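/- Let $n\ge 4$. For $i\ge 1$ let $\mathcal O(1,2i)$ be the even free field vertex algebra over $\mathbb C$ freely generated by one even field $W^i$ of weight $i$ with operator product $W^i(z)W^i(w)\sim (z-w)^{-2i}$, and let $$\mathcal W^{\mathrm{free}}(\mathfrak{sl}_n)=\bigotimes_{i=2}^{n}\mathcal O(1,2i)$$ be the free field (large level) limit of $\mathcal W^k(\mathfrak{sl}_n)$. Let $\mathbb Z_2$ act on it by the vertex algebra automorphism $\theta$ with $\theta(W^i)=(-1)^iW^i$ for $2\le i\le n$, and let $\mathcal W^{\mathrm{free}}(\mathfrak{sl}_n)^{\mathbb Z_2}$ be the orbifold, that is, the vertex subalgebra of $\theta$-fixed elements. For odd $p,q$ with $3\le p,q\le n$ and $a,b\ge 0$ put $U^{p,q}_{a,b}={:}(\partial^aW^{p})(\partial^bW^{q}){:}$. A subset $S$ of a vertex algebra $\mathcal V$ is a strong generating set if $\mathcal V$ is spanned by the normally ordered monomials ${:}\partial^{k_1}\alpha_1\cdots\partial^{k_r}\alpha_r{:}$ with $r\ge 0$, $k_1,\dots,k_r\ge 0$ and $\alpha_1,\dots,\alpha_r\in S$; it is minimal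 if no proper subset of $S$ is a strong generating set. Then $\mathcal W^{\mathrm{free}}(\mathfrak{sl}_n)^{\mathbb Z_2}$ has the minimal strong generating set $T$ consisting of 1. $W^{2i}$, for $1\le i\le \frac n2$, 2. $U^{3,3}_{0,2a}$, for $a=0,1,2,3$, 3. $U^{3,2i+1}_{0,a}$, for $2\le i<\frac n2$ and $a=0,1,2,3,4,5,6$, 4. $U^{2i+1,2i+1}_{0,2a}$, for $2\le i<\frac n2$ and $a=0,1,2$, 5. $U^{2i+1,2j+1}_{0,a}$, for $2\le i<j<\frac n2$ and $a=0,1,2,3,4,5$. -/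

import Mathlib

open VertexOperator

/-- A vertex algebra over `ℂ` (all states even): a vector space `V` with a vacuum `vac`, a
translation operator `T` and a state-field correspondence `Y`, where `ncoeff (Y a) n b` is the
`n`-th product of `a` and `b`, i.e. the coefficient of `z ^ (-n - 1)` in `Y(a, z) b`.
That `Y(a, z) b` is a Laurent series is part of the type `VertexOperator ℂ V`.
Locality says `(z - w) ^ N [Y(a, z), Y(b, w)] = 0` for some `N`, coefficient by coefficient. -/
structure VertexAlgebra (V : Type*) [AddCommGroup V] [Module ℂ V] where
  vac : V
  T : Module.End ℂ V
  Y : V →ₗ[ℂ] VertexOperator ℂ V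
  Y_vac : ∀ (n : ℤ) (b : V), ncoeff (Y vac) n b = if n = -1 then b else 0
  Y_creation : ∀ (a : V) (n : ℤ), 0 ≤ n → ncoeff (Y a) n vac = 0
  Y_creation_neg_one : ∀ a : V, ncoeff (Y a) (-1) vac = a
  T_vac : T vac = 0
  translation : ∀ (a : V) (n : ℤ) (b : V),
    T (ncoeff (Y a) n b) - ncoeff (Y a) n (T b) = (-n : ℂ) • ncoeff (Y a) (n - 1) b
  locality : ∀ a b : V, ∃ N : ℕ, ∀ (m n : ℤ) (c : V),
    ∑ j ∈ Finset.range (N + 1), ((-1) ^ j * (N.choose j : ℂ)) •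
      (ncoeff (Y a) (m + N - j) (ncoeff (Y b) (n + j) c) -
        ncoeff (Y b) (n + j) (ncoeff (Y a) (m + N - j) c)) = 0

namespace VertexAlgebra

/-- A vertex subalgebra: a subspace that contains the vacuum and is closed under all products. -/
structure Subalgebra {V : Type*} [AddCommGroup V] [Module ℂ V] (A : VertexAlgebra V)
    extends Submodule ℂ V where
  vac_mem : A.vac ∈ carrier
  ncoeff_mem : ∀ a ∈ carrier, ∀ (n : ℤ), ∀ b ∈ carrier, ncoeff (A.Y a) n b ∈ carrier

/-- A vertex algebra automorphism: a linear automorphism that fixes the vacuum and preserves all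
products. -/
structure Automorphism {V : Type*} [AddCommGroup V] [Module ℂ V] (A : VertexAlgebra V)
    extends V ≃ₗ[ℂ] V where
  map_vac : toFun A.vac = A.vac
  map_ncoeff : ∀ (a : V) (n : ℤ) (b : V),
    toFun (ncoeff (A.Y a) n b) = ncoeff (A.Y (toFun a)) n (toFun b)

/-- The orbifold: the vertex subalgebra of all states that the automorphism `θ` fixes. -/
def orbifold {V : Type*} [AddCommGroup V] [Module ℂ V] (A : VertexAlgebra V)
    (θ : A.Automorphism) : A.Subalgebra where
  carrier := {v | θ.toLinearEquiv v = v}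
  add_mem' ha hb := by
    rw [Set.mem_ofPred_eq] at ha hb ⊢
    rw [map_add, ha, hb]
  zero_mem' := map_zero _
  smul_mem' r v hv := by
    rw [Set.mem_ofPred_eq] at hv ⊢
    rw [map_smul, hv]
  vac_mem := θ.map_vac
  ncoeff_mem a ha n b hb := by
    have h := θ.map_ncoeff a n b
    change θ.toLinearEquiv _ = ncoeff (A.Y (θ.toLinearEquiv a)) n (θ.toLinearEquiv b) at h
    rw [Set.mem_ofPred_eq] at ha hb ⊢
    rw [h, ha, hb]

/-- The normally ordered (Wick) product `:ab: = a_(-1) b`. -/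
def wick {V : Type*} [AddCommGroup V] [Module ℂ V] (A : VertexAlgebra V) (a b : V) : V :=
  ncoeff (A.Y a) (-1) b

/-- The normally ordered monomials `:(∂^{k₁} a₁) (∂^{k₂} a₂) ⋯ (∂^{kᵣ} aᵣ):` with all `aᵢ ∈ S`,
`r ≥ 0`, where iterated products are nested to the right and `∂` is the translation operator. -/
inductive IsMonomial {V : Type*} [AddCommGroup V] [Module ℂ V] (A : VertexAlgebra V)
    (S : Set V) : V → Prop
  | vac : IsMonomial A S A.vac
  | wick (a : V) (ha : a ∈ S) (k : ℕ) (b : V) (hb : IsMonomial A S b) :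
      IsMonomial A S (A.wick ((A.T ^ k) a) b)

/-- `S` strongly generates the vertex subalgebra `U`: it lies in `U`, and `U` is the span of the
normally ordered monomials in the elements of `S` and their derivatives. -/
def Subalgebra.IsStrongGeneratingSet {V : Type*} [AddCommGroup V] [Module ℂ V]
    {A : VertexAlgebra V} (U : A.Subalgebra) (S : Set V) : Prop :=
  S ⊆ U.toSubmodule ∧ Submodule.span ℂ {v | A.IsMonomial S v} = U.toSubmodule

/-- A strong generating set none of whose proper subsets is a strong generating set. -/
def Subalgebra.IsMinimalStrongGeneratingSet {V : Type*} [AddCommGroup V] [Module ℂ V]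
    {A : VertexAlgebra V} (U : A.Subalgebra) (S : Set V) : Prop :=
  Minimal U.IsStrongGeneratingSet S

end VertexAlgebra

namespace FreeField

open MvPolynomial

/-- The Fock space with one creation variable `x_{i,k} = X (i, k)` for each `k ≥ 0` and each
generator `W i`; `x_{i,k}` stands for the mode `W i _(-k-1)` and the monomials in the `x_{i,k}`
are the corresponding states created from the vacuum `1`. -/
abbrev Fock (ι : Type*) := MvPolynomial (ι × ℕ) ℂ

theorem ncoeff_ext {ι : Type*} {A B : VertexOperator ℂ (Fock ι)}
    (h : ∀ (n : ℤ) v, ncoeff A n v = ncoeff B n v) : A = B := by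
  apply HVertexOperator.coeff_inj
  funext n
  apply LinearMap.ext
  intro v
  have := h (-n - 1) v
  rwa [VertexOperator.ncoeff_apply, VertexOperator.ncoeff_apply,
    show -(-n-1)-1 = n by ring] at this

theorem exists_bound {ι : Type*} (B : VertexOperator ℂ (Fock ι)) (v : Fock ι) :
    ∃ M : ℤ, ∀ n, M ≤ n → ncoeff B n v = 0 := by
  refine ⟨-((HahnModule.of ℂ).symm (B v)).order, fun n hn => ?_⟩
  apply VertexOperator.ncoeff_eq_zero_of_lt_order
  lia

theorem exists_bound' {ι : Type*} (B : VertexOperator ℂ (Fock ι)) (v : Fock ι) (n : ℤ) :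
    ∃ M : ℕ, ∀ j : ℕ, M ≤ j → ncoeff B (n + j) v = 0 := by
  obtain ⟨M, hM⟩ := exists_bound B v
  exact ⟨(M - n).toNat, fun j hj => hM _ (by lia)⟩

theorem pderiv_bound {ι : Type*} (i : ι) (v : Fock ι) :
    ∃ M : ℕ, ∀ l : ℕ, M ≤ l → pderiv (i, l) v = 0 := by
  classical
  obtain ⟨M, hM⟩ := (v.vars.image Prod.snd).bddAbove
  refine ⟨M + 1, fun l hl => pderiv_eq_zero_of_notMem_vars fun h => ?_⟩
  have := hM (Finset.mem_coe.2 (Finset.mem_image_of_mem Prod.snd h))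
  simp only at this
  lia

theorem pderiv_comm {ι : Type*} (p q : ι × ℕ) (v : Fock ι) :
    pderiv p (pderiv q v) = pderiv q (pderiv p v) := by
  classical
  have h : ⁅(pderiv p : Derivation ℂ (Fock ι) (Fock ι)),
      (pderiv q : Derivation ℂ (Fock ι) (Fock ι))⁆ = 0 := by
    apply MvPolynomial.derivation_ext (σ := ι × ℕ) (R := ℂ) (A := Fock ι)
    intro r
    simp [Derivation.commutator_apply, pderiv_X, Pi.single_apply, apply_ite]
  have := DFunLike.congr_fun h v
  rw [Derivation.commutator_apply] at this
  exact sub_eq_zero.1 this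

theorem fin_of_bound {M : Type*} [AddCommGroup M] {f : ℕ → M} (h : ∃ K, ∀ j, K ≤ j → f j = 0) :
    Function.HasFiniteSupport f := by
  obtain ⟨K, hK⟩ := h
  refine (Set.finite_lt_nat K).subset fun j hj => ?_
  by_contra h
  exact hj (hK j (not_lt.1 h))

theorem finsum_range {M : Type*} [AddCommGroup M] {f : ℕ → M} (K : ℕ)
    (hK : ∀ j, K ≤ j → f j = 0) : ∑ᶠ j, f j = ∑ j ∈ Finset.range K, f j := by
  apply finsum_eq_sum_of_support_subset
  intro j hj
  simp only [Finset.coe_range, Set.mem_Iio]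
  by_contra h
  exact hj (hK j (not_lt.1 h))

theorem finsum_swap {M : Type*} [AddCommGroup M] {f : ℕ → ℕ → M}
    (h : ∃ K, ∀ i j, K ≤ i ∨ K ≤ j → f i j = 0) :
    ∑ᶠ i, ∑ᶠ j, f i j = ∑ᶠ j, ∑ᶠ i, f i j := by
  obtain ⟨K, hK⟩ := h
  have h1 : ∀ i, ∑ᶠ j, f i j = ∑ j ∈ Finset.range K, f i j := fun i =>
    finsum_range K fun j hj => hK i j (Or.inr hj)
  have h2 : ∀ j, ∑ᶠ i, f i j = ∑ i ∈ Finset.range K, f i j := fun i =>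
    finsum_range K fun j hj => hK j i (Or.inl hj)
  simp only [h1, h2]
  rw [finsum_range K, finsum_range K, Finset.sum_comm]
  · intro j hj; exact Finset.sum_eq_zero fun i _ => hK _ _ (Or.inr hj)
  · intro j hj; exact Finset.sum_eq_zero fun i _ => hK _ _ (Or.inl hj)

theorem finsum_succ {M : Type*} [AddCommGroup M] {f : ℕ → M} (h : ∃ K, ∀ j, K ≤ j → f j = 0) :
    ∑ᶠ j, f j = f 0 + ∑ᶠ j, f (j + 1) := by
  obtain ⟨K, hK⟩ := h
  rw [finsum_range (K + 1) (fun j hj => hK j (by lia)), finsum_range K (fun j hj => hK _ (by lia)),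
    Finset.sum_range_succ']
  abel

/-- The modes of `creation i k B`. -/
noncomputable def creationMode {ι : Type*} (i : ι) (k : ℕ) (B : VertexOperator ℂ (Fock ι)) (n : ℤ) :
    Module.End ℂ (Fock ι) where
  toFun v := ∑ᶠ j : ℕ, ((k + j).choose k : ℂ) • (X (i, k + j) * ncoeff B (n + j) v)
  map_add' u v := by
    obtain ⟨M, hM⟩ := exists_bound' B u n
    obtain ⟨N, hN⟩ := exists_bound' B v n
    rw [← finsum_add_distrib (fin_of_bound ⟨M, fun j hj => by rw [hM j hj, mul_zero, smul_zero]⟩)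
      (fin_of_bound ⟨N, fun j hj => by rw [hN j hj, mul_zero, smul_zero]⟩)]
    simp [mul_add]
  map_smul' r v := by
    rw [RingHom.id_apply, smul_finsum]
    simp only [map_smul, mul_smul_comm, smul_comm r]

theorem creationMode_apply {ι : Type*} (i : ι) (k : ℕ) (B : VertexOperator ℂ (Fock ι)) (n : ℤ)
    (v : Fock ι) : creationMode i k B n v =
      ∑ᶠ j : ℕ, ((k + j).choose k : ℂ) • (X (i, k + j) * ncoeff B (n + j) v) := rfl

theorem creationMode_bdd {ι : Type*} (i : ι) (k : ℕ) (B : VertexOperator ℂ (Fock ι)) (v : Fock ι) :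
    BddBelow (Function.support fun y : ℤ => creationMode i k B (-y - 1) v) := by
  obtain ⟨M, hM⟩ := exists_bound B v
  refine ⟨-M - 1, fun y hy => ?_⟩
  by_contra h
  apply hy
  simp only [creationMode_apply]
  apply finsum_eq_zero_of_forall_eq_zero
  intro j
  rw [hM _ (by lia), mul_zero, smul_zero]

/-- Multiplication of a field `B(z)` on the left by `(1 / k!) ∂^k W i (z)_+`, where
`W i (z)_+ = ∑_{j ≥ 0} x_{i,j} z^j` is the creation part of `W i (z)`. -/
noncomputable def creation {ι : Type*} (i : ι) (k : ℕ) :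
    Module.End ℂ (VertexOperator ℂ (Fock ι)) where
  toFun B := VertexOperator.of_coeff (fun y => creationMode i k B (-y - 1)) (creationMode_bdd i k B)
  map_add' A B := by
    apply ncoeff_ext
    intro n v
    rw [map_add, Pi.add_apply, LinearMap.add_apply]
    simp only [ncoeff_of_coeff]
    generalize -(-n - 1) - 1 = n
    simp only [creationMode_apply]
    obtain ⟨M, hM⟩ := exists_bound' A v n
    obtain ⟨N, hN⟩ := exists_bound' B v n
    rw [← finsum_add_distrib (fin_of_bound ⟨M, fun j hj => by rw [hM j hj, mul_zero, smul_zero]⟩)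
      (fin_of_bound ⟨N, fun j hj => by rw [hN j hj, mul_zero, smul_zero]⟩)]
    simp [mul_add]
  map_smul' r A := by
    apply ncoeff_ext
    intro n v
    rw [RingHom.id_apply, map_smul, Pi.smul_apply, LinearMap.smul_apply]
    simp only [ncoeff_of_coeff]
    generalize -(-n - 1) - 1 = n
    simp only [creationMode_apply]
    rw [smul_finsum]
    simp only [map_smul, Pi.smul_apply, LinearMap.smul_apply, mul_smul_comm, smul_comm r]

theorem creation_apply {ι : Type*} (i : ι) (k : ℕ) (B : VertexOperator ℂ (Fock ι)) (n : ℤ)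
    (v : Fock ι) : ncoeff (creation i k B) n v =
      ∑ᶠ j : ℕ, ((k + j).choose k : ℂ) • (X (i, k + j) * ncoeff B (n + j) v) := by
  change ncoeff (VertexOperator.of_coeff (fun y => creationMode i k B (-y - 1))
    (creationMode_bdd i k B)) n v = _
  rw [ncoeff_of_coeff, show -(-n - 1) - 1 = n by ring, creationMode_apply]

/-- The annihilation part of `W i (z)` is `W i (z)_- = ∑_{l ≥ 0} C(l + d, d) z^{-l-d-1} ∂/∂x_{i,l}`,
where the pole of `W i (z) W i (w)` has order `d + 1`; `coef d k l` is the coefficient of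
`z^{-k-l-d-1} ∂/∂x_{i,l}` in `(1 / k!) ∂^k W i (z)_-`. -/
def coef (d k l : ℕ) : ℂ := (-1) ^ k * (((k + l + d).choose k * (l + d).choose d : ℕ) : ℂ)

/-- The modes of `annihilation d i k B`. -/
noncomputable def annihilationMode {ι : Type*} (d : ℕ) (i : ι) (k : ℕ)
    (B : VertexOperator ℂ (Fock ι)) (n : ℤ) : Module.End ℂ (Fock ι) where
  toFun v := ∑ᶠ l : ℕ, coef d k l • ncoeff B (n - k - l - d - 1) (pderiv (i, l) v)
  map_add' u v := by
    obtain ⟨M, hM⟩ := pderiv_bound i u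
    obtain ⟨N, hN⟩ := pderiv_bound i v
    rw [← finsum_add_distrib (fin_of_bound ⟨M, fun j hj => by rw [hM j hj, map_zero, smul_zero]⟩)
      (fin_of_bound ⟨N, fun j hj => by rw [hN j hj, map_zero, smul_zero]⟩)]
    simp
  map_smul' r v := by
    rw [RingHom.id_apply, smul_finsum]
    simp only [map_smul, Derivation.map_smul, smul_comm r]

theorem annihilationMode_apply {ι : Type*} (d : ℕ) (i : ι) (k : ℕ) (B : VertexOperator ℂ (Fock ι))
    (n : ℤ) (v : Fock ι) : annihilationMode d i k B n v =
      ∑ᶠ l : ℕ, coef d k l • ncoeff B (n - k - l - d - 1) (pderiv (i, l) v) := rfl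

theorem annihilationMode_bdd {ι : Type*} (d : ℕ) (i : ι) (k : ℕ) (B : VertexOperator ℂ (Fock ι))
    (v : Fock ι) :
    BddBelow (Function.support fun y : ℤ => annihilationMode d i k B (-y - 1) v) := by
  obtain ⟨L, hL⟩ := pderiv_bound i v
  choose K hK using fun l => exists_bound B (pderiv (i, l) v)
  obtain ⟨K', hK'⟩ := ((Finset.range L).image fun l => K l + k + l + d + 1).bddAbove
  refine ⟨-K' - 1, fun y hy => ?_⟩
  by_contra h
  apply hy
  simp only [annihilationMode_apply]
  apply finsum_eq_zero_of_forall_eq_zero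
  intro l
  by_cases hl : L ≤ l
  · rw [hL l hl, map_zero, smul_zero]
  · rw [hK l, smul_zero]
    have : K l + k + l + d + 1 ≤ K' := hK' (by
      rw [Finset.mem_coe, Finset.mem_image]
      exact ⟨l, Finset.mem_range.2 (not_le.1 hl), rfl⟩)
    lia

/-- Multiplication of a field `B(z)` on the right by `(1 / k!) ∂^k W i (z)_-`, where `W i (z)_-` is
the annihilation part of `W i (z)`. -/
noncomputable def annihilation {ι : Type*} (d : ℕ) (i : ι) (k : ℕ) :
    Module.End ℂ (VertexOperator ℂ (Fock ι)) where
  toFun B := VertexOperator.of_coeff (fun y => annihilationMode d i k B (-y - 1))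
    (annihilationMode_bdd d i k B)
  map_add' A B := by
    apply ncoeff_ext
    intro n v
    rw [map_add, Pi.add_apply, LinearMap.add_apply]
    simp only [ncoeff_of_coeff]
    generalize -(-n - 1) - 1 = n
    simp only [annihilationMode_apply]
    obtain ⟨M, hM⟩ := pderiv_bound i v
    rw [← finsum_add_distrib (fin_of_bound ⟨M, fun j hj => by rw [hM j hj, map_zero, smul_zero]⟩)
      (fin_of_bound ⟨M, fun j hj => by rw [hM j hj, map_zero, smul_zero]⟩)]
    simp
  map_smul' r A := by
    apply ncoeff_ext
    intro n v
    rw [RingHom.id_apply, map_smul, Pi.smul_apply, LinearMap.smul_apply]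
    simp only [ncoeff_of_coeff]
    generalize -(-n - 1) - 1 = n
    simp only [annihilationMode_apply]
    rw [smul_finsum]
    simp only [map_smul, Pi.smul_apply, LinearMap.smul_apply, smul_comm r]

theorem annihilation_apply {ι : Type*} (d : ℕ) (i : ι) (k : ℕ) (B : VertexOperator ℂ (Fock ι))
    (n : ℤ) (v : Fock ι) : ncoeff (annihilation d i k B) n v =
      ∑ᶠ l : ℕ, coef d k l • ncoeff B (n - k - l - d - 1) (pderiv (i, l) v) := by
  change ncoeff (VertexOperator.of_coeff (fun y => annihilationMode d i k B (-y - 1))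
    (annihilationMode_bdd d i k B)) n v = _
  rw [ncoeff_of_coeff, show -(-n - 1) - 1 = n by ring, annihilationMode_apply]

/-- The normally ordered product `:(1 / k!) (∂^k W i (z)) B(z):`, for `p = (i, k)`, where the
pole of `W i (z) W i (w)` has order `d i + 1`. -/
noncomputable def normalOrder {ι : Type*} (d : ι → ℕ) (p : ι × ℕ) :
    Module.End ℂ (VertexOperator ℂ (Fock ι)) :=
  creation p.1 p.2 + annihilation (d p.1) p.1 p.2

theorem creation_creation {ι : Type*} (i i' : ι) (k k' : ℕ) (B : VertexOperator ℂ (Fock ι)) :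
    creation i k (creation i' k' B) = creation i' k' (creation i k B) := by
  apply ncoeff_ext
  intro n v
  simp only [creation_apply]
  obtain ⟨M, hM⟩ := exists_bound' B v n
  have key : ∀ (i i' : ι) (k k' j : ℕ), ((k + j).choose k : ℂ) • (X (i, k + j) *
      ∑ᶠ j' : ℕ, ((k' + j').choose k' : ℂ) • (X (i', k' + j') * ncoeff B (n + j + j') v)) =
      ∑ᶠ j' : ℕ, (((k + j).choose k : ℂ) * ((k' + j').choose k' : ℂ)) •
        (X (i, k + j) * X (i', k' + j') * ncoeff B (n + (j + j' : ℕ)) v) := by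
    intro i i' k k' j
    rw [mul_finsum' _ _ (fin_of_bound ⟨M, fun l hl => by
      rw [add_assoc, ← Nat.cast_add, hM (j + l) (by lia), mul_zero, smul_zero]⟩), smul_finsum]
    apply finsum_congr
    intro l
    rw [mul_smul_comm, smul_smul, mul_assoc, Nat.cast_add, add_assoc]
  simp only [key]
  rw [finsum_swap ⟨M, fun a b hab => by rw [hM (a + b) (by lia), mul_zero, smul_zero]⟩]
  refine finsum_congr fun j => finsum_congr fun l => ?_
  rw [mul_comm (X _ : Fock ι), mul_comm (_ : ℂ), add_comm j l]

theorem annihilation_annihilation {ι : Type*} (d d' : ℕ) (i i' : ι) (k k' : ℕ)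
    (B : VertexOperator ℂ (Fock ι)) :
    annihilation d i k (annihilation d' i' k' B) = annihilation d' i' k' (annihilation d i k B) := by
  apply ncoeff_ext
  intro n v
  simp only [annihilation_apply, smul_finsum]
  obtain ⟨M, hM⟩ := pderiv_bound i v
  obtain ⟨M', hM'⟩ := pderiv_bound i' v
  have comm := fun p q => pderiv_comm p q v
  rw [finsum_swap ⟨max M M', fun a b hab => ?_⟩]
  · refine finsum_congr fun j => finsum_congr fun l => ?_
    rw [smul_comm, comm, show n - k - l - d - 1 - k' - j - d' - 1 =
      n - k' - j - d' - 1 - (k : ℤ) - l - d - 1 by ring]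
  · rcases hab with h | h
    · rw [hM a (by lia)]; simp
    · rw [comm, hM' b (by lia)]; simp

theorem creation_annihilation {ι : Type*} (d : ℕ) (i i' : ι) (k k' : ℕ)
    (B : VertexOperator ℂ (Fock ι)) :
    creation i k (annihilation d i' k' B) = annihilation d i' k' (creation i k B) := by
  apply ncoeff_ext
  intro n v
  simp only [annihilation_apply, creation_apply, smul_finsum]
  obtain ⟨M, hM⟩ := pderiv_bound i' v
  choose K hK using fun l => exists_bound' B (pderiv (i', l) v) (n - k' - l - d - 1)
  obtain ⟨K', hK'⟩ := ((Finset.range M).image K).bddAbove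
  have key : ∀ j : ℕ, ((k + j).choose k : ℂ) • (X (i, k + j) * ∑ᶠ l : ℕ, coef d k' l •
      ncoeff B (n + j - k' - l - d - 1) (pderiv (i', l) v)) =
      ∑ᶠ l : ℕ, ((k + j).choose k : ℂ) • coef d k' l • (X (i, k + j) *
        ncoeff B (n - k' - l - d - 1 + j) (pderiv (i', l) v)) := by
    intro j
    rw [mul_finsum' _ _ (fin_of_bound ⟨M, fun l hl => by simp [hM l hl]⟩), smul_finsum]
    refine finsum_congr fun l => ?_
    rw [mul_smul_comm]
    rw [show n + j - k' - l - d - 1 = n - k' - l - d - 1 + (j : ℤ) by ring]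
  simp only [key]
  rw [finsum_swap ⟨max M K', fun a b hab => ?_⟩]
  · refine finsum_congr fun j => finsum_congr fun l => ?_
    rw [smul_comm]
  · by_cases hb : M ≤ b
    · simp [hM b hb]
    · have : K b ≤ K' := hK' (by
        rw [Finset.mem_coe, Finset.mem_image]
        exact ⟨b, Finset.mem_range.2 (not_le.1 hb), rfl⟩)
      rw [hK b a (by lia)]; simp

theorem normalOrder_comm {ι : Type*} (d : ι → ℕ) (p q : ι × ℕ) :
    normalOrder d p * normalOrder d q = normalOrder d q * normalOrder d p := by
  apply LinearMap.ext
  intro B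
  simp only [normalOrder, Module.End.mul_apply, LinearMap.add_apply, map_add]
  rw [creation_creation, annihilation_annihilation, creation_annihilation, creation_annihilation]
  abel

open IsMulCommutative in
/-- The commuting operators `normalOrder d p` on fields extend to an action of polynomials. -/
noncomputable def normalOrderHom {ι : Type*} (d : ι → ℕ) :
    Fock ι →ₐ[ℂ] Module.End ℂ (VertexOperator ℂ (Fock ι)) :=
  haveI : IsMulCommutative (Algebra.adjoin ℂ (Set.range (normalOrder d))) :=
    Algebra.isMulCommutative_adjoin ℂ (by
      rintro _ ⟨p, rfl⟩ _ ⟨q, rfl⟩; exact normalOrder_comm d p q)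
  (Algebra.adjoin ℂ (Set.range (normalOrder d))).val.comp
    (aeval (R := ℂ) (S₁ := Algebra.adjoin ℂ (Set.range (normalOrder d))) fun p => ⟨normalOrder d p, Algebra.subset_adjoin ⟨p, rfl⟩⟩)

open IsMulCommutative in
theorem normalOrderHom_X {ι : Type*} (d : ι → ℕ) (p : ι × ℕ) :
    normalOrderHom d (X p) = normalOrder d p := by
  simp [normalOrderHom]

theorem idOp_bdd (ι : Type*) (v : Fock ι) : BddBelow (Function.support
    fun y : ℤ => (if y = 0 then 1 else 0 : Module.End ℂ (Fock ι)) v) :=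
  ⟨0, fun y hy => by by_contra h; exact hy (by simp [(not_le.1 h).ne])⟩

/-- The identity field. -/
noncomputable def idOp (ι : Type*) : VertexOperator ℂ (Fock ι) :=
  VertexOperator.of_coeff (fun y => if y = 0 then 1 else 0) (idOp_bdd ι)

/-- The state-field correspondence: the monomial `x_{i₁,k₁} ⋯ x_{iᵣ,kᵣ}` is sent to the normally
ordered field `:(1 / k₁!) (∂^{k₁} W i₁ (z)) ⋯ (1 / kᵣ!) (∂^{kᵣ} W iᵣ (z)):`. -/
noncomputable def Y {ι : Type*} (d : ι → ℕ) : Fock ι →ₗ[ℂ] VertexOperator ℂ (Fock ι) :=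
  (LinearMap.applyₗ (idOp ι)).comp (normalOrderHom d).toLinearMap

theorem Y_one {ι : Type*} (d : ι → ℕ) : Y d 1 = idOp ι := by simp [Y]

theorem Y_X_mul {ι : Type*} (d : ι → ℕ) (p : ι × ℕ) (a : Fock ι) :
    Y d (X p * a) = normalOrder d p (Y d a) := by simp [Y, normalOrderHom_X]

theorem idOp_apply {ι : Type*} (n : ℤ) (v : Fock ι) :
    ncoeff (idOp ι) n v = if n = -1 then v else 0 := by
  rw [idOp, ncoeff_of_coeff]
  by_cases h : n = -1
  · subst h
    simp
  · have : ¬ (-n - 1 = 0) := by lia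
    rw [if_neg h, if_neg this, LinearMap.zero_apply]

theorem fock_induction {ι : Type*} {P : Fock ι → Prop} (one : P 1)
    (add : ∀ a b, P a → P b → P (a + b)) (smul : ∀ (r : ℂ) a, P a → P (r • a))
    (mul : ∀ p a, P a → P (X p * a)) (a : Fock ι) : P a := by
  induction a using MvPolynomial.induction_on with
  | C r =>
    have := smul r 1 one
    rwa [MvPolynomial.smul_eq_C_mul, mul_one] at this
  | add a b ha hb => exact add a b ha hb
  | mul_X a p ha => rw [mul_comm]; exact mul p a ha

open Filter in
theorem creation_ev {ι : Type*} (i : ι) (k : ℕ) (B : VertexOperator ℂ (Fock ι)) (n : ℤ)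
    (v : Fock ι) : ∀ᶠ M : ℕ in atTop, ncoeff (creation i k B) n v =
      ∑ j ∈ Finset.range M, ((k + j).choose k : ℂ) • (X (i, k + j) * ncoeff B (n + j) v) := by
  obtain ⟨K, hK⟩ := exists_bound' B v n
  filter_upwards [eventually_ge_atTop K] with M hM
  rw [creation_apply, finsum_range M fun j hj => by rw [hK j (by lia), mul_zero, smul_zero] ]

open Filter in
theorem annihilation_ev {ι : Type*} (d : ℕ) (i : ι) (k : ℕ) (B : VertexOperator ℂ (Fock ι))
    (n : ℤ) (v : Fock ι) : ∀ᶠ M : ℕ in atTop, ncoeff (annihilation d i k B) n v =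
      ∑ l ∈ Finset.range M, coef d k l • ncoeff B (n - k - l - d - 1) (pderiv (i, l) v) := by
  obtain ⟨K, hK⟩ := pderiv_bound i v
  filter_upwards [eventually_ge_atTop K] with M hM
  rw [annihilation_apply, finsum_range M fun j hj => by rw [hK j (by lia), map_zero, smul_zero] ]

open Filter in
theorem normalOrder_ev {ι : Type*} (d : ι → ℕ) (p : ι × ℕ) (B : VertexOperator ℂ (Fock ι))
    (n : ℤ) (v : Fock ι) : ∀ᶠ M : ℕ in atTop, ncoeff (normalOrder d p B) n v =
      ∑ j ∈ Finset.range M, ((p.2 + j).choose p.2 : ℂ) • (X (p.1, p.2 + j) * ncoeff B (n + j) v) +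
      ∑ l ∈ Finset.range M,
        coef (d p.1) p.2 l • ncoeff B (n - p.2 - l - d p.1 - 1) (pderiv (p.1, l) v) := by
  filter_upwards [creation_ev p.1 p.2 B n v, annihilation_ev (d p.1) p.1 p.2 B n v] with M h1 h2
  rw [normalOrder, LinearMap.add_apply, map_add, Pi.add_apply, LinearMap.add_apply, h1, h2]

/-- creation axiom -/
theorem Y_creation {ι : Type*} (d : ι → ℕ) (a : Fock ι) :
    (∀ n : ℤ, 0 ≤ n → ncoeff (Y d a) n 1 = 0) ∧ ncoeff (Y d a) (-1) 1 = a := by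
  induction a using fock_induction with
  | one =>
    refine ⟨fun n hn => ?_, ?_⟩
    · rw [Y_one, idOp_apply, if_neg (by lia)]
    · rw [Y_one, idOp_apply, if_pos rfl]
  | add a b ha hb =>
    refine ⟨fun n hn => ?_, ?_⟩
    · rw [map_add, map_add, Pi.add_apply, LinearMap.add_apply, ha.1 n hn, hb.1 n hn, add_zero]
    · rw [map_add, map_add, Pi.add_apply, LinearMap.add_apply, ha.2, hb.2]
  | smul r a ha =>
    refine ⟨fun n hn => ?_, ?_⟩
    · rw [map_smul, map_smul, Pi.smul_apply, LinearMap.smul_apply, ha.1 n hn, smul_zero]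
    · rw [map_smul, map_smul, Pi.smul_apply, LinearMap.smul_apply, ha.2]
  | mul p a ha =>
    refine ⟨fun n hn => ?_, ?_⟩
    · obtain ⟨M, hM⟩ := (normalOrder_ev d p (Y d a) n 1).exists
      rw [Y_X_mul, hM, Finset.sum_eq_zero, Finset.sum_eq_zero, add_zero]
      · intro l _; rw [Derivation.map_one_eq_zero, map_zero, smul_zero]
      · intro j _; rw [ha.1 _ (by lia), mul_zero, smul_zero]
    · obtain ⟨M, hM, hM1⟩ := ((normalOrder_ev d p (Y d a) (-1) 1).and
        (Filter.eventually_ge_atTop 1)).exists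
      rw [Y_X_mul, hM, Finset.sum_eq_single 0, Finset.sum_eq_zero, add_zero]
      · simp [ha.2]
      · intro l _; rw [Derivation.map_one_eq_zero, map_zero, smul_zero]
      · intro j _ hj; rw [ha.1 _ (by lia), mul_zero, smul_zero]
      · intro h; simp at h; lia

/-- The translation operator, the derivation with `T x_{i,k} = (k + 1) x_{i,k+1}`. -/
noncomputable def translation (ι : Type*) : Derivation ℂ (Fock ι) (Fock ι) :=
  mkDerivation ℂ fun p => ((p.2 + 1 : ℕ) : ℂ) • X (p.1, p.2 + 1)

theorem translation_X {ι : Type*} (i : ι) (k : ℕ) :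
    translation ι (X (i, k)) = ((k + 1 : ℕ) : ℂ) • X (i, k + 1) := by
  rw [translation, mkDerivation_X]

theorem pderiv_translation {ι : Type*} (i : ι) (l : ℕ) (v : Fock ι) :
    pderiv (i, l) (translation ι v) =
      translation ι (pderiv (i, l) v) + (l : ℂ) • pderiv (i, l - 1) v := by
  classical
  have h : ⁅(pderiv (i, l) : Derivation ℂ (Fock ι) (Fock ι)), translation ι⁆ =
      (l : ℂ) • (pderiv (i, l - 1) : Derivation ℂ (Fock ι) (Fock ι)) := by
    apply MvPolynomial.derivation_ext (σ := ι × ℕ) (R := ℂ) (A := Fock ι)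
    rintro ⟨i', k⟩
    rw [Derivation.commutator_apply, translation_X, Derivation.map_smul, pderiv_X,
      Derivation.smul_apply, pderiv_X, pderiv_X]
    simp only [Pi.single_apply, Prod.mk.injEq, apply_ite, Derivation.map_one_eq_zero, map_zero,
      ite_self, sub_zero]
    rcases l with _ | l
    · simp
    · by_cases h : i' = i ∧ k = l
      · simp [h]
      · rw [if_neg (by simpa using h), if_neg (by simpa using h), smul_zero, smul_zero]
  have := DFunLike.congr_fun h v
  rw [Derivation.commutator_apply, Derivation.smul_apply, sub_eq_iff_eq_add'] at this
  exact this

theorem coef_succ_right (d k l : ℕ) :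
    ((l : ℂ) + 1) * coef d k (l + 1) = (k + l + d + 1) * coef d k l := by
  have h1 := Nat.choose_mul_succ_eq (k + l + d) k
  have h2 := Nat.choose_mul_succ_eq (l + d) d
  rw [show k + l + d + 1 - k = l + d + 1 by lia] at h1
  rw [show l + d + 1 - d = l + 1 by lia] at h2
  have h1' : ((k + l + d).choose k : ℂ) * (k + l + d + 1) =
    (k + l + d + 1).choose k * (l + d + 1) := by exact_mod_cast h1
  have h2' : ((l + d).choose d : ℂ) * (l + d + 1) =
    (l + d + 1).choose d * (l + 1) := by exact_mod_cast h2
  simp only [coef, Nat.cast_mul]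
  rw [show k + (l + 1) + d = k + l + d + 1 by lia, show l + 1 + d = l + d + 1 by lia]
  linear_combination (-1) ^ k * (-((k + l + d + 1).choose k : ℂ) * h2' -((l + d).choose d : ℂ) * h1')

theorem coef_succ_left (d k l : ℕ) :
    ((k : ℂ) + 1) * coef d (k + 1) l = -((k + l + d + 1) * coef d k l) := by
  have h1 := Nat.add_one_mul_choose_eq (k + l + d) k
  have h1' : ((k + l + d : ℂ) + 1) * (k + l + d).choose k =
    (k + l + d + 1).choose (k + 1) * (k + 1) := by exact_mod_cast h1
  simp only [coef, Nat.cast_mul]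
  rw [show k + 1 + l + d = k + l + d + 1 by lia]
  linear_combination (-1) ^ k * ((l + d).choose d : ℂ) * h1'

theorem choose_succ (k j : ℕ) :
    ((k : ℂ) + j + 1) * ((k + j).choose k : ℂ) = (j + 1) * ((k + (j + 1)).choose k : ℂ) := by
  have h1 := Nat.choose_mul_succ_eq (k + j) k
  rw [show k + j + 1 - k = j + 1 by lia] at h1
  have h1' : ((k + j).choose k : ℂ) * (k + j + 1) =
    (k + j + 1).choose k * (j + 1) := by exact_mod_cast h1
  rw [← add_assoc]
  linear_combination h1'

theorem choose_succ' (k j : ℕ) :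
    ((k : ℂ) + 1) * ((k + 1 + j).choose (k + 1) : ℂ) = (k + j + 1) * ((k + j).choose k : ℂ) := by
  have h1 := Nat.add_one_mul_choose_eq (k + j) k
  have h1' : ((k + j : ℂ) + 1) * (k + j).choose k =
    (k + j + 1).choose (k + 1) * (k + 1) := by exact_mod_cast h1
  rw [show k + 1 + j = k + j + 1 by lia]
  linear_combination -h1'

theorem Y_add_apply {ι : Type*} (d : ι → ℕ) (a b : Fock ι) (n : ℤ) (v : Fock ι) :
    ncoeff (Y d (a + b)) n v = ncoeff (Y d a) n v + ncoeff (Y d b) n v := by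
  rw [map_add, map_add, Pi.add_apply, LinearMap.add_apply]

theorem Y_smul_apply {ι : Type*} (d : ι → ℕ) (r : ℂ) (a : Fock ι) (n : ℤ) (v : Fock ι) :
    ncoeff (Y d (r • a)) n v = r • ncoeff (Y d a) n v := by
  rw [map_smul, map_smul, Pi.smul_apply, LinearMap.smul_apply]

theorem Y_zero_apply {ι : Type*} (d : ι → ℕ) (n : ℤ) (v : Fock ι) :
    ncoeff (Y d 0) n v = 0 := by
  rw [map_zero, map_zero, Pi.zero_apply, LinearMap.zero_apply]

/-- `[T, Y(a)_n] = -n Y(a)_{n-1}` -/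
theorem translation_Y {ι : Type*} (d : ι → ℕ) (a : Fock ι) : ∀ (n : ℤ) (v : Fock ι),
    translation ι (ncoeff (Y d a) n v) = ncoeff (Y d a) n (translation ι v) +
      (-n : ℂ) • ncoeff (Y d a) (n - 1) v := by
  induction a using fock_induction with
  | one =>
    intro n v
    simp only [Y_one, idOp_apply]
    by_cases h : n = -1
    · subst h; simp
    · by_cases h' : n = 0
      · subst h'; simp
      · rw [if_neg h, if_neg h, if_neg (by lia)]; simp
  | add a b ha hb =>
    intro n v
    simp only [Y_add_apply]
    simp only [map_add, ha, hb, smul_add]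
    abel
  | smul r a ha =>
    intro n v
    simp only [Y_smul_apply, Derivation.map_smul, ha, smul_add, smul_comm r]
  | mul p a ha =>
    intro n v
    obtain ⟨i, k⟩ := p
    obtain ⟨K, hK⟩ := exists_bound' (Y d a) v (n - 1)
    obtain ⟨L, hL⟩ := pderiv_bound i v
    obtain ⟨M, h1, h2, h3, hKM, hLM⟩ := ((normalOrder_ev d (i, k) (Y d a) n v).and
      ((normalOrder_ev d (i, k) (Y d a) n (translation ι v)).and
      ((normalOrder_ev d (i, k) (Y d a) (n - 1) v).and
      ((Filter.eventually_ge_atTop K).and (Filter.eventually_ge_atTop (L + 1)))))).exists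
    rw [Y_X_mul, h1, h2, h3]
    clear h1 h2 h3
    simp only [map_add, map_sum, Derivation.map_smul, Derivation.leibniz, smul_eq_mul,
      translation_X, ha, pderiv_translation, smul_add, mul_add, Finset.sum_add_distrib,
      Finset.smul_sum, map_smul, smul_smul]
    have e1 : ∑ j ∈ Finset.range M, ((k + j).choose k : ℂ) • (X (i, k + j) *
          ((-((n + j : ℤ) : ℂ)) • ncoeff (Y d a) (n + j - 1) v)) +
        ∑ j ∈ Finset.range M, ((k + j).choose k : ℂ) • (ncoeff (Y d a) (n + j) v *
          ((k + j + 1 : ℕ) : ℂ) • (X (i, k + j + 1) : Fock ι)) =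
        ∑ j ∈ Finset.range M, ((-n : ℂ) * ((k + j).choose k : ℂ)) • (X (i, k + j) *
          ncoeff (Y d a) (n - 1 + j) v) := by
      have e2 : ∑ j ∈ Finset.range M, ((k + j).choose k : ℂ) • (ncoeff (Y d a) (n + j) v *
          ((k + j + 1 : ℕ) : ℂ) • (X (i, k + j + 1) : Fock ι)) =
          ∑ j ∈ Finset.range M, ((j : ℂ) * ((k + j).choose k : ℂ)) • (X (i, k + j) *
          ncoeff (Y d a) (n - 1 + j) v) := by
        have := Finset.sum_range_succ (fun j : ℕ => ((j : ℂ) * ((k + j).choose k : ℂ)) •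
          (X (i, k + j) * ncoeff (Y d a) (n - 1 + j) v)) M
        rw [hK M hKM, mul_zero, smul_zero, add_zero, Finset.sum_range_succ'] at this
        rw [← this]
        simp only [Nat.cast_zero, zero_mul, zero_smul, add_zero]
        refine Finset.sum_congr rfl fun j _ => ?_
        rw [show n - 1 + ((j + 1 : ℕ) : ℤ) = n + j by push_cast; ring, mul_smul_comm, smul_smul,
          mul_comm (X _ : Fock ι), ← add_assoc k j 1]
        congr 1
        have := choose_succ k j
        push_cast
        rw [add_assoc k j 1]
        linear_combination this
      rw [e2, ← Finset.sum_add_distrib]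
      refine Finset.sum_congr rfl fun j _ => ?_
      rw [show n + (j : ℤ) - 1 = n - 1 + j by ring, mul_smul_comm, smul_smul, ← add_smul]
      congr 1
      push_cast
      ring
    have e3 : ∑ l ∈ Finset.range M, (coef (d i) k l * (l : ℂ)) •
          ncoeff (Y d a) (n - k - l - d i - 1) (pderiv (i, l - 1) v) =
        ∑ l ∈ Finset.range M, ((l + 1 : ℂ) * coef (d i) k (l + 1)) •
          ncoeff (Y d a) (n - 1 - k - l - d i - 1) (pderiv (i, l) v) := by
      have := Finset.sum_range_succ (fun l : ℕ => (coef (d i) k l * (l : ℂ)) •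
          ncoeff (Y d a) (n - k - l - d i - 1) (pderiv (i, l - 1) v)) M
      rw [hL (M - 1) (by lia), map_zero, smul_zero, add_zero, Finset.sum_range_succ'] at this
      rw [← this]
      simp only [Nat.cast_zero, mul_zero, zero_smul, add_zero, Nat.add_sub_cancel]
      refine Finset.sum_congr rfl fun l _ => ?_
      rw [show n - k - ((l + 1 : ℕ) : ℤ) - d i - 1 = n - 1 - k - l - d i - 1 by push_cast; ring]
      congr 1
      push_cast
      ring
    have e4 : ∑ l ∈ Finset.range M, (coef (d i) k l * -((n - k - l - d i - 1 : ℤ) : ℂ)) •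
          ncoeff (Y d a) (n - k - l - d i - 1 - 1) (pderiv (i, l) v) =
        ∑ l ∈ Finset.range M, ((l + 1 : ℂ) * coef (d i) k (l + 1)) •
          ncoeff (Y d a) (n - 1 - k - l - d i - 1) (pderiv (i, l) v) +
        ∑ l ∈ Finset.range M, (-n * coef (d i) k l) •
          ncoeff (Y d a) (n - 1 - k - l - d i - 1) (pderiv (i, l) v) := by
      rw [← Finset.sum_add_distrib]
      refine Finset.sum_congr rfl fun l _ => ?_
      rw [show n - k - l - d i - 1 - 1 = n - 1 - k - l - (d i : ℤ) - 1 by ring, ← add_smul,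
        coef_succ_right]
      congr 1
      push_cast
      ring
    rw [e3, e4, ← e1]
    abel

/-- `Y(T a) = ∂ Y(a)` -/
theorem Y_translation {ι : Type*} (d : ι → ℕ) (a : Fock ι) : ∀ (n : ℤ) (v : Fock ι),
    ncoeff (Y d (translation ι a)) n v = (-n : ℂ) • ncoeff (Y d a) (n - 1) v := by
  induction a using fock_induction with
  | one =>
    intro n v
    rw [Derivation.map_one_eq_zero, Y_zero_apply, Y_one, idOp_apply]
    by_cases h' : n = 0
    · subst h'; simp
    · rw [if_neg (by lia), smul_zero]
  | add a b ha hb =>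
    intro n v
    rw [map_add]
    simp only [Y_add_apply, ha, hb, smul_add]
  | smul r a ha =>
    intro n v
    rw [Derivation.map_smul]
    simp only [Y_smul_apply, ha, smul_comm r]
  | mul p a ha =>
    intro n v
    obtain ⟨i, k⟩ := p
    obtain ⟨K, hK⟩ := exists_bound' (Y d a) v (n - 1)
    obtain ⟨M, h1, h2, h3, hKM⟩ := ((normalOrder_ev d (i, k + 1) (Y d a) n v).and
      ((normalOrder_ev d (i, k) (Y d (translation ι a)) n v).and
      ((normalOrder_ev d (i, k) (Y d a) (n - 1) v).and
      (Filter.eventually_ge_atTop K)))).exists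
    rw [Derivation.leibniz, translation_X, smul_eq_mul, smul_eq_mul, mul_comm a, smul_mul_assoc,
      Y_add_apply, Y_smul_apply, Y_X_mul, Y_X_mul, Y_X_mul, h1, h2, h3]
    clear h1 h2 h3
    simp only [ha, smul_add, Finset.smul_sum, smul_smul]
    have e2 : ∑ j ∈ Finset.range M, (((k + 1 : ℕ) : ℂ) * ((k + 1 + j).choose (k + 1) : ℂ)) •
          (X (i, k + 1 + j) * ncoeff (Y d a) (n + j) v) =
          ∑ j ∈ Finset.range M, ((j : ℂ) * ((k + j).choose k : ℂ)) • (X (i, k + j) *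
          ncoeff (Y d a) (n - 1 + j) v) := by
      have := Finset.sum_range_succ (fun j : ℕ => ((j : ℂ) * ((k + j).choose k : ℂ)) •
        (X (i, k + j) * ncoeff (Y d a) (n - 1 + j) v)) M
      rw [hK M hKM, mul_zero, smul_zero, add_zero, Finset.sum_range_succ'] at this
      rw [← this]
      simp only [Nat.cast_zero, zero_mul, zero_smul, add_zero]
      refine Finset.sum_congr rfl fun j _ => ?_
      rw [show n - 1 + ((j + 1 : ℕ) : ℤ) = n + j by push_cast; ring,
        show k + 1 + j = k + (j + 1) by lia]
      congr 1
      have h := choose_succ k j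
      have h' := choose_succ' k j
      rw [show k + 1 + j = k + (j + 1) by lia] at h'
      push_cast
      linear_combination h + h'
    have e1 : ∑ j ∈ Finset.range M, ((k + j).choose k : ℂ) • (X (i, k + j) *
          ((-((n + j : ℤ) : ℂ)) • ncoeff (Y d a) (n + j - 1) v)) +
        ∑ j ∈ Finset.range M, ((j : ℂ) * ((k + j).choose k : ℂ)) • (X (i, k + j) *
          ncoeff (Y d a) (n - 1 + j) v) =
        ∑ j ∈ Finset.range M, ((-n : ℂ) * ((k + j).choose k : ℂ)) • (X (i, k + j) *
          ncoeff (Y d a) (n - 1 + j) v) := by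
      rw [← Finset.sum_add_distrib]
      refine Finset.sum_congr rfl fun j _ => ?_
      rw [show n + (j : ℤ) - 1 = n - 1 + j by ring, mul_smul_comm, smul_smul, ← add_smul]
      congr 1
      push_cast
      ring
    have e4 : ∑ l ∈ Finset.range M, (coef (d i) k l * -((n - k - l - d i - 1 : ℤ) : ℂ)) •
          ncoeff (Y d a) (n - k - l - d i - 1 - 1) (pderiv (i, l) v) +
        ∑ l ∈ Finset.range M, (((k + 1 : ℕ) : ℂ) * coef (d i) (k + 1) l) •
          ncoeff (Y d a) (n - (k + 1 : ℕ) - l - d i - 1) (pderiv (i, l) v) =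
        ∑ l ∈ Finset.range M, (-n * coef (d i) k l) •
          ncoeff (Y d a) (n - 1 - k - l - d i - 1) (pderiv (i, l) v) := by
      rw [← Finset.sum_add_distrib]
      refine Finset.sum_congr rfl fun l _ => ?_
      rw [show n - k - l - d i - 1 - 1 = n - 1 - k - l - (d i : ℤ) - 1 by ring,
        show n - (k + 1 : ℕ) - l - d i - 1 = n - 1 - k - l - (d i : ℤ) - 1 by push_cast; ring,
        ← add_smul, Nat.cast_add, Nat.cast_one, coef_succ_left]
      congr 1
      push_cast
      ring
    rw [e2, ← e1, ← e4]
    abel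

theorem pderiv_X' {ι : Type*} [DecidableEq ι] (i i' : ι) (k k' : ℕ) :
    pderiv (i, k) (X (i', k') : Fock ι) = if i' = i ∧ k' = k then 1 else 0 := by
  rw [pderiv_X, Pi.single_apply]
  simp only [Prod.mk.injEq]

/-- `[∂_{i,l}, Y(c)_n]` -/
theorem pderiv_Y {ι : Type*} (d : ι → ℕ) (i : ι) (l : ℕ) (c : Fock ι) : ∀ (n : ℤ) (v : Fock ι),
    pderiv (i, l) (ncoeff (Y d c) n v) = ncoeff (Y d c) n (pderiv (i, l) v) +
      ∑ k ∈ Finset.range (l + 1), (l.choose k : ℂ) •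
        ncoeff (Y d (pderiv (i, k) c)) (n + l - k) v := by
  classical
  induction c using fock_induction with
  | one =>
    intro n v
    simp only [Derivation.map_one_eq_zero, Y_zero_apply, smul_zero, Finset.sum_const_zero, add_zero]
    simp only [Y_one, idOp_apply]
    split_ifs
    · rfl
    · exact map_zero _
  | add a b ha hb =>
    intro n v
    simp only [map_add (pderiv _)]
    simp only [Y_add_apply]
    simp only [map_add, ha, hb, smul_add, Finset.sum_add_distrib]
    abel
  | smul r a ha =>
    intro n v
    simp only [Derivation.map_smul]
    simp only [Y_smul_apply]
    simp only [Derivation.map_smul, ha, smul_add, smul_comm r, Finset.smul_sum]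
  | mul p a ha =>
    intro n v
    obtain ⟨i', k'⟩ := p
    obtain ⟨M, h1, h2, h3, hM⟩ := ((normalOrder_ev d (i', k') (Y d a) n v).and
      ((normalOrder_ev d (i', k') (Y d a) n (pderiv (i, l) v)).and
      (((Finset.range (l + 1)).eventually_all.2 fun k _ =>
        (normalOrder_ev d (i', k') (Y d (pderiv (i, k) a)) (n + l - k) v)).and
      (Filter.eventually_ge_atTop (l + 1))))).exists
    have h4 : ∑ k ∈ Finset.range (l + 1), (l.choose k : ℂ) •
        ncoeff (Y d (pderiv (i, k) (X (i', k') * a))) (n + l - k) v =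
        ∑ k ∈ Finset.range (l + 1), ((l.choose k : ℂ) • (
          ∑ j ∈ Finset.range M, ((k' + j).choose k' : ℂ) • (X (i', k' + j) *
            ncoeff (Y d (pderiv (i, k) a)) (n + l - k + j) v) +
          ∑ m ∈ Finset.range M, coef (d i') k' m • ncoeff (Y d (pderiv (i, k) a))
            (n + l - k - k' - m - d i' - 1) (pderiv (i', m) v)) +
          if i' = i ∧ k' = k then (l.choose k : ℂ) • ncoeff (Y d a) (n + l - k) v else 0) := by
      refine Finset.sum_congr rfl fun k hk => ?_
      rw [Derivation.leibniz, smul_eq_mul, smul_eq_mul, Y_add_apply, Y_X_mul, h3 k hk, pderiv_X',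
        mul_ite, mul_one, mul_zero, smul_add]
      congr 1
      split_ifs with h
      · rfl
      · rw [Y_zero_apply, smul_zero]
    have h5 : ∑ j ∈ Finset.range M, ((k' + j).choose k' : ℂ) •
        (ncoeff (Y d a) (n + j) v * pderiv (i, l) (X (i', k' + j) : Fock ι)) =
        ∑ k ∈ Finset.range (l + 1),
          if i' = i ∧ k' = k then (l.choose k : ℂ) • ncoeff (Y d a) (n + l - k) v else 0 := by
      simp only [pderiv_X', mul_ite, mul_one, mul_zero, smul_ite, smul_zero]
      by_cases hi : i' = i
      · simp only [hi, true_and]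
        rw [Finset.sum_ite_eq]
        by_cases hl : k' ≤ l
        · rw [if_pos (Finset.mem_range.2 (by lia)), Finset.sum_eq_single (l - k')]
          · rw [if_pos (by lia), show k' + (l - k') = l by lia,
              show n + ((l - k' : ℕ) : ℤ) = n + l - k' by lia]
          · intro b _ hb; rw [if_neg (by lia)]
          · intro h; simp at h; lia
        · rw [if_neg (by simp; lia), Finset.sum_eq_zero]
          intro x _; rw [if_neg (by lia)]
      · simp [hi]
    rw [h4, Y_X_mul, h1, h2]
    clear h1 h2 h3 h4
    simp only [map_add, map_sum, Derivation.map_smul, Derivation.leibniz, smul_eq_mul, ha,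
      smul_add, mul_add, Finset.sum_add_distrib]
    rw [h5]
    have h6 : ∑ j ∈ Finset.range M, ((k' + j).choose k' : ℂ) • (X (i', k' + j) *
        ∑ k ∈ Finset.range (l + 1), (l.choose k : ℂ) •
          ncoeff (Y d (pderiv (i, k) a)) (n + j + l - k) v) =
        ∑ k ∈ Finset.range (l + 1), (l.choose k : ℂ) •
          ∑ j ∈ Finset.range M, ((k' + j).choose k' : ℂ) • (X (i', k' + j) *
            ncoeff (Y d (pderiv (i, k) a)) (n + l - k + j) v) := by
      simp only [Finset.mul_sum, Finset.smul_sum]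
      rw [Finset.sum_comm]
      refine Finset.sum_congr rfl fun k _ => Finset.sum_congr rfl fun j _ => ?_
      rw [mul_smul_comm, smul_comm, show n + j + l - k = n + l - k + (j : ℤ) by ring]
    have h7 : ∑ m ∈ Finset.range M, coef (d i') k' m •
        ∑ k ∈ Finset.range (l + 1), (l.choose k : ℂ) •
          ncoeff (Y d (pderiv (i, k) a)) (n - k' - m - d i' - 1 + l - k) (pderiv (i', m) v) =
        ∑ k ∈ Finset.range (l + 1), (l.choose k : ℂ) •
          ∑ m ∈ Finset.range M, coef (d i') k' m • ncoeff (Y d (pderiv (i, k) a))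
            (n + l - k - k' - m - d i' - 1) (pderiv (i', m) v) := by
      simp only [Finset.smul_sum]
      rw [Finset.sum_comm]
      refine Finset.sum_congr rfl fun k _ => Finset.sum_congr rfl fun j _ => ?_
      rw [smul_comm, show n - k' - j - d i' - 1 + l - k = n + l - k - k' - j - d i' - (1 : ℤ) by ring]
    rw [h6, h7]
    simp only [pderiv_comm (i, l)]
    abel

/-- `[Y(c)_n, x_{i,j}]` -/
theorem Y_mul_X {ι : Type*} (d : ι → ℕ) (i : ι) (c : Fock ι) :
    ∃ K₀ : ℕ, ∀ K, K₀ ≤ K → ∀ (j : ℕ) (n : ℤ) (v : Fock ι),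
      ncoeff (Y d c) n (X (i, j) * v) = X (i, j) * ncoeff (Y d c) n v +
        ∑ k ∈ Finset.range K, coef (d i) k j •
          ncoeff (Y d (pderiv (i, k) c)) (n - k - j - d i - 1) v := by
  classical
  induction c using fock_induction with
  | one =>
    refine ⟨0, fun K _ j n v => ?_⟩
    simp only [Derivation.map_one_eq_zero, Y_zero_apply, smul_zero, Finset.sum_const_zero, Y_one,
      idOp_apply, mul_ite, mul_zero, add_zero]
  | add a b ha hb =>
    obtain ⟨Ka, ha⟩ := ha
    obtain ⟨Kb, hb⟩ := hb
    refine ⟨max Ka Kb, fun K hK j n v => ?_⟩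
    simp only [map_add (pderiv _)]
    simp only [Y_add_apply]
    rw [ha K (by lia), hb K (by lia)]
    simp only [smul_add, mul_add, Finset.sum_add_distrib]
    abel
  | smul r a ha =>
    obtain ⟨Ka, ha⟩ := ha
    refine ⟨Ka, fun K hK j n v => ?_⟩
    simp only [Derivation.map_smul]
    simp only [Y_smul_apply]
    rw [ha K hK]
    simp only [mul_smul_comm, smul_add, smul_comm r, Finset.smul_sum]
  | mul p a ha =>
    obtain ⟨Ka, ha⟩ := ha
    obtain ⟨i', k'⟩ := p
    refine ⟨max Ka (k' + 1), fun K hK j n v => ?_⟩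
    have ha := ha K (by lia)
    obtain ⟨M, h1, h2, h3, hM⟩ := ((normalOrder_ev d (i', k') (Y d a) n v).and
      ((normalOrder_ev d (i', k') (Y d a) n (X (i, j) * v)).and
      (((Finset.range K).eventually_all.2 fun k _ =>
        (normalOrder_ev d (i', k') (Y d (pderiv (i, k) a)) (n - k - j - d i - 1) v)).and
      (Filter.eventually_ge_atTop (j + 1))))).exists
    have h4 : ∑ k ∈ Finset.range K, coef (d i) k j •
        ncoeff (Y d (pderiv (i, k) (X (i', k') * a))) (n - k - j - d i - 1) v =
        ∑ k ∈ Finset.range K, (coef (d i) k j • (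
          ∑ m ∈ Finset.range M, ((k' + m).choose k' : ℂ) • (X (i', k' + m) *
            ncoeff (Y d (pderiv (i, k) a)) (n - k - j - d i - 1 + m) v) +
          ∑ m ∈ Finset.range M, coef (d i') k' m • ncoeff (Y d (pderiv (i, k) a))
            (n - k - j - d i - 1 - k' - m - d i' - 1) (pderiv (i', m) v)) +
          if i' = i ∧ k' = k then coef (d i) k j • ncoeff (Y d a) (n - k - j - d i - 1) v
          else 0) := by
      refine Finset.sum_congr rfl fun k hk => ?_
      rw [Derivation.leibniz, smul_eq_mul, smul_eq_mul, Y_add_apply, Y_X_mul, h3 k hk, pderiv_X',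
        mul_ite, mul_one, mul_zero, smul_add]
      congr 1
      split_ifs with h
      · rfl
      · rw [Y_zero_apply, smul_zero]
    have h5 : ∑ m ∈ Finset.range M, coef (d i') k' m • ncoeff (Y d a) (n - k' - m - d i' - 1)
          (v * pderiv (i', m) (X (i, j) : Fock ι)) =
        ∑ k ∈ Finset.range K,
          if i' = i ∧ k' = k then coef (d i) k j • ncoeff (Y d a) (n - k - j - d i - 1) v
          else 0 := by
      simp only [pderiv_X', mul_one, mul_zero, apply_ite, map_zero, smul_zero]
      by_cases hi : i' = i
      · subst hi
        simp only [true_and]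
        rw [Finset.sum_ite_eq, Finset.sum_ite_eq, if_pos (Finset.mem_range.2 (by lia)),
          if_pos (Finset.mem_range.2 (by lia))]
      · simp [hi, Ne.symm hi]
    rw [h4, Y_X_mul, h1, h2]
    clear h1 h2 h3 h4
    simp only [map_add, ha, Derivation.leibniz, smul_eq_mul,
      smul_add, mul_add, Finset.sum_add_distrib]
    rw [h5]
    have h6 : ∑ m ∈ Finset.range M, ((k' + m).choose k' : ℂ) • (X (i', k' + m) *
        ∑ k ∈ Finset.range K, coef (d i) k j •
          ncoeff (Y d (pderiv (i, k) a)) (n + m - k - j - d i - 1) v) =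
        ∑ k ∈ Finset.range K, coef (d i) k j •
          ∑ m ∈ Finset.range M, ((k' + m).choose k' : ℂ) • (X (i', k' + m) *
            ncoeff (Y d (pderiv (i, k) a)) (n - k - j - d i - 1 + m) v) := by
      simp only [Finset.mul_sum, Finset.smul_sum]
      rw [Finset.sum_comm]
      refine Finset.sum_congr rfl fun k _ => Finset.sum_congr rfl fun m _ => ?_
      rw [mul_smul_comm, smul_comm,
        show n + m - k - j - d i - 1 = n - k - j - d i - 1 + (m : ℤ) by ring]
    have h7 : ∑ m ∈ Finset.range M, coef (d i') k' m •
        ∑ k ∈ Finset.range K, coef (d i) k j •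
          ncoeff (Y d (pderiv (i, k) a)) (n - k' - m - d i' - 1 - k - j - d i - 1)
            (pderiv (i', m) v) =
        ∑ k ∈ Finset.range K, coef (d i) k j •
          ∑ m ∈ Finset.range M, coef (d i') k' m • ncoeff (Y d (pderiv (i, k) a))
            (n - k - j - d i - 1 - k' - m - d i' - 1) (pderiv (i', m) v) := by
      simp only [Finset.smul_sum]
      rw [Finset.sum_comm]
      refine Finset.sum_congr rfl fun k _ => Finset.sum_congr rfl fun m _ => ?_
      rw [smul_comm, show n - k' - m - d i' - 1 - k - j - d i - 1 =
        n - k - j - d i - 1 - k' - m - d i' - (1 : ℤ) by ring]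
    have h8 : ∑ m ∈ Finset.range M, ((k' + m).choose k' : ℂ) • (X (i', k' + m) *
          (X (i, j) * ncoeff (Y d a) (n + m) v)) =
        X (i, j) * ∑ m ∈ Finset.range M, ((k' + m).choose k' : ℂ) • (X (i', k' + m) *
          ncoeff (Y d a) (n + m) v) := by
      simp only [Finset.mul_sum, mul_smul_comm, mul_left_comm]
    have h9 : ∑ m ∈ Finset.range M, coef (d i') k' m • (X (i, j) *
          ncoeff (Y d a) (n - k' - m - d i' - 1) (pderiv (i', m) v)) =
        X (i, j) * ∑ m ∈ Finset.range M, coef (d i') k' m •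
          ncoeff (Y d a) (n - k' - m - d i' - 1) (pderiv (i', m) v) := by
      simp only [Finset.mul_sum, mul_smul_comm]
    rw [h6, h7, h8, h9]
    abel

/-- Multiplication of a formal distribution in `z` and `w` by `z - w`, on coefficients. -/
def zw (V : Type*) [AddCommGroup V] [Module ℂ V] : Module.End ℂ (ℤ → ℤ → V) where
  toFun F m n := F (m + 1) n - F m (n + 1)
  map_add' F G := by
    funext m n
    simp only [Pi.add_apply]
    abel
  map_smul' r F := by
    funext m n
    simp only [Pi.smul_apply, smul_sub, RingHom.id_apply]

theorem zw_apply {V : Type*} [AddCommGroup V] [Module ℂ V] (F : ℤ → ℤ → V) (m n : ℤ) :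
    zw V F m n = F (m + 1) n - F m (n + 1) := rfl

theorem zw_pow_apply {V : Type*} [AddCommGroup V] [Module ℂ V] (N : ℕ) : ∀ (F : ℤ → ℤ → V)
    (m n : ℤ), (zw V ^ N) F m n = ∑ j ∈ Finset.range (N + 1),
      ((-1) ^ j * (N.choose j : ℂ)) • F (m + N - j) (n + j) := by
  induction N with
  | zero => intro F m n; simp
  | succ N ih =>
    intro F m n
    rw [pow_succ, Module.End.mul_apply, ih]
    simp only [zw_apply, smul_sub, Finset.sum_sub_distrib]
    rw [Finset.sum_range_succ' _ (N + 1), Finset.sum_range_succ' _ N]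
    simp only [Nat.choose_succ_succ, Nat.cast_add, mul_add, add_smul, Finset.sum_add_distrib]
    have h1 : ∑ x ∈ Finset.range (N + 1), ((-1) ^ (x + 1) * (N.choose x : ℂ)) •
        F (m + (N + (1 : ℕ)) - (x + (1 : ℕ))) (n + (x + (1 : ℕ))) =
        - ∑ j ∈ Finset.range (N + 1), ((-1) ^ j * (N.choose j : ℂ)) •
          F (m + N - j) (n + j + 1) := by
      rw [← Finset.sum_neg_distrib]
      refine Finset.sum_congr rfl fun j _ => ?_
      rw [show m + (N + (1 : ℕ)) - (j + (1 : ℕ)) = m + N - (j : ℤ) by push_cast; ring,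
        show n + (j + (1 : ℕ)) = n + j + (1 : ℤ) by push_cast; ring, ← neg_smul]
      congr 1
      ring
    have h2 : ∑ x ∈ Finset.range (N + 1), ((-1) ^ (x + 1) * (N.choose (x + 1) : ℂ)) •
        F (m + (N + (1 : ℕ)) - (x + (1 : ℕ))) (n + (x + (1 : ℕ))) =
        ∑ j ∈ Finset.range N, ((-1) ^ (j + 1) * (N.choose (j + 1) : ℂ)) •
          F (m + N - (j + (1 : ℕ)) + 1) (n + (j + (1 : ℕ))) := by
      rw [Finset.sum_range_succ, Nat.choose_succ_self, Nat.cast_zero, mul_zero, zero_smul, add_zero]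
      refine Finset.sum_congr rfl fun j _ => ?_
      congr 2
      push_cast
      ring
    rw [h1, h2]
    have h3 : m + (N + (1 : ℕ)) - (0 : ℕ) = m + N - (0 : ℕ) + (1 : ℤ) := by push_cast; ring
    rw [h3]
    simp only [pow_zero, Nat.choose_zero_right]
    abel

theorem zw_pow_eq_zero {V : Type*} [AddCommGroup V] [Module ℂ V] {F : ℤ → ℤ → V} {N M : ℕ}
    (h : (zw V ^ N) F = 0) (hNM : N ≤ M) : (zw V ^ M) F = 0 := by
  rw [← Nat.sub_add_cancel hNM, pow_add, Module.End.mul_apply, h, map_zero]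

/-- Division by `(z - w) ^ s`, expanded in the domain `|z| > |w|`. -/
noncomputable def expR {V : Type*} [AddCommGroup V] [Module ℂ V] (s : ℕ) (F : ℤ → ℤ → V) :
    ℤ → ℤ → V :=
  fun m n => ∑ᶠ j : ℕ, (s.multichoose j : ℂ) • F (m - s - j) (n + j)

/-- Division by `(w - z) ^ s`, expanded in the domain `|w| > |z|`. -/
noncomputable def expL {V : Type*} [AddCommGroup V] [Module ℂ V] (s : ℕ) (F : ℤ → ℤ → V) :
    ℤ → ℤ → V :=
  fun m n => ∑ᶠ j : ℕ, (s.multichoose j : ℂ) • F (m + j) (n - s - j)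

theorem zw_expR {V : Type*} [AddCommGroup V] [Module ℂ V] {F : ℤ → ℤ → V}
    (hF : ∃ N₀ : ℤ, ∀ n, N₀ ≤ n → ∀ m, F m n = 0) (s : ℕ) :
    (zw V ^ s) (expR s F) = F := by
  obtain ⟨N₀, hF⟩ := hF
  induction s with
  | zero =>
    funext m n
    rw [pow_zero, Module.End.one_apply, expR, finsum_eq_single _ 0]
    · simp
    · intro j hj
      obtain ⟨j, rfl⟩ := Nat.exists_eq_succ_of_ne_zero hj
      simp
  | succ s ih =>
    rw [pow_succ, Module.End.mul_apply]
    have : zw V (expR (s + 1) F) = expR s F := by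
      funext m n
      have key : ∀ c : ℕ → ℂ, ∃ K : ℕ, ∀ j, K ≤ j → c j • F (m - s - j) (n + j) = 0 := fun c =>
        ⟨(N₀ - n).toNat, fun j hj => by rw [hF _ (by lia), smul_zero]⟩
      have key' : ∀ c : ℕ → ℂ, ∃ K : ℕ, ∀ j : ℕ, K ≤ j →
          c j • F (m - s - (j + 1 : ℕ)) (n + (j + 1 : ℕ)) = 0 := fun c =>
        ⟨(N₀ - n).toNat, fun j hj => by rw [hF _ (by lia), smul_zero]⟩
      have e1 : expR (s + 1) F (m + 1) n =
          ∑ᶠ j : ℕ, ((s + 1).multichoose j : ℂ) • F (m - s - j) (n + j) := by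
        refine finsum_congr fun j => ?_
        rw [show m + 1 - (s + 1 : ℕ) - j = m - s - (j : ℤ) by push_cast; ring]
      have e2 : expR (s + 1) F m (n + 1) = ∑ᶠ j : ℕ, ((s + 1).multichoose j : ℂ) •
          F (m - s - (j + 1 : ℕ)) (n + (j + 1 : ℕ)) := by
        refine finsum_congr fun j => ?_
        rw [show m - (s + 1 : ℕ) - j = m - s - ((j + 1 : ℕ) : ℤ) by push_cast; ring,
          show n + 1 + j = n + ((j + 1 : ℕ) : ℤ) by push_cast; ring]
      rw [zw_apply, e1, e2, expR, finsum_succ (key _), finsum_succ (key _), sub_eq_iff_eq_add,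
        add_assoc, ← finsum_add_distrib (fin_of_bound (key' _)) (fin_of_bound (key' _))]
      simp only [Nat.multichoose_zero_right, Nat.multichoose_succ_succ, Nat.cast_add, add_smul]
    rw [this, ih]

theorem zw_expL {V : Type*} [AddCommGroup V] [Module ℂ V] {F : ℤ → ℤ → V}
    (hF : ∃ N₀ : ℤ, ∀ m, N₀ ≤ m → ∀ n, F m n = 0) (s : ℕ) :
    (zw V ^ s) (expL s F) = ((-1) ^ s : ℂ) • F := by
  obtain ⟨N₀, hF⟩ := hF
  induction s with
  | zero =>
    rw [pow_zero, Module.End.one_apply, pow_zero, one_smul]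
    funext m n
    rw [expL, finsum_eq_single _ 0]
    · simp
    · intro j hj
      obtain ⟨j, rfl⟩ := Nat.exists_eq_succ_of_ne_zero hj
      simp
  | succ s ih =>
    rw [pow_succ, Module.End.mul_apply]
    have : zw V (expL (s + 1) F) = (-1 : ℂ) • expL s F := by
      funext m n
      have key : ∀ c : ℕ → ℂ, ∃ K : ℕ, ∀ j, K ≤ j → c j • F (m + j) (n - s - j) = 0 := fun c =>
        ⟨(N₀ - m).toNat, fun j hj => by rw [hF _ (by lia), smul_zero]⟩
      have key' : ∀ c : ℕ → ℂ, ∃ K : ℕ, ∀ j : ℕ, K ≤ j →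
          c j • F (m + (j + 1 : ℕ)) (n - s - (j + 1 : ℕ)) = 0 := fun c =>
        ⟨(N₀ - m).toNat, fun j hj => by rw [hF _ (by lia), smul_zero]⟩
      have e1 : expL (s + 1) F m (n + 1) =
          ∑ᶠ j : ℕ, ((s + 1).multichoose j : ℂ) • F (m + j) (n - s - j) := by
        refine finsum_congr fun j => ?_
        rw [show n + 1 - (s + 1 : ℕ) - j = n - s - (j : ℤ) by push_cast; ring]
      have e2 : expL (s + 1) F (m + 1) n = ∑ᶠ j : ℕ, ((s + 1).multichoose j : ℂ) •
          F (m + (j + 1 : ℕ)) (n - s - (j + 1 : ℕ)) := by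
        refine finsum_congr fun j => ?_
        rw [show n - (s + 1 : ℕ) - j = n - s - ((j + 1 : ℕ) : ℤ) by push_cast; ring,
          show m + 1 + j = m + ((j + 1 : ℕ) : ℤ) by push_cast; ring]
      rw [Pi.smul_apply, Pi.smul_apply, neg_smul, one_smul, zw_apply, e1, e2, expL,
        finsum_succ (key _), finsum_succ (key _), sub_eq_iff_eq_add, neg_add_eq_sub,
        eq_sub_iff_add_eq, add_comm, add_assoc,
        ← finsum_add_distrib (fin_of_bound (key' _)) (fin_of_bound (key' _))]
      simp only [Nat.multichoose_zero_right, Nat.multichoose_succ_succ, Nat.cast_add, add_smul]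
    rw [this, map_smul, ih, smul_smul, pow_succ, mul_comm]

/-- The coefficients of the commutator of two fields, applied to `v`. -/
noncomputable def comm {ι : Type*} (A B : VertexOperator ℂ (Fock ι)) (v : Fock ι) :
    ℤ → ℤ → Fock ι :=
  fun m n => ncoeff A m (ncoeff B n v) - ncoeff B n (ncoeff A m v)

/-- Mutual locality of two fields. -/
def IsLocal {ι : Type*} (A B : VertexOperator ℂ (Fock ι)) : Prop :=
  ∃ N : ℕ, ∀ v, (zw (Fock ι) ^ N) (comm A B v) = 0

theorem isLocal_translation {ι : Type*} (d : ι → ℕ) (a : Fock ι)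
    {C : VertexOperator ℂ (Fock ι)} (h : IsLocal (Y d a) C) :
    IsLocal (Y d (translation ι a)) C := by
  obtain ⟨N, hN⟩ := h
  have key : ∀ (N : ℕ) (F : ℤ → ℤ → Fock ι), (zw (Fock ι) ^ N) F = 0 →
      (zw (Fock ι) ^ (N + 1)) (fun m n : ℤ => (-m : ℂ) • F (m - 1) n) = 0 := by
    intro N
    induction N with
    | zero =>
      intro F hF
      rw [pow_zero, Module.End.one_apply] at hF
      subst hF
      have h0 : (fun m n : ℤ => (-m : ℂ) • (0 : ℤ → ℤ → Fock ι) (m - 1) n) = 0 := by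
        funext m n
        simp
      rw [h0, map_zero]
    | succ N ih =>
      intro F hF
      have h1 : zw (Fock ι) (fun m n : ℤ => (-m : ℂ) • F (m - 1) n) =
          (fun m n : ℤ => (-m : ℂ) • (zw (Fock ι) F) (m - 1) n) - F := by
        funext m n
        rw [Pi.sub_apply, Pi.sub_apply, zw_apply, zw_apply, show m + 1 - 1 = m by ring,
          show m - 1 + 1 = m by ring]
        push_cast
        module
      rw [pow_succ, Module.End.mul_apply, h1, map_sub, hF, sub_zero]
      apply ih
      rw [← Module.End.mul_apply, ← pow_succ, hF]
  refine ⟨N + 1, fun v => ?_⟩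
  convert key N _ (hN v) using 2
  funext m n
  rw [comm, Y_translation, Y_translation, map_smul, comm, smul_sub]

theorem choose_factorial (a b : ℕ) :
    ((a + b).choose a : ℂ) * (a.factorial * b.factorial) = (a + b).factorial := by
  have := Nat.add_choose_mul_factorial_mul_factorial a b
  rw [← this, Nat.choose_symm_add]
  push_cast
  ring

theorem coef_mul_choose (d k j : ℕ) :
    coef d 0 (k + j) * ((k + j).choose k : ℂ) =
      ((k + d).choose k : ℂ) * ((k + d + 1).multichoose j : ℂ) := by
  rw [coef, Nat.multichoose_eq, show 0 + (k + j) + d = k + j + d by lia,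
    show k + d + 1 + j - 1 = j + (k + d) by lia, Nat.choose_zero_right, one_mul, pow_zero, one_mul]
  have h1 := choose_factorial d (k + j)
  have h2 := choose_factorial k j
  have h3 := choose_factorial k d
  have h4 := choose_factorial j (k + d)
  rw [show d + (k + j) = k + j + d by lia] at h1
  rw [show j + (k + d) = k + j + d by lia] at h4 ⊢
  have hk : (k.factorial : ℂ) * (j.factorial * d.factorial) ≠ 0 := by
    simp [Nat.factorial_ne_zero]
  apply mul_right_cancel₀ hk
  linear_combination ((k + j + d).choose d : ℂ) * d.factorial * h2 + h1
    - ((k + j + d).choose j : ℂ) * j.factorial * h3 - h4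

theorem coef_eq (d k j : ℕ) :
    coef d k j = (-1) ^ k * (((k + d).choose k : ℂ) * ((k + d + 1).multichoose j : ℂ)) := by
  rw [coef, Nat.multichoose_eq, show k + d + 1 + j - 1 = j + (k + d) by lia, Nat.cast_mul]
  have h1 := choose_factorial k (j + d)
  have h2 := choose_factorial d j
  have h3 := choose_factorial k d
  have h4 := choose_factorial j (k + d)
  rw [show k + (j + d) = k + j + d by lia] at h1
  rw [show d + j = j + d by lia] at h2
  rw [show j + (k + d) = k + j + d by lia] at h4 ⊢
  have hk : (k.factorial : ℂ) * (j.factorial * d.factorial) ≠ 0 := by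
    simp [Nat.factorial_ne_zero]
  congr 1
  apply mul_right_cancel₀ hk
  linear_combination ((k + j + d).choose k : ℂ) * k.factorial * h2 + h1
    - ((k + j + d).choose j : ℂ) * j.factorial * h3 - h4

theorem zw_mul_sum {ι : Type*} (i : ι) {N : ℕ} : ∀ {F : ℤ → ℤ → Fock ι},
    (∀ n : ℤ, ∃ M₀ : ℤ, ∀ m, M₀ ≤ m → F m n = 0) → (zw (Fock ι) ^ N) F = 0 →
    (zw (Fock ι) ^ N) (fun m n : ℤ => ∑ᶠ j : ℕ, X (i, j) * F (m + j) n) = 0 := by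
  induction N with
  | zero =>
    intro F _ hF
    rw [pow_zero, Module.End.one_apply] at hF ⊢
    subst hF
    funext m n
    simp
  | succ N ih =>
    intro F h hF
    rw [pow_succ, Module.End.mul_apply] at hF ⊢
    have h' : ∀ n : ℤ, ∃ M₀ : ℤ, ∀ m, M₀ ≤ m → zw (Fock ι) F m n = 0 := by
      intro n
      obtain ⟨M, hM⟩ := h n
      obtain ⟨M', hM'⟩ := h (n + 1)
      refine ⟨max M M', fun m hm => ?_⟩
      rw [zw_apply, hM _ (by lia), hM' _ (by lia), sub_zero]
    have key : zw (Fock ι) (fun m n : ℤ => ∑ᶠ j : ℕ, X (i, j) * F (m + j) n) =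
        fun m n : ℤ => ∑ᶠ j : ℕ, X (i, j) * zw (Fock ι) F (m + j) n := by
      funext m n
      obtain ⟨M, hM⟩ := h n
      obtain ⟨M', hM'⟩ := h (n + 1)
      rw [zw_apply, ← finsum_sub_distrib
        (fin_of_bound ⟨(M - (m + 1)).toNat, fun j hj => by rw [hM _ (by lia), mul_zero]⟩)
        (fin_of_bound ⟨(M' - m).toNat, fun j hj => by rw [hM' _ (by lia), mul_zero]⟩)]
      refine finsum_congr fun j => ?_
      rw [zw_apply, mul_sub, show m + 1 + j = m + j + (1 : ℤ) by ring]
    rw [key]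
    exact ih h' hF

theorem isLocal_X_zero_mul {ι : Type*} {d : ι → ℕ} (hd : ∀ i, Odd (d i)) (i : ι) (a : Fock ι)
    (h : ∀ c, IsLocal (Y d a) (Y d c)) (c : Fock ι) : IsLocal (Y d (X (i, 0) * a)) (Y d c) := by
  obtain ⟨K₀, hK₀⟩ := Y_mul_X d i c
  obtain ⟨K₁, hK₁⟩ := pderiv_bound i c
  obtain ⟨K, hKK₀, hKK₁⟩ : ∃ K, K₀ ≤ K ∧ K₁ ≤ K := ⟨max K₀ K₁, le_max_left _ _, le_max_right _ _⟩
  replace hK₀ := hK₀ K hKK₀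
  replace hK₁ : ∀ k, K ≤ k → pderiv (i, k) c = 0 := fun k hk => hK₁ k (by lia)
  obtain ⟨N, hN⟩ := h c
  choose Nk hNk using fun k => h (pderiv (i, k) c)
  set N' : ℕ := N + ∑ k ∈ Finset.range K, (Nk k + (k + d i + 1)) with hN'
  refine ⟨N', fun v => ?_⟩
  obtain ⟨L, hL⟩ := pderiv_bound i v
  let F : ℕ → ℤ → ℤ → Fock ι := fun k m n =>
    ncoeff (Y d a) m (ncoeff (Y d (pderiv (i, k) c)) n v)
  let G : ℕ → ℤ → ℤ → Fock ι := fun k m n =>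
    ncoeff (Y d (pderiv (i, k) c)) n (ncoeff (Y d a) m v)
  have hF : ∀ k, ∃ N₀ : ℤ, ∀ n, N₀ ≤ n → ∀ m, F k m n = 0 := fun k => by
    obtain ⟨M, hM⟩ := exists_bound (Y d (pderiv (i, k) c)) v
    exact ⟨M, fun n hn m => by simp only [F]; rw [hM n hn, map_zero]⟩
  have hG : ∀ k, ∃ N₀ : ℤ, ∀ m, N₀ ≤ m → ∀ n, G k m n = 0 := fun k => by
    obtain ⟨M, hM⟩ := exists_bound (Y d a) v
    exact ⟨M, fun n hn m => by simp only [G]; rw [hM n hn, map_zero]⟩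
  have key : comm (Y d (X (i, 0) * a)) (Y d c) v =
      (fun m n : ℤ => ∑ᶠ j : ℕ, X (i, j) * comm (Y d a) (Y d c) v (m + j) n) +
      (fun m n : ℤ => ∑ l ∈ Finset.range L, coef (d i) 0 l •
        comm (Y d a) (Y d c) (pderiv (i, l) v) (m - l - d i - 1) n) +
      ∑ k ∈ Finset.range K, ((k + d i).choose k : ℂ) •
        (expR (k + d i + 1) (F k) - ((-1) ^ k : ℂ) • expL (k + d i + 1) (G k)) := by
    funext m n
    have hR : ∀ k, ∀ᶠ M : ℕ in Filter.atTop, ∑ l ∈ Finset.range M,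
        (coef (d i) 0 l * (l.choose k : ℂ)) • F k (m - l - d i - 1) (n + l - k) =
          ((k + d i).choose k : ℂ) • expR (k + d i + 1) (F k) m n := by
      intro k
      obtain ⟨B, hB⟩ := hF k
      filter_upwards [Filter.eventually_ge_atTop (k + (B - n).toNat)] with M hM
      obtain ⟨M, rfl⟩ : ∃ M', M = k + M' := ⟨M - k, by lia⟩
      rw [expR, finsum_range M (fun j hj => by rw [hB _ (by lia), smul_zero]), Finset.sum_range_add,
        Finset.sum_eq_zero, zero_add, Finset.smul_sum]
      · refine Finset.sum_congr rfl fun j _ => ?_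
        rw [coef_mul_choose, smul_smul]
        congr 2
        · push_cast; ring
        · push_cast; ring
      · intro l hl
        rw [Nat.choose_eq_zero_of_lt (Finset.mem_range.1 hl), Nat.cast_zero, mul_zero, zero_smul]
    have hL' : ∀ k, ∀ᶠ M : ℕ in Filter.atTop, ∑ j ∈ Finset.range M,
        coef (d i) k j • G k (m + j) (n - k - j - d i - 1) =
          (((k + d i).choose k : ℂ) * (-1) ^ k) • expL (k + d i + 1) (G k) m n := by
      intro k
      obtain ⟨B, hB⟩ := hG k
      filter_upwards [Filter.eventually_ge_atTop (B - m).toNat] with M hM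
      rw [expL, finsum_range M (fun j hj => by rw [hB _ (by lia), smul_zero]), Finset.smul_sum]
      refine Finset.sum_congr rfl fun j _ => ?_
      rw [coef_eq, smul_smul]
      congr 1
      · ring
      · congr 1; push_cast; ring
    have hP : ∀ᶠ M : ℕ in Filter.atTop, ∑ᶠ j : ℕ, X (i, j) * comm (Y d a) (Y d c) v (m + j) n =
        ∑ j ∈ Finset.range M, X (i, j) * comm (Y d a) (Y d c) v (m + j) n := by
      obtain ⟨B, hB⟩ := exists_bound (Y d a) v
      obtain ⟨B', hB'⟩ := exists_bound (Y d a) (ncoeff (Y d c) n v)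
      filter_upwards [Filter.eventually_ge_atTop (max (B - m).toNat (B' - m).toNat)] with M hM
      exact finsum_range M fun j hj => by
        rw [comm, hB _ (by lia), hB' _ (by lia), map_zero, sub_zero, mul_zero]
    obtain ⟨M, h1, h2, h3, h4, h5, h6⟩ := ((normalOrder_ev d (i, 0) (Y d a) m
      (ncoeff (Y d c) n v)).and ((normalOrder_ev d (i, 0) (Y d a) m v).and (hP.and
      (((Finset.range K).eventually_all.2 fun k _ => hR k).and
      (((Finset.range K).eventually_all.2 fun k _ => hL' k).and
      (Filter.eventually_ge_atTop L)))))).exists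
    have hd' : ∀ l : ℕ, pderiv (i, l) (ncoeff (Y d c) n v) = ncoeff (Y d c) n (pderiv (i, l) v) +
        ∑ k ∈ Finset.range K, (l.choose k : ℂ) •
          ncoeff (Y d (pderiv (i, k) c)) (n + l - k) v := by
      intro l
      rw [pderiv_Y]
      congr 1
      have e := fun k (hk : k ∉ Finset.range (l + 1)) => show (l.choose k : ℂ) •
          ncoeff (Y d (pderiv (i, k) c)) (n + l - k) v = 0 by
        rw [Nat.choose_eq_zero_of_lt (by simpa using hk), Nat.cast_zero, zero_smul]
      have e' := fun k (hk : k ∉ Finset.range K) => show (l.choose k : ℂ) •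
          ncoeff (Y d (pderiv (i, k) c)) (n + l - k) v = 0 by
        rw [hK₁ k (by simpa using hk), Y_zero_apply, smul_zero]
      rw [← finsum_eq_sum_of_support_subset (s := Finset.range (l + 1)),
        ← finsum_eq_sum_of_support_subset (s := Finset.range K)]
      · intro k hk; by_contra h; exact hk (e' k h)
      · intro k hk; by_contra h; exact hk (e k h)
    have hP2 : ∑ l ∈ Finset.range L, coef (d i) 0 l •
        comm (Y d a) (Y d c) (pderiv (i, l) v) (m - l - d i - 1) n =
        ∑ l ∈ Finset.range M, coef (d i) 0 l •
          comm (Y d a) (Y d c) (pderiv (i, l) v) (m - l - d i - 1) n := by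
      apply Finset.sum_subset (by simpa using h6)
      intro l _ hl
      rw [hL l (by simpa using hl), comm, map_zero, map_zero, map_zero, sub_zero,
        smul_zero]
    rw [comm, Y_X_mul, h1, h2, Pi.add_apply, Pi.add_apply, Pi.add_apply, Pi.add_apply, h3, hP2,
      Finset.sum_apply, Finset.sum_apply]
    have hS : ∑ k ∈ Finset.range K, (((k + d i).choose k : ℂ) •
        (expR (k + d i + 1) (F k) - ((-1) ^ k : ℂ) • expL (k + d i + 1) (G k))) m n =
        ∑ k ∈ Finset.range K, (∑ l ∈ Finset.range M,
          (coef (d i) 0 l * (l.choose k : ℂ)) • F k (m - l - d i - 1) (n + l - k) -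
          ∑ j ∈ Finset.range M, coef (d i) k j • G k (m + j) (n - k - j - d i - 1)) := by
      refine Finset.sum_congr rfl fun k hk => ?_
      rw [h4 k hk, h5 k hk]
      simp only [Pi.smul_apply, Pi.sub_apply, smul_sub, smul_smul]
    rw [hS]
    clear h1 h2 h3 h4 h5 hS hP2
    simp only [zero_add, Nat.choose_zero_right, Nat.cast_one, one_smul, Nat.cast_zero, sub_zero,
      map_add, map_sum, map_smul, hd', hK₀, comm, smul_sub, smul_add, mul_sub,
      Finset.sum_add_distrib, Finset.sum_sub_distrib, Finset.smul_sum, smul_smul]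
    rw [Finset.sum_comm (s := Finset.range K) (t := Finset.range M),
      Finset.sum_comm (s := Finset.range K) (t := Finset.range M)]
    simp only [F, G]
    abel
  have shift : ∀ (N : ℕ) (t : ℤ) (F : ℤ → ℤ → Fock ι), (zw (Fock ι) ^ N) F = 0 →
      (zw (Fock ι) ^ N) (fun m n : ℤ => F (m + t) n) = 0 := by
    intro N t F hF
    funext m n
    rw [zw_pow_apply]
    have := congr_fun (congr_fun hF (m + t)) n
    rw [zw_pow_apply] at this
    refine Eq.trans ?_ this
    refine Finset.sum_congr rfl fun j _ => ?_
    rw [show m + N - j + t = m + t + N - (j : ℤ) by ring]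
  rw [key, map_add, map_add, map_sum]
  have p1 : (zw (Fock ι) ^ N') (fun m n : ℤ => ∑ᶠ j : ℕ, X (i, j) *
      comm (Y d a) (Y d c) v (m + j) n) = 0 := by
    apply zw_mul_sum
    · intro n
      obtain ⟨M, hM⟩ := exists_bound (Y d a) v
      obtain ⟨M', hM'⟩ := exists_bound (Y d a) (ncoeff (Y d c) n v)
      exact ⟨max M M', fun m hm => by
        rw [comm, hM _ (by lia), hM' _ (by lia), map_zero, sub_zero]⟩
    · exact zw_pow_eq_zero (hN v) (by lia)
  have p2 : (zw (Fock ι) ^ N') (fun m n : ℤ => ∑ l ∈ Finset.range L, coef (d i) 0 l •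
        comm (Y d a) (Y d c) (pderiv (i, l) v) (m - l - d i - 1) n) = 0 := by
    have e : (fun m n : ℤ => ∑ l ∈ Finset.range L, coef (d i) 0 l •
        comm (Y d a) (Y d c) (pderiv (i, l) v) (m - l - d i - 1) n) =
        ∑ l ∈ Finset.range L, coef (d i) 0 l • fun m n : ℤ =>
          comm (Y d a) (Y d c) (pderiv (i, l) v) (m + (- l - d i - 1)) n := by
      funext m n
      rw [Finset.sum_apply, Finset.sum_apply]
      refine Finset.sum_congr rfl fun l _ => ?_
      rw [Pi.smul_apply, Pi.smul_apply, show m + (- l - d i - 1) = m - l - d i - (1 : ℤ) by ring]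
    rw [e, map_sum]
    refine Finset.sum_eq_zero fun l _ => ?_
    rw [map_smul, shift _ _ _ (zw_pow_eq_zero (hN _) (by lia)), smul_zero]
  rw [p1, p2, add_zero, zero_add]
  refine Finset.sum_eq_zero fun k hk => ?_
  have hle : Nk k + (k + d i + 1) ≤ N' := by
    have := Finset.single_le_sum (f := fun k => Nk k + (k + d i + 1))
      (fun _ _ => Nat.zero_le _) hk
    lia
  rw [map_smul]
  have : (zw (Fock ι) ^ (Nk k + (k + d i + 1)))
      (expR (k + d i + 1) (F k) - ((-1) ^ k : ℂ) • expL (k + d i + 1) (G k)) = 0 := by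
    rw [pow_add, Module.End.mul_apply, map_sub, map_smul, zw_expR (hF k), zw_expL (hG k), smul_smul,
      ← pow_add, show k + (k + d i + 1) = k + k + (d i + 1) by lia,
      Even.neg_one_pow (Even.add (⟨k, rfl⟩ : Even (k + k)) (hd i).add_one), one_smul]
    exact hNk k v
  rw [zw_pow_eq_zero this hle, smul_zero]

theorem isLocal_add {ι : Type*} (d : ι → ℕ) {a b : Fock ι} {C : VertexOperator ℂ (Fock ι)}
    (ha : IsLocal (Y d a) C) (hb : IsLocal (Y d b) C) : IsLocal (Y d (a + b)) C := by
  obtain ⟨N, hN⟩ := ha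
  obtain ⟨M, hM⟩ := hb
  refine ⟨N + M, fun v => ?_⟩
  have : comm (Y d (a + b)) C v = comm (Y d a) C v + comm (Y d b) C v := by
    funext m n
    simp only [comm, Pi.add_apply, Y_add_apply]
    simp only [map_add]
    abel
  rw [this, map_add, zw_pow_eq_zero (hN v) (by lia), zw_pow_eq_zero (hM v) (by lia), add_zero]

theorem isLocal_smul {ι : Type*} (d : ι → ℕ) (r : ℂ) {a : Fock ι} {C : VertexOperator ℂ (Fock ι)}
    (ha : IsLocal (Y d a) C) : IsLocal (Y d (r • a)) C := by
  obtain ⟨N, hN⟩ := ha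
  refine ⟨N, fun v => ?_⟩
  have : comm (Y d (r • a)) C v = r • comm (Y d a) C v := by
    funext m n
    simp only [comm, Pi.smul_apply, Y_smul_apply]
    simp only [map_smul, smul_sub]
  rw [this, map_smul, hN, smul_zero]

theorem isLocal_one {ι : Type*} (d : ι → ℕ) (C : VertexOperator ℂ (Fock ι)) :
    IsLocal (Y d 1) C := by
  refine ⟨0, fun v => ?_⟩
  rw [pow_zero, Module.End.one_apply]
  funext m n
  simp only [comm, Y_one, idOp_apply]
  split_ifs
  · exact sub_self _
  · rw [map_zero]; exact sub_self _

theorem isLocal_Y {ι : Type*} {d : ι → ℕ} (hd : ∀ i, Odd (d i)) (a : Fock ι) :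
    ∀ c, IsLocal (Y d a) (Y d c) := by
  induction a using fock_induction with
  | one => exact fun c => isLocal_one d _
  | add a b ha hb => exact fun c => isLocal_add d (ha c) (hb c)
  | smul r a ha => exact fun c => isLocal_smul d r (ha c)
  | mul p a ha =>
    obtain ⟨i, k⟩ := p
    induction k generalizing a with
    | zero => exact isLocal_X_zero_mul hd i a ha
    | succ k ih =>
      intro c
      have h : (X (i, k + 1) * a : Fock ι) = (((k + 1 : ℕ) : ℂ)⁻¹) •
          (translation ι (X (i, k) * a) + (-1 : ℂ) • (X (i, k) * translation ι a)) := by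
        rw [Derivation.leibniz, translation_X, smul_eq_mul, smul_eq_mul, neg_one_smul,
          add_comm (X (i, k) * _), add_assoc, add_neg_cancel, add_zero, mul_smul_comm, smul_smul,
          inv_mul_cancel₀ (Nat.cast_ne_zero.2 (Nat.succ_ne_zero k)), one_smul, mul_comm]
      rw [h]
      exact isLocal_smul d _ (isLocal_add d (isLocal_translation d _ (ih a ha c))
        (isLocal_smul d _ (ih _ (fun c => isLocal_translation d a (ha c)) c)))


/-- The algebra automorphism of the Fock space that multiplies `x_{i,k}` by the sign `ε i`. -/
noncomputable def rescale {ι : Type*} (ε : ι → ℤˣ) : Fock ι ≃ₗ[ℂ] Fock ι :=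
  LinearEquiv.ofInvolutive
    (aeval (fun p : ι × ℕ => ((ε p.1 : ℤ) : ℂ) • (X p : Fock ι))).toLinearMap (fun v => by
      rw [AlgHom.toLinearMap_apply, AlgHom.toLinearMap_apply, ← AlgHom.comp_apply]
      have : (aeval (fun p : ι × ℕ => ((ε p.1 : ℤ) : ℂ) • (X p : Fock ι))).comp
          (aeval (fun p : ι × ℕ => ((ε p.1 : ℤ) : ℂ) • (X p : Fock ι))) = AlgHom.id ℂ _ := by
        apply MvPolynomial.algHom_ext
        intro p
        rw [AlgHom.comp_apply, aeval_X, map_smul, aeval_X, smul_smul, ← Int.cast_mul,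
          ← Units.val_mul, Int.units_mul_self]
        simp
      rw [this, AlgHom.id_apply])

theorem rescale_apply {ι : Type*} (ε : ι → ℤˣ) (v : Fock ι) : rescale ε v =
    aeval (fun p : ι × ℕ => ((ε p.1 : ℤ) : ℂ) • (X p : Fock ι)) v := rfl

theorem rescale_X_mul {ι : Type*} (ε : ι → ℤˣ) (p : ι × ℕ) (v : Fock ι) :
    rescale ε (X p * v) = ((ε p.1 : ℤ) : ℂ) • (X p * rescale ε v) := by
  rw [rescale_apply, map_mul, aeval_X, smul_mul_assoc, rescale_apply]

theorem units_mul_self {ι : Type*} (ε : ι → ℤˣ) (i : ι) : ((ε i : ℤ) : ℂ) * ((ε i : ℤ) : ℂ) = 1 := by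
  rw [← Int.cast_mul, ← Units.val_mul, Int.units_mul_self]; simp

theorem pderiv_rescale {ι : Type*} (ε : ι → ℤˣ) (p : ι × ℕ) (v : Fock ι) :
    pderiv p (rescale ε v) = ((ε p.1 : ℤ) : ℂ) • rescale ε (pderiv p v) := by
  classical
  induction v using fock_induction with
  | one => simp [rescale_apply]
  | add a b ha hb => simp only [map_add, ha, hb, smul_add]
  | smul r a ha => simp only [map_smul, Derivation.map_smul, ha, smul_comm r]
  | mul q a ha =>
    rw [rescale_X_mul, Derivation.map_smul, Derivation.leibniz, Derivation.leibniz, ha, pderiv_X,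
      Pi.single_apply]
    simp only [smul_eq_mul, map_add, rescale_X_mul, mul_ite, mul_one, mul_zero, smul_add,
      mul_smul_comm]
    congr 1
    · rw [smul_comm]
    · split_ifs with h
      · rw [h]
      · simp

theorem rescale_Y {ι : Type*} (d : ι → ℕ) (ε : ι → ℤˣ) (a : Fock ι) : ∀ (n : ℤ) (b : Fock ι),
    rescale ε (ncoeff (Y d a) n b) = ncoeff (Y d (rescale ε a)) n (rescale ε b) := by
  induction a using fock_induction with
  | one =>
    intro n b
    have : rescale ε (1 : Fock ι) = 1 := by rw [rescale_apply, map_one]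
    rw [this, Y_one, idOp_apply, idOp_apply]
    split_ifs
    · rfl
    · exact map_zero _
  | add a b ha hb =>
    intro n v
    rw [map_add (rescale ε), Y_add_apply, Y_add_apply, map_add, ha, hb]
  | smul r a ha =>
    intro n v
    rw [map_smul (rescale ε), Y_smul_apply, Y_smul_apply, map_smul, ha]
  | mul p a ha =>
    intro n v
    obtain ⟨M, h1, h2⟩ := ((normalOrder_ev d p (Y d a) n v).and
      (normalOrder_ev d p (Y d (rescale ε a)) n (rescale ε v))).exists
    rw [rescale_X_mul, Y_smul_apply, Y_X_mul, Y_X_mul, h1, h2]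
    clear h1 h2
    simp only [map_add, map_sum, map_smul, rescale_X_mul, ha, pderiv_rescale, smul_add,
      Finset.smul_sum, smul_smul]
    congr 1
    · refine Finset.sum_congr rfl fun j _ => ?_
      rw [mul_comm]
    · refine Finset.sum_congr rfl fun l _ => ?_
      rw [mul_left_comm, units_mul_self, mul_one]

end FreeField

/-- The free field algebra with even generators `W i`, of weight `wt i`, and operator products
`W i (z) W j (w) ∼ δ_{ij} (z - w) ^ (-2 * wt i)`: the tensor product over `i` of the rank one even
algebras of orthogonal type `O_ev(1, 2 * wt i)`. The generator `W i` is the variable `X (i, 0)`. -/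
noncomputable def freeFieldAlgebra {ι : Type*} (wt : ι → ℕ) (hwt : ∀ i, 0 < wt i) :
    VertexAlgebra (FreeField.Fock ι) where
  vac := 1
  T := (FreeField.translation ι).toLinearMap
  Y := FreeField.Y fun i => 2 * wt i - 1
  Y_vac n b := by rw [FreeField.Y_one, FreeField.idOp_apply]
  Y_creation a := (FreeField.Y_creation _ a).1
  Y_creation_neg_one a := (FreeField.Y_creation _ a).2
  T_vac := Derivation.map_one_eq_zero _
  translation a n b := by
    change FreeField.translation ι _ - ncoeff _ n (FreeField.translation ι b) = _
    rw [FreeField.translation_Y,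
      add_sub_cancel_left]
  locality a b := by
    obtain ⟨N, hN⟩ := FreeField.isLocal_Y (d := fun i => 2 * wt i - 1)
      (fun i => ⟨wt i - 1, by have := hwt i; lia⟩) a b
    refine ⟨N, fun m n c => ?_⟩
    have := congr_fun (congr_fun (hN c) m) n
    rwa [FreeField.zw_pow_apply] at this

/-- The operator products of the generators. -/
theorem freeFieldAlgebra_ope {ι : Type*} [DecidableEq ι] (wt : ι → ℕ) (hwt : ∀ i, 0 < wt i)
    (i j : ι) (m : ℕ) :
    ncoeff ((freeFieldAlgebra wt hwt).Y (MvPolynomial.X (i, 0))) m (MvPolynomial.X (j, 0)) =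
      if i = j ∧ m + 1 = 2 * wt i then 1 else 0 := by
  change ncoeff (FreeField.Y (fun i => 2 * wt i - 1) (MvPolynomial.X (i, 0))) m _ = _
  rw [← mul_one (MvPolynomial.X (i, 0) : FreeField.Fock ι), FreeField.Y_X_mul, FreeField.Y_one]
  obtain ⟨M, h, hM⟩ := ((FreeField.normalOrder_ev (fun i => 2 * wt i - 1) (i, 0)
    (FreeField.idOp ι) m (MvPolynomial.X (j, 0))).and (Filter.eventually_ge_atTop 1)).exists
  rw [h, Finset.sum_eq_zero, zero_add, Finset.sum_eq_single 0]
  · have := hwt i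
    rw [FreeField.idOp_apply, FreeField.pderiv_X', FreeField.coef]
    by_cases hij : i = j
    · subst hij
      by_cases hm : m + 1 = 2 * wt i
      · rw [if_pos (by push_cast; lia), if_pos ⟨rfl, rfl⟩, if_pos ⟨rfl, hm⟩]
        simp
      · rw [if_neg (by push_cast; lia), if_neg (by tauto), smul_zero]
    · have hji : ¬ j = i := fun h => hij h.symm
      simp [hij, hji]
  · intro l _ hl
    rw [FreeField.pderiv_X', if_neg (fun h => hl h.2.symm), map_zero, smul_zero]
  · intro h
    simp at h
    lia
  · intro j _
    rw [FreeField.idOp_apply, if_neg (by push_cast; lia), mul_zero, smul_zero]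

/-- The automorphism of a free field algebra that multiplies each generator `W i` by the sign
`ε i`. -/
noncomputable def freeFieldSign {ι : Type*} (wt : ι → ℕ) (hwt : ∀ i, 0 < wt i) (ε : ι → ℤˣ) :
    (freeFieldAlgebra wt hwt).Automorphism where
  toLinearEquiv := FreeField.rescale ε
  map_vac := map_one (MvPolynomial.aeval (R := ℂ) fun p : ι × ℕ =>
    ((ε p.1 : ℤ) : ℂ) • (MvPolynomial.X p : FreeField.Fock ι))
  map_ncoeff a n b := FreeField.rescale_Y _ ε a n b

namespace WFree

/-- The free field limit `W^free(sl_n)`, the tensor product of the `O_ev(1, 2i)`, `2 ≤ i ≤ n`. -/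
noncomputable def algebra (n : ℕ) : VertexAlgebra (FreeField.Fock (Set.Icc 2 n)) :=
  freeFieldAlgebra (fun i => (i : ℕ)) fun i => lt_of_lt_of_le two_pos i.2.1

/-- The involution `θ` of `W^free(sl_n)` with `θ(W^i) = (-1)^i W^i`. -/
noncomputable def involution (n : ℕ) : (algebra n).Automorphism :=
  freeFieldSign _ _ fun i => (-1) ^ (i : ℕ)

/-- The orbifold `W^free(sl_n)^{ℤ₂}`. -/
noncomputable def orbifold (n : ℕ) : (algebra n).Subalgebra :=
  (algebra n).orbifold (involution n)

/-- The generator `W^i` of weight `i`, for `2 ≤ i ≤ n` (and `0` for all other `i`, which do not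
occur below). -/
noncomputable def W (n i : ℕ) : FreeField.Fock (Set.Icc 2 n) :=
  if h : i ∈ Set.Icc 2 n then MvPolynomial.X (⟨i, h⟩, 0) else 0

/-- `U^{i,j}_{a,b} = :(∂^a W^i)(∂^b W^j):`. -/
noncomputable def U (n i j a b : ℕ) : FreeField.Fock (Set.Icc 2 n) :=
  (algebra n).wick (((algebra n).T ^ a) (W n i)) (((algebra n).T ^ b) (W n j))

/-- The set `T` of strong generators of the orbifold; `2 * i ≤ n` and `2 * i < n` stand for
`i ≤ n / 2` and `i < n / 2`. -/
def generators (n : ℕ) : Set (FreeField.Fock (Set.Icc 2 n)) :=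
  {v | ∃ i, 1 ≤ i ∧ 2 * i ≤ n ∧ v = W n (2 * i)} ∪
  {v | ∃ a ≤ 3, v = U n 3 3 0 (2 * a)} ∪
  {v | ∃ i, 2 ≤ i ∧ 2 * i < n ∧ ∃ a ≤ 6, v = U n 3 (2 * i + 1) 0 a} ∪
  {v | ∃ i, 2 ≤ i ∧ 2 * i < n ∧ ∃ a ≤ 2, v = U n (2 * i + 1) (2 * i + 1) 0 (2 * a)} ∪
  {v | ∃ i j, 2 ≤ i ∧ i < j ∧ 2 * j < n ∧ ∃ a ≤ 5, v = U n (2 * i + 1) (2 * j + 1) 0 a}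

end WFree

/-!
# The `ℤ₂`-orbifold of the free field limit of `W^k(sl_n)`

The Fock space is the polynomial ring in the variables `x_{i,k} = ∂ᵏW^i / k!`, and the orbifold is
spanned by the monomials with an even number of odd variables, i.e. variables with `i` odd. Both
halves of the theorem rest on one formula (`wick_X_mul_X`): the Wick product of `x_p x_q` with a
state `v` is `x_p x_q v` plus two contractions, derivations of the form `x_{i,k} ∂/∂x_{j,l}`, which
preserve the polynomial degree and the number of odd variables.

*Strong generation.* A Nakayama lemma (`isStrongGeneratingSet_of_le_generatedPart`) reduces strong
generation to generation modulo derivatives and Wick products of states of smaller conformal weight.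
Its proof rewrites nested Wick products, which requires that the field of `:ab:` is the normally
ordered product of the fields of `a` and `b` (`Y_wick`); this follows from Dong's lemma
(`zw_pow_residue_eq_zero`), because a field that is local to all fields is determined by its value on
the vacuum. By the formula for Wick products, each monomial in the orbifold of degree larger than two
is a Wick product up to monomials of smaller degree, so that only quadratic states matter
(`monomial_mem_generated`). Integration by parts reduces these to `x_{p,0} x_{r,m}`, with `m` even
for `p = r`. For large `m` they are decomposable: the Wick products of the two ways to pair four odd
variables have the same quartic term, so their difference is quadratic. With at least two
of the variables belonging to `W^3`, this gives the relations `three_mul_X_mem_generated`,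
`three_mul_three_mem_generated` and `X_zero_mul_X_mem_generated`.

*Minimality.* For each generator there is a linear functional that vanishes on derivatives, on
decomposable states and on all other generators (`exists_functional`), so that the generator cannot
be omitted (`mem_of_vanishesOnDecomposables`). For `W^i` this is the coefficient of `x_{i,0}`. For a
quadratic generator with `m` derivatives it is an alternating sum of coefficients of
`x_{p,a} x_{r,b}`, `a + b = m`. As contractions produce variables `x_{p,k}` with `k` at least twice
the weight of the contracted generator, hence `k ≥ 6`, they do not contribute for `m ≤ 5`. For
`m = 6`, which occurs only for `p = 3`, they do, and this is compensated by a multiple of the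
coefficient of the quartic monomial `x_{3,0}³ x_{r,0}`.
-/

namespace FreeField

open MvPolynomial

/-! ### Dong's lemma for formal distributions in three variables -/

section Residue

variable {V : Type*} [AddCommGroup V] [Module ℂ V]

/-- Multiplication of a formal distribution in `z₁, z₂, z₃` by `z₁ - z₂`, where `F l m n` is the
coefficient of `z₁ ^ (-l - 1) * z₂ ^ (-m - 1) * z₃ ^ (-n - 1)`. -/
def diff₁₂ (V : Type*) [AddCommGroup V] [Module ℂ V] : Module.End ℂ (ℤ → ℤ → ℤ → V) where
  toFun F l m n := F (l + 1) m n - F l (m + 1) n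
  map_add' F G := by
    funext l m n
    simp only [Pi.add_apply]
    abel
  map_smul' r F := by
    funext l m n
    simp only [Pi.smul_apply, smul_sub, RingHom.id_apply]

/-- Multiplication of a formal distribution in `z₁, z₂, z₃` by `z₁ - z₃`, on coefficients. -/
def diff₁₃ (V : Type*) [AddCommGroup V] [Module ℂ V] : Module.End ℂ (ℤ → ℤ → ℤ → V) where
  toFun F l m n := F (l + 1) m n - F l m (n + 1)
  map_add' F G := by
    funext l m n
    simp only [Pi.add_apply]
    abel
  map_smul' r F := by
    funext l m n
    simp only [Pi.smul_apply, smul_sub, RingHom.id_apply]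

/-- Multiplication of a formal distribution in `z₁, z₂, z₃` by `z₂ - z₃`, on coefficients. -/
def diff₂₃ (V : Type*) [AddCommGroup V] [Module ℂ V] : Module.End ℂ (ℤ → ℤ → ℤ → V) where
  toFun F l m n := F l (m + 1) n - F l m (n + 1)
  map_add' F G := by
    funext l m n
    simp only [Pi.add_apply]
    abel
  map_smul' r F := by
    funext l m n
    simp only [Pi.smul_apply, smul_sub, RingHom.id_apply]

theorem diff₁₂_apply (F : ℤ → ℤ → ℤ → V) (l m n : ℤ) :
    diff₁₂ V F l m n = F (l + 1) m n - F l (m + 1) n := rfl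

theorem diff₁₃_apply (F : ℤ → ℤ → ℤ → V) (l m n : ℤ) :
    diff₁₃ V F l m n = F (l + 1) m n - F l m (n + 1) := rfl

theorem diff₂₃_apply (F : ℤ → ℤ → ℤ → V) (l m n : ℤ) :
    diff₂₃ V F l m n = F l (m + 1) n - F l m (n + 1) := rfl

theorem commute_diff₁₂_diff₁₃ : Commute (diff₁₂ V) (diff₁₃ V) := by
  refine LinearMap.ext fun F => ?_
  funext l m n
  simp only [Module.End.mul_apply, diff₁₂_apply, diff₁₃_apply]
  abel

theorem commute_diff₁₂_diff₂₃ : Commute (diff₁₂ V) (diff₂₃ V) := by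
  refine LinearMap.ext fun F => ?_
  funext l m n
  simp only [Module.End.mul_apply, diff₁₂_apply, diff₂₃_apply]
  abel

theorem commute_diff₁₃_diff₂₃ : Commute (diff₁₃ V) (diff₂₃ V) := by
  refine LinearMap.ext fun F => ?_
  funext l m n
  simp only [Module.End.mul_apply, diff₁₃_apply, diff₂₃_apply]
  abel

theorem diff₂₃_eq : diff₂₃ V = diff₁₃ V - diff₁₂ V := by
  refine LinearMap.ext fun F => ?_
  funext l m n
  simp only [LinearMap.sub_apply, Pi.sub_apply, diff₁₂_apply, diff₁₃_apply, diff₂₃_apply]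
  abel

theorem diff₁₂_pow_apply (N : ℕ) (F : ℤ → ℤ → ℤ → V) (n : ℤ) :
    (fun l m => (diff₁₂ V ^ N) F l m n) = (zw V ^ N) (fun l m => F l m n) := by
  induction N generalizing F with
  | zero => rfl
  | succ N ih =>
    rw [pow_succ, pow_succ, Module.End.mul_apply, Module.End.mul_apply, ih]
    rfl

theorem diff₁₃_pow_apply (N : ℕ) (F : ℤ → ℤ → ℤ → V) (m : ℤ) :
    (fun l n => (diff₁₃ V ^ N) F l m n) = (zw V ^ N) (fun l n => F l m n) := by
  induction N generalizing F with
  | zero => rfl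
  | succ N ih =>
    rw [pow_succ, pow_succ, Module.End.mul_apply, Module.End.mul_apply, ih]
    rfl

theorem diff₂₃_pow_apply (N : ℕ) (F : ℤ → ℤ → ℤ → V) (l : ℤ) :
    (fun m n => (diff₂₃ V ^ N) F l m n) = (zw V ^ N) (fun m n => F l m n) := by
  induction N generalizing F with
  | zero => rfl
  | succ N ih =>
    rw [pow_succ, pow_succ, Module.End.mul_apply, Module.End.mul_apply, ih]
    rfl

/-- The pairs of formal distributions for which the sums in `residue` are finite. -/
def residueDomain (V : Type*) [AddCommGroup V] [Module ℂ V] :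
    Submodule ℂ ((ℤ → ℤ → ℤ → V) × (ℤ → ℤ → ℤ → V)) where
  carrier := {p | ∀ m n, ∃ K : ℕ, ∀ j : ℕ, K ≤ j →
    p.1 (-1 - j) (m + j) n = 0 ∧ p.2 j (m - 1 - j) n = 0}
  zero_mem' m n := ⟨0, fun j _ => ⟨rfl, rfl⟩⟩
  add_mem' {p q} hp hq m n := by
    obtain ⟨K, hK⟩ := hp m n
    obtain ⟨L, hL⟩ := hq m n
    refine ⟨max K L, fun j hj => ?_⟩
    simp [hK j (by lia), hL j (by lia)]
  smul_mem' r p hp m n := by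
    obtain ⟨K, hK⟩ := hp m n
    exact ⟨K, fun j hj => by simp [hK j hj]⟩

/-- The residue in `z₁` of `p.1 / (z₁ - z₂) - p.2 / (z₁ - z₂)`, where the first fraction is expanded
in the domain `|z₁| > |z₂|` and the second one in the domain `|z₂| > |z₁|`. -/
noncomputable def residue (p : (ℤ → ℤ → ℤ → V) × (ℤ → ℤ → ℤ → V)) (m n : ℤ) : V :=
  ∑ᶠ j : ℕ, (p.1 (-1 - j) (m + j) n + p.2 j (m - 1 - j) n)

theorem hasFiniteSupport_of_mem_residueDomain {p : (ℤ → ℤ → ℤ → V) × (ℤ → ℤ → ℤ → V)}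
    (hp : p ∈ residueDomain V) (m n : ℤ) :
    Function.HasFiniteSupport fun j : ℕ => p.1 (-1 - j) (m + j) n + p.2 j (m - 1 - j) n := by
  obtain ⟨K, hK⟩ := hp m n
  exact fin_of_bound ⟨K, fun j hj => by rw [(hK j hj).1, (hK j hj).2, add_zero]⟩

theorem residue_sub {p q : (ℤ → ℤ → ℤ → V) × (ℤ → ℤ → ℤ → V)} (hp : p ∈ residueDomain V)
    (hq : q ∈ residueDomain V) : residue (p - q) = residue p - residue q := by
  funext m n
  rw [Pi.sub_apply, Pi.sub_apply, residue, residue, residue, ← finsum_sub_distrib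
    (hasFiniteSupport_of_mem_residueDomain hp m n) (hasFiniteSupport_of_mem_residueDomain hq m n)]
  refine finsum_congr fun j => ?_
  simp only [Prod.fst_sub, Prod.snd_sub, Pi.sub_apply]
  abel

theorem diff₁₂_mem_residueDomain {p : (ℤ → ℤ → ℤ → V) × (ℤ → ℤ → ℤ → V)}
    (hp : p ∈ residueDomain V) : p.map (diff₁₂ V) (diff₁₂ V) ∈ residueDomain V := by
  intro m n
  obtain ⟨K, hK⟩ := hp (m + 1) n
  refine ⟨K + 1, fun j hj => ?_⟩
  simp only [Prod.map_fst, Prod.map_snd, diff₁₂_apply]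
  have h1 := (hK (j - 1) (by lia)).1
  have h2 := hK j (by lia)
  have h3 := (hK (j + 1) (by lia)).2
  rw [show (-1 - ((j - 1 : ℕ) : ℤ)) = -1 - j + 1 by lia,
    show m + 1 + ((j - 1 : ℕ) : ℤ) = m + j by lia] at h1
  rw [show m + 1 + (j : ℤ) = m + j + 1 by ring, show m + 1 - 1 - (j : ℤ) = m - 1 - j + 1 by ring]
    at h2
  rw [show m + 1 - 1 - ((j + 1 : ℕ) : ℤ) = m - 1 - j by push_cast; ring, Nat.cast_succ] at h3
  rw [h1, h2.1, h2.2, h3]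
  simp

theorem diff₂₃_mem_residueDomain {p : (ℤ → ℤ → ℤ → V) × (ℤ → ℤ → ℤ → V)}
    (hp : p ∈ residueDomain V) : p.map (diff₂₃ V) (diff₂₃ V) ∈ residueDomain V := by
  intro m n
  obtain ⟨K, hK⟩ := hp (m + 1) n
  obtain ⟨L, hL⟩ := hp m (n + 1)
  refine ⟨max K L, fun j hj => ?_⟩
  simp only [Prod.map_fst, Prod.map_snd, diff₂₃_apply]
  have h1 := hL j (by lia)
  have h2 := hK j (by lia)
  rw [show m + 1 + (j : ℤ) = m + j + 1 by ring, show m + 1 - 1 - (j : ℤ) = m - 1 - j + 1 by ring]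
    at h2
  rw [h1.1, h1.2, h2.1, h2.2]
  simp

theorem diff₁₃_mem_residueDomain {p : (ℤ → ℤ → ℤ → V) × (ℤ → ℤ → ℤ → V)}
    (hp : p ∈ residueDomain V) : p.map (diff₁₃ V) (diff₁₃ V) ∈ residueDomain V := by
  have h := add_mem (diff₁₂_mem_residueDomain hp) (diff₂₃_mem_residueDomain hp)
  convert h using 1
  simp [Prod.map, diff₂₃_eq]

theorem residue_diff₁₂ {p : (ℤ → ℤ → ℤ → V) × (ℤ → ℤ → ℤ → V)} (hp : p ∈ residueDomain V)
    (m n : ℤ) : residue (p.map (diff₁₂ V) (diff₁₂ V)) m n = p.1 0 m n - p.2 0 m n := by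
  obtain ⟨K, hK⟩ := hp (m + 1) n
  obtain ⟨L, hL⟩ := diff₁₂_mem_residueDomain hp m n
  rw [residue, finsum_range (max (K + 1) L) fun j hj => by
    rw [(hL j (by lia)).1, (hL j (by lia)).2, add_zero] ]
  have h : ∀ j : ℕ, (p.map (diff₁₂ V) (diff₁₂ V)).1 (-1 - j) (m + j) n +
      (p.map (diff₁₂ V) (diff₁₂ V)).2 j (m - 1 - j) n =
      (fun j : ℕ => p.1 (-j) (m + j) n - p.2 j (m - j) n) j -
      (fun j : ℕ => p.1 (-j) (m + j) n - p.2 j (m - j) n) (j + 1) := by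
    intro j
    simp only [Prod.map_fst, Prod.map_snd, diff₁₂_apply]
    rw [show -1 - (j : ℤ) + 1 = -j by ring, show -((j + 1 : ℕ) : ℤ) = -1 - j by push_cast; ring,
      show m + ((j + 1 : ℕ) : ℤ) = m + j + 1 by push_cast; ring,
      show m - ((j + 1 : ℕ) : ℤ) = m - 1 - j by push_cast; ring,
      show m - 1 - (j : ℤ) + 1 = m - j by ring, Nat.cast_succ]
    abel
  rw [Finset.sum_congr rfl fun j _ => h j, Finset.sum_range_sub']
  obtain ⟨k, hk⟩ : ∃ k, max (K + 1) L = k + 1 := ⟨max (K + 1) L - 1, by lia⟩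
  have h1 := (hK k (by lia)).1
  have h2 := (hK (k + 1) (by lia)).2
  rw [show (-1 - (k : ℤ)) = -((k + 1 : ℕ) : ℤ) by push_cast; ring,
    show m + 1 + (k : ℤ) = m + (k + 1 : ℕ) by push_cast; ring] at h1
  rw [show m + 1 - 1 - ((k + 1 : ℕ) : ℤ) = m - (k + 1 : ℕ) by push_cast; ring] at h2
  simp only [hk, h1, h2]
  simp

theorem residue_diff₂₃ {p : (ℤ → ℤ → ℤ → V) × (ℤ → ℤ → ℤ → V)} (hp : p ∈ residueDomain V) :
    residue (p.map (diff₂₃ V) (diff₂₃ V)) = zw V (residue p) := by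
  funext m n
  rw [zw_apply, residue, residue, residue, ← finsum_sub_distrib
    (hasFiniteSupport_of_mem_residueDomain hp _ n) (hasFiniteSupport_of_mem_residueDomain hp m _)]
  refine finsum_congr fun j => ?_
  simp only [Prod.map_fst, Prod.map_snd, diff₂₃_apply]
  rw [show m + 1 + (j : ℤ) = m + j + 1 by ring, show m + 1 - 1 - (j : ℤ) = m - 1 - j + 1 by ring]
  abel

theorem pow_mem_residueDomain {f : Module.End ℂ (ℤ → ℤ → ℤ → V)}
    (hf : ∀ p ∈ residueDomain V, p.map f f ∈ residueDomain V) (N : ℕ)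
    {p : (ℤ → ℤ → ℤ → V) × (ℤ → ℤ → ℤ → V)} (hp : p ∈ residueDomain V) :
    p.map ⇑(f ^ N) ⇑(f ^ N) ∈ residueDomain V := by
  induction N with
  | zero => exact hp
  | succ N ih =>
    have := hf _ ih
    rw [pow_succ']
    exact this

/-- Dong's lemma, in coefficients: the components of `p` stand for the commutators of `C(z₃)` with
`A(z₁) B(z₂)` and with `B(z₂) A(z₁)`, and `residue p` for its commutator with their normally ordered
product. On the residue, `z₂ - z₃` acts as `(z₁ - z₃) - (z₁ - z₂)`, and in the expansion of its
`(2N+1)`-st power each term contains a power of one of these two factors that annihilates. -/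
theorem zw_pow_residue_eq_zero {p : (ℤ → ℤ → ℤ → V) × (ℤ → ℤ → ℤ → V)}
    (hp : p ∈ residueDomain V) {N : ℕ}
    (h₁₂ : (diff₁₂ V ^ N) (p.1 - p.2) = 0)
    (hα : (diff₂₃ V ^ N) ((diff₁₃ V ^ N) p.1) = 0)
    (hβ : (diff₂₃ V ^ N) ((diff₁₃ V ^ N) p.2) = 0) :
    (zw V ^ (3 * N + 1)) (residue p) = 0 := by
  have hq : ∀ i j : ℕ, p.map ⇑(diff₁₃ V ^ i * diff₁₂ V ^ j * diff₂₃ V ^ N)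
      ⇑(diff₁₃ V ^ i * diff₁₂ V ^ j * diff₂₃ V ^ N) ∈ residueDomain V := fun i j =>
    pow_mem_residueDomain (fun _ => diff₁₃_mem_residueDomain) i
      (pow_mem_residueDomain (fun _ => diff₁₂_mem_residueDomain) j
        (pow_mem_residueDomain (fun _ => diff₂₃_mem_residueDomain) N hp))
  have h0 : residue (0 : (ℤ → ℤ → ℤ → V) × (ℤ → ℤ → ℤ → V)) = 0 := by
    funext m n
    simp [residue]
  have key : ∀ r i j : ℕ, 2 * N + 1 ≤ i + j + r →
      (zw V ^ r) (residue (p.map ⇑(diff₁₃ V ^ i * diff₁₂ V ^ j * diff₂₃ V ^ N)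
        ⇑(diff₁₃ V ^ i * diff₁₂ V ^ j * diff₂₃ V ^ N))) = 0 := by
    intro r
    induction r with
    | zero =>
      -- Either `N ≤ i`, or `N < j`; in the latter case one factor `z₁ - z₂` cancels the denominator
      -- in the residue and the other `N` are absorbed by locality of the first two fields.
      intro i j hij
      rw [pow_zero, Module.End.one_apply]
      rcases le_or_gt N i with hi | hi
      · have h : diff₁₃ V ^ i * diff₁₂ V ^ j * diff₂₃ V ^ N =
            (diff₁₃ V ^ (i - N) * diff₁₂ V ^ j) * (diff₂₃ V ^ N * diff₁₃ V ^ N) := by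
          nth_rewrite 1 [← Nat.sub_add_cancel hi]
          rw [((commute_diff₁₃_diff₂₃ (V := V)).pow_pow N N).eq.symm, pow_add]
          simp only [mul_assoc]
          rw [← mul_assoc (_ ^ N), ((commute_diff₁₂_diff₁₃ (V := V)).pow_pow j N).eq.symm, mul_assoc]
        have h' : p.map ⇑(diff₁₃ V ^ i * diff₁₂ V ^ j * diff₂₃ V ^ N)
            ⇑(diff₁₃ V ^ i * diff₁₂ V ^ j * diff₂₃ V ^ N) = 0 := by
          rw [h]
          exact Prod.ext (by simp [hα]) (by simp [hβ])
        rw [h', h0]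
      · obtain ⟨t, rfl⟩ : ∃ t, j = N + t + 1 := ⟨j - N - 1, by lia⟩
        have h : diff₁₃ V ^ i * diff₁₂ V ^ (N + t + 1) * diff₂₃ V ^ N =
            diff₁₂ V * (diff₁₃ V ^ i * diff₂₃ V ^ N * diff₁₂ V ^ t * diff₁₂ V ^ N) := by
          rw [show N + t + 1 = 1 + (t + N) by ring, pow_add, pow_one, ← mul_assoc (_ ^ i),
            ((commute_diff₁₂_diff₁₃ (V := V)).pow_right i).eq.symm, mul_assoc, mul_assoc, mul_assoc,
            ((commute_diff₁₂_diff₂₃ (V := V)).pow_pow (t + N) N).eq, pow_add]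
          simp only [mul_assoc]
        have hq' := pow_mem_residueDomain (fun _ => diff₁₃_mem_residueDomain) i
          (pow_mem_residueDomain (fun _ => diff₂₃_mem_residueDomain) N
            (pow_mem_residueDomain (fun _ => diff₁₂_mem_residueDomain) t
              (pow_mem_residueDomain (fun _ => diff₁₂_mem_residueDomain) N hp)))
        rw [h]
        funext m n
        refine (residue_diff₁₂ hq' m n).trans ?_
        have h2 := congrArg (diff₁₃ V ^ i * diff₂₃ V ^ N * diff₁₂ V ^ t) h₁₂
        rw [map_zero, map_sub, map_sub] at h2
        exact congrFun (congrFun (congrFun h2 0) m) n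
    | succ r ih =>
      intro i j hij
      have h1 := ih (i + 1) j (by lia)
      have h2 := ih i (j + 1) (by lia)
      have h3 : p.map ⇑(diff₁₃ V ^ (i + 1) * diff₁₂ V ^ j * diff₂₃ V ^ N)
            ⇑(diff₁₃ V ^ (i + 1) * diff₁₂ V ^ j * diff₂₃ V ^ N) -
          p.map ⇑(diff₁₃ V ^ i * diff₁₂ V ^ (j + 1) * diff₂₃ V ^ N)
            ⇑(diff₁₃ V ^ i * diff₁₂ V ^ (j + 1) * diff₂₃ V ^ N) =
          (p.map ⇑(diff₁₃ V ^ i * diff₁₂ V ^ j * diff₂₃ V ^ N)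
            ⇑(diff₁₃ V ^ i * diff₁₂ V ^ j * diff₂₃ V ^ N)).map (diff₂₃ V) (diff₂₃ V) := by
        have h : diff₁₃ V ^ (i + 1) * diff₁₂ V ^ j * diff₂₃ V ^ N -
            diff₁₃ V ^ i * diff₁₂ V ^ (j + 1) * diff₂₃ V ^ N =
            diff₂₃ V * (diff₁₃ V ^ i * diff₁₂ V ^ j * diff₂₃ V ^ N) := by
          rw [diff₂₃_eq, sub_mul, pow_succ' (diff₁₃ V), pow_succ' (diff₁₂ V), ← mul_assoc (_ ^ i),
            ((commute_diff₁₂_diff₁₃ (V := V)).pow_right i).eq.symm]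
          simp only [mul_assoc]
        exact Prod.ext (LinearMap.congr_fun h p.1) (LinearMap.congr_fun h p.2)
      rw [pow_succ, Module.End.mul_apply, ← residue_diff₂₃ (hq i j), ← h3,
        residue_sub (hq _ _) (hq _ _), map_sub, h1, h2, sub_zero]
  have h := key (2 * N + 1) 0 0 (by lia)
  rw [pow_zero, pow_zero, one_mul, one_mul] at h
  have h4 : ∀ M, residue (p.map ⇑(diff₂₃ V ^ M) ⇑(diff₂₃ V ^ M)) = (zw V ^ M) (residue p) := by
    intro M
    induction M with
    | zero => rfl
    | succ M ih =>
      rw [pow_succ', pow_succ', Module.End.mul_apply, ← ih, ← residue_diff₂₃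
        (pow_mem_residueDomain (fun _ => diff₂₃_mem_residueDomain) M hp)]
      rfl
  rw [h4, ← Module.End.mul_apply, ← pow_add] at h
  rwa [show 3 * N + 1 = 2 * N + 1 + N by ring]

end Residue

/-! ### Fields of normally ordered products -/

theorem ncoeff_Y_neg_one_sub {ι : Type*} (d : ι → ℕ) (a v : Fock ι) (j : ℕ) :
    ncoeff (Y d a) (-1 - j) v =
      ((j.factorial : ℂ)⁻¹) • ncoeff (Y d ((translation ι).toLinearMap ^ j • a)) (-1) v := by
  induction j generalizing a with
  | zero => simp
  | succ j ih =>
    have h := ih (translation ι a)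
    have h' : (translation ι).toLinearMap ^ (j + 1) • a =
        (translation ι).toLinearMap ^ j • translation ι a := by
      rw [pow_succ]; rfl
    rw [h', Nat.factorial_succ, Nat.cast_mul, mul_inv, mul_smul, ← h, Y_translation, smul_smul,
      show -1 - (j : ℤ) - 1 = -1 - (j + 1 : ℕ) by push_cast; ring]
    push_cast
    rw [show -(-1 - (j : ℂ)) = j + 1 by ring, inv_mul_cancel₀ (by exact_mod_cast j.succ_ne_zero),
      one_smul]

/-- The mode `n` of the normally ordered product of two fields. -/
noncomputable def normalProduct {ι : Type*} (A B : VertexOperator ℂ (Fock ι)) (n : ℤ) (v : Fock ι) :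
    Fock ι :=
  ∑ᶠ j : ℕ, (ncoeff A (-1 - j) (ncoeff B (n + j) v) + ncoeff B (n - 1 - j) (ncoeff A j v))

theorem normalProduct_ev {ι : Type*} (A B : VertexOperator ℂ (Fock ι)) (n : ℤ) (v : Fock ι) :
    ∃ K : ℕ, ∀ j : ℕ, K ≤ j → ncoeff B (n + j) v = 0 ∧ ncoeff A j v = 0 := by
  obtain ⟨K, hK⟩ := exists_bound' B v n
  obtain ⟨L, hL⟩ := exists_bound' A v 0
  exact ⟨max K L, fun j hj => ⟨hK j (by lia), by simpa using hL j (by lia)⟩⟩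

/-- A field that is local to two mutually local fields is local to their normally ordered
product. -/
theorem isLocal_normalProduct {ι : Type*} {A B C : VertexOperator ℂ (Fock ι)} (hAB : IsLocal A B)
    (hAC : IsLocal A C) (hBC : IsLocal B C) : ∃ N : ℕ, ∀ v, (zw (Fock ι) ^ N) (fun m n =>
      normalProduct A B m (ncoeff C n v) - ncoeff C n (normalProduct A B m v)) = 0 := by
  obtain ⟨N₁, h₁⟩ := hAB
  obtain ⟨N₂, h₂⟩ := hAC
  obtain ⟨N₃, h₃⟩ := hBC
  obtain ⟨N, hN₁, hN₂, hN₃⟩ : ∃ N, N₁ ≤ N ∧ N₂ ≤ N ∧ N₃ ≤ N :=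
    ⟨max N₁ (max N₂ N₃), by lia, by lia, by lia⟩
  replace h₁ := fun v => zw_pow_eq_zero (h₁ v) hN₁
  replace h₂ := fun v => zw_pow_eq_zero (h₂ v) hN₂
  replace h₃ := fun v => zw_pow_eq_zero (h₃ v) hN₃
  have hlin : ∀ (f : Module.End ℂ (Fock ι)) (F : ℤ → ℤ → Fock ι), (zw (Fock ι) ^ N) F = 0 →
      (zw (Fock ι) ^ N) (fun m n => f (F m n)) = 0 := by
    intro f F hF
    funext m n
    have := congrArg f (congrFun (congrFun hF m) n)
    rw [zw_pow_apply, map_sum] at this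
    rw [zw_pow_apply]
    simpa using this
  refine ⟨3 * N + 1, fun v => ?_⟩
  set p : (ℤ → ℤ → ℤ → Fock ι) × (ℤ → ℤ → ℤ → Fock ι) :=
    (fun l m n => ncoeff A l (ncoeff B m (ncoeff C n v)) - ncoeff C n (ncoeff A l (ncoeff B m v)),
      fun l m n => ncoeff B m (ncoeff A l (ncoeff C n v)) - ncoeff C n (ncoeff B m (ncoeff A l v)))
    with hp
  have hpD : p ∈ residueDomain (Fock ι) := by
    intro m n
    obtain ⟨K, hK⟩ := normalProduct_ev A B m (ncoeff C n v)
    obtain ⟨L, hL⟩ := normalProduct_ev A B m v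
    refine ⟨max K L, fun j hj => ?_⟩
    have h := hK j (by lia)
    have h' := hL j (by lia)
    simp only [hp, h, h', map_zero, sub_zero]
    trivial
  have hres : (fun m n => normalProduct A B m (ncoeff C n v) -
      ncoeff C n (normalProduct A B m v)) = residue p := by
    funext m n
    obtain ⟨K, hK⟩ := normalProduct_ev A B m (ncoeff C n v)
    obtain ⟨L, hL⟩ := normalProduct_ev A B m v
    obtain ⟨M, hM⟩ := hpD m n
    rw [residue, normalProduct, normalProduct,
      finsum_range (max K (max L M)) fun j hj => by
        rw [(hK j (by lia)).1, (hK j (by lia)).2, map_zero, map_zero, add_zero],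
      finsum_range (max K (max L M)) fun j hj => by
        rw [(hL j (by lia)).1, (hL j (by lia)).2, map_zero, map_zero, add_zero],
      finsum_range (max K (max L M)) fun j hj => by
        rw [(hM j (by lia)).1, (hM j (by lia)).2, add_zero],
      map_sum, ← Finset.sum_sub_distrib]
    refine Finset.sum_congr rfl fun j _ => ?_
    simp only [hp, map_add]
    abel
  rw [hres]
  apply zw_pow_residue_eq_zero hpD
  · funext l m n
    refine (congrFun (congrFun (diff₁₂_pow_apply N _ n) l) m).trans ?_
    have h := hlin (ncoeff C n) _ (h₁ v)
    have h' := (h₁ (ncoeff C n v))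
    have := congrArg₂ (· - ·) h' h
    rw [← map_sub, sub_zero] at this
    convert congrFun (congrFun this l) m using 4
    · simp only [hp, Pi.sub_apply, comm, map_sub]
      abel
    · rfl
  · have e : p.1 = (fun l m n => ncoeff A l (comm B C v m n)) +
        fun l m n => comm A C (ncoeff B m v) l n := by
      funext l m n
      simp only [hp, Pi.add_apply, comm, map_sub]
      abel
    have e1 : (diff₂₃ (Fock ι) ^ N) (fun l m n => ncoeff A l (comm B C v m n)) = 0 := by
      funext l m n
      refine (congrFun (congrFun (diff₂₃_pow_apply N _ l) m) n).trans ?_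
      rw [hlin (ncoeff A l) _ (h₃ v)]
      rfl
    have e2 : (diff₁₃ (Fock ι) ^ N) (fun l m n => comm A C (ncoeff B m v) l n) = 0 := by
      funext l m n
      refine (congrFun (congrFun (diff₁₃_pow_apply N _ m) l) n).trans ?_
      rw [h₂]
      rfl
    rw [e, map_add, map_add, e2, map_zero, add_zero, ← Module.End.mul_apply,
      ((commute_diff₁₃_diff₂₃ (V := Fock ι)).pow_pow N N).eq.symm, Module.End.mul_apply, e1,
      map_zero]
  · have e : p.2 = (fun l m n => ncoeff B m (comm A C v l n)) +
        fun l m n => comm B C (ncoeff A l v) m n := by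
      funext l m n
      simp only [hp, Pi.add_apply, comm, map_sub]
      abel
    have e1 : (diff₁₃ (Fock ι) ^ N) (fun l m n => ncoeff B m (comm A C v l n)) = 0 := by
      funext l m n
      refine (congrFun (congrFun (diff₁₃_pow_apply N _ m) l) n).trans ?_
      rw [hlin (ncoeff B m) _ (h₂ v)]
      rfl
    have e2 : (diff₂₃ (Fock ι) ^ N) (fun l m n => comm B C (ncoeff A l v) m n) = 0 := by
      funext l m n
      refine (congrFun (congrFun (diff₂₃_pow_apply N _ l) m) n).trans ?_
      rw [h₃]
      rfl
    rw [e, map_add, map_add, e1, map_zero, zero_add, ← Module.End.mul_apply,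
      ((commute_diff₁₃_diff₂₃ (V := Fock ι)).pow_pow N N).eq.symm, Module.End.mul_apply, e2,
      map_zero]

/-- The field of a Wick product and the normally ordered product of the fields agree on the
vacuum. -/
theorem normalProduct_one {ι : Type*} (d : ι → ℕ) (a b : Fock ι) (n : ℤ) :
    normalProduct (Y d a) (Y d b) n 1 = ncoeff (Y d (ncoeff (Y d a) (-1) b)) n 1 := by
  have hpos : ∀ n : ℤ, normalProduct (Y d a) (Y d b) n 1 =
      ∑ᶠ j : ℕ, ncoeff (Y d a) (-1 - j) (ncoeff (Y d b) (n + j) 1) := by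
    intro n
    refine finsum_congr fun j => ?_
    rw [(Y_creation d a).1 j (by lia), map_zero, add_zero]
  rcases le_or_gt 0 n with hn | hn
  · rw [hpos, (Y_creation d _).1 n hn]
    refine finsum_eq_zero_of_forall_eq_zero fun j => ?_
    rw [(Y_creation d b).1 _ (by lia), map_zero]
  · obtain ⟨t, rfl⟩ : ∃ t : ℕ, n = -1 - t := ⟨(-1 - n).toNat, by lia⟩
    clear hn
    have hfin : ∀ t : ℕ, normalProduct (Y d a) (Y d b) (-1 - t) 1 = ∑ j ∈ Finset.range (t + 1),
        ncoeff (Y d a) (-1 - j) (ncoeff (Y d b) (-1 - t + j) 1) := by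
      intro t
      rw [hpos, finsum_range (t + 1)]
      intro j hj
      rw [(Y_creation d b).1 _ (by lia), map_zero]
    induction t with
    | zero =>
      rw [hfin, Nat.cast_zero, sub_zero, (Y_creation d _).2]
      simp [(Y_creation d b).2]
    | succ t ih =>
      have h1 := congrArg (translation ι) ih
      rw [translation_Y, Derivation.map_one_eq_zero, map_zero, zero_add] at h1
      have ht : ((t : ℂ) + 1) ≠ 0 := by exact_mod_cast t.succ_ne_zero
      have e : -1 - ((t + 1 : ℕ) : ℤ) = -1 - t - 1 := by push_cast; ring
      rw [e, ← smul_right_inj ht]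
      convert h1 using 1
      · rw [← e, hfin, hfin, map_sum]
        simp only [translation_Y, Derivation.map_one_eq_zero, map_zero, zero_add, map_smul]
        rw [Finset.sum_add_distrib, Finset.smul_sum]
        have e1 := Finset.sum_range_succ (fun j : ℕ => (j - t - 1 : ℂ) •
          ncoeff (Y d a) (-1 - j) (ncoeff (Y d b) (-1 - (t + 1 : ℕ) + j) 1)) (t + 1)
        have e2 := Finset.sum_range_succ' (fun j : ℕ => (j : ℂ) •
          ncoeff (Y d a) (-1 - j) (ncoeff (Y d b) (-1 - (t + 1 : ℕ) + j) 1)) (t + 1)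
        have e3 : ∀ j : ℕ, (-((-1 - t + j : ℤ) : ℂ)) • ncoeff (Y d a) (-1 - j)
            (ncoeff (Y d b) (-1 - t + j - 1) 1) = (-(j - t - 1 : ℂ)) •
            ncoeff (Y d a) (-1 - j) (ncoeff (Y d b) (-1 - (t + 1 : ℕ) + j) 1) := by
          intro j
          rw [show -1 - (t : ℤ) + j - 1 = -1 - (t + 1 : ℕ) + j by push_cast; ring]
          congr 1
          push_cast
          ring
        have e4 : ∀ j : ℕ, (-((-1 - j : ℤ) : ℂ)) • ncoeff (Y d a) (-1 - j - 1)
            (ncoeff (Y d b) (-1 - t + j) 1) = ((j + 1 : ℕ) : ℂ) •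
            ncoeff (Y d a) (-1 - (j + 1 : ℕ))
              (ncoeff (Y d b) (-1 - (t + 1 : ℕ) + (j + 1 : ℕ)) 1) := by
          intro j
          rw [show -1 - (t : ℤ) + j = -1 - (t + 1 : ℕ) + (j + 1 : ℕ) by push_cast; ring,
            show -1 - (j : ℤ) - 1 = -1 - (j + 1 : ℕ) by push_cast; ring]
          congr 1
          push_cast
          ring
        simp only [e3, e4]
        simp only [neg_smul, Finset.sum_neg_distrib]
        rw [Nat.cast_zero, zero_smul, add_zero] at e2
        have e5 : (((t + 1 : ℕ) : ℂ) - t - 1) = 0 := by push_cast; ring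
        rw [e5, zero_smul, add_zero] at e1
        rw [← e2, ← e1, add_comm, neg_add_eq_sub, ← Finset.sum_sub_distrib]
        refine Finset.sum_congr rfl fun j _ => ?_
        rw [← sub_smul]
        congr 1
        ring
      · congr 1
        push_cast
        ring

/-- The field of a normally ordered product of states is the normally ordered product of their
fields: both are local to all fields (the second by Dong's lemma) and agree on the vacuum. -/
theorem Y_wick {ι : Type*} {d : ι → ℕ} (hd : ∀ i, Odd (d i)) (a b : Fock ι) (n : ℤ) (c : Fock ι) :
    ncoeff (Y d (ncoeff (Y d a) (-1) b)) n c = normalProduct (Y d a) (Y d b) n c := by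
  obtain ⟨N₁, h₁⟩ := isLocal_Y hd (ncoeff (Y d a) (-1) b) c
  obtain ⟨N₂, h₂⟩ := isLocal_normalProduct (isLocal_Y hd a b) (isLocal_Y hd a c) (isLocal_Y hd b c)
  obtain ⟨N, hN₁, hN₂⟩ : ∃ N, N₁ ≤ N ∧ N₂ ≤ N := ⟨max N₁ N₂, by lia, by lia⟩
  -- Locality applied to the vacuum, at the mode `-1` of `c`, determines the value on `c`.
  have key : ∀ D : ℤ → Fock ι → Fock ι, (∀ m, D m 0 = 0) → (zw (Fock ι) ^ N) (fun m n =>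
      D m (ncoeff (Y d c) n 1) - ncoeff (Y d c) n (D m 1)) = 0 →
      D n c = ∑ j ∈ Finset.range (N + 1), ((-1) ^ j * (N.choose j : ℂ)) •
        ncoeff (Y d c) (-1 + j) (D (n - N + N - j) 1) := by
    intro D hD0 hD
    have h := congrFun (congrFun hD (n - N)) (-1)
    rw [zw_pow_apply] at h
    simp only [smul_sub, Finset.sum_sub_distrib] at h
    rw [Pi.zero_apply, Pi.zero_apply, sub_eq_zero, Finset.sum_eq_single 0] at h
    · rw [← h]
      simp [(Y_creation d c).2]
    · intro j _ hj
      rw [(Y_creation d c).1 _ (by lia), hD0, smul_zero]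
    · simp
  rw [key (fun m v => ncoeff (Y d (ncoeff (Y d a) (-1) b)) m v) (fun m => map_zero _)
      (zw_pow_eq_zero (h₁ 1) hN₁),
    key (normalProduct (Y d a) (Y d b)) (fun m => by simp [normalProduct])
      (zw_pow_eq_zero (h₂ 1) hN₂)]
  simp only [normalProduct_one]

end FreeField

namespace FreeField

open MvPolynomial

/-! ### Strong generation from generation modulo decomposable states -/

section Generation

variable {ι : Type*} {wt : ι → ℕ} {hwt : ∀ i, 0 < wt i}

theorem odd_two_mul_sub_one (hwt : ∀ i, 0 < wt i) (i : ι) : Odd (2 * wt i - 1) :=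
  ⟨wt i - 1, by have := hwt i; lia⟩

theorem wick_def (hwt : ∀ i, 0 < wt i) (a b : Fock ι) :
    (freeFieldAlgebra wt hwt).wick a b = ncoeff (Y (fun i => 2 * wt i - 1) a) (-1) b := rfl

theorem translation_wick (hwt : ∀ i, 0 < wt i) (a b : Fock ι) :
    translation ι ((freeFieldAlgebra wt hwt).wick a b) =
      (freeFieldAlgebra wt hwt).wick (translation ι a) b +
        (freeFieldAlgebra wt hwt).wick a (translation ι b) := by
  simp only [wick_def, translation_Y, Y_translation]
  rw [add_comm]

variable (hwt) in
/-- The normally ordered monomials in derivatives of elements of `S`, together with a weight: each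
element `s` of `S` is given some positive weight `i` with `s ∈ F i`. -/
inductive IsMonomialOfWeight (F : ℤ → Submodule ℂ (Fock ι)) (S : Set (Fock ι)) : ℤ → Fock ι → Prop
  | vac : IsMonomialOfWeight F S 0 1
  | wick (s : Fock ι) (i : ℤ) (hs : s ∈ S) (hi : 0 < i) (hsi : s ∈ F i) (k : ℕ) (m : ℤ) (b : Fock ι)
      (hb : IsMonomialOfWeight F S m b) : IsMonomialOfWeight F S (i + k + m)
        ((freeFieldAlgebra wt hwt).wick (((freeFieldAlgebra wt hwt).T ^ k) s) b)

theorem IsMonomialOfWeight.nonneg {F : ℤ → Submodule ℂ (Fock ι)} {S : Set (Fock ι)} {m : ℤ}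
    {v : Fock ι} (h : IsMonomialOfWeight hwt F S m v) : 0 ≤ m := by
  induction h with
  | vac => exact le_rfl
  | wick => lia

theorem IsMonomialOfWeight.isMonomial {F : ℤ → Submodule ℂ (Fock ι)} {S : Set (Fock ι)} {m : ℤ}
    {v : Fock ι} (h : IsMonomialOfWeight hwt F S m v) :
    (freeFieldAlgebra wt hwt).IsMonomial S v := by
  induction h with
  | vac => exact .vac
  | wick s i hs hi hsi k m b hb ih => exact .wick s hs k b ih

variable (hwt) in
/-- The span of the normally ordered monomials of weight at most `N`. -/
noncomputable def monomialSpan (F : ℤ → Submodule ℂ (Fock ι)) (S : Set (Fock ι)) (N : ℤ) :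
    Submodule ℂ (Fock ι) :=
  Submodule.span ℂ {v | ∃ m ≤ N, IsMonomialOfWeight hwt F S m v}

theorem wick_mem_monomialSpan {F : ℤ → Submodule ℂ (Fock ι)} {S : Set (Fock ι)} {s : Fock ι} {i : ℤ}
    (hs : s ∈ S) (hi : 0 < i) (hsi : s ∈ F i) (k : ℕ) {N M : ℤ} {b : Fock ι}
    (hb : b ∈ monomialSpan hwt F S N) (hNM : i + k + N ≤ M) :
    (freeFieldAlgebra wt hwt).wick (((freeFieldAlgebra wt hwt).T ^ k) s) b ∈
      monomialSpan hwt F S M := by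
  induction hb using Submodule.span_induction with
  | mem b hb =>
    obtain ⟨m, hm, hb⟩ := hb
    exact Submodule.subset_span ⟨_, by lia, .wick s i hs hi hsi k m b hb⟩
  | zero => rw [wick_def, map_zero]; exact zero_mem _
  | add a b _ _ ha hb => rw [wick_def, map_add]; exact add_mem ha hb
  | smul r a _ ha => rw [wick_def, map_smul]; exact Submodule.smul_mem _ _ ha

theorem translation_mem_monomialSpan {F : ℤ → Submodule ℂ (Fock ι)} {S : Set (Fock ι)} {N : ℤ}
    {v : Fock ι} (hv : v ∈ monomialSpan hwt F S N) :
    translation ι v ∈ monomialSpan hwt F S (N + 1) := by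
  induction hv using Submodule.span_induction with
  | mem b hb =>
    obtain ⟨m, hm, hb⟩ := hb
    suffices h : translation ι b ∈ monomialSpan hwt F S (m + 1) from
      Submodule.span_mono (by rintro x ⟨l, hl, hx⟩; exact ⟨l, by lia, hx⟩) h
    clear hm
    induction hb with
    | vac => rw [Derivation.map_one_eq_zero]; exact zero_mem _
    | wick s i hs hi hsi k m b hb ih =>
      rw [translation_wick]
      refine add_mem ?_ (wick_mem_monomialSpan hs hi hsi k ih (by lia))
      have h : translation ι (((freeFieldAlgebra wt hwt).T ^ k) s) =
          ((freeFieldAlgebra wt hwt).T ^ (k + 1)) s := by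
        rw [pow_succ', Module.End.mul_apply]
        rfl
      rw [h]
      exact wick_mem_monomialSpan hs hi hsi (k + 1)
        (Submodule.subset_span ⟨m, le_rfl, hb⟩) (by push_cast; lia)
  | zero => rw [map_zero]; exact zero_mem _
  | add a b _ _ ha hb => rw [map_add]; exact add_mem ha hb
  | smul r a _ ha => rw [Derivation.map_smul]; exact Submodule.smul_mem _ _ ha

/-- The inductive step of the Nakayama lemma: a product of a monomial and a state of smaller weight
is a combination of monomials, since the field of a monomial `:(∂ˡs) a:` is the normally ordered
product of the fields of `∂ˡs` and `a`. -/
theorem ncoeff_mem_monomialSpan {F : ℤ → Submodule ℂ (Fock ι)}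
    (hF : ∀ {i j k m : ℤ} {a b : Fock ι}, a ∈ F i → b ∈ F j → i + j - k - 1 ≤ m →
      ncoeff (Y (fun i => 2 * wt i - 1) a) k b ∈ F m)
    {S : Set (Fock ι)} {N : ℤ} (hN : ∀ M < N, F M ≤ monomialSpan hwt F S M) {i : ℤ} {a : Fock ι}
    (ha : IsMonomialOfWeight hwt F S i a) (hFa : ∀ {i a}, IsMonomialOfWeight hwt F S i a → a ∈ F i) :
    ∀ (j : ℤ) (b : Fock ι) (k : ℕ), b ∈ F j → j < N → i + j + k ≤ N →
      ncoeff (Y (fun i => 2 * wt i - 1) a) (-1 - k) b ∈ monomialSpan hwt F S N := by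
  have hmono : ∀ {M : ℤ}, M ≤ N → monomialSpan hwt F S M ≤ monomialSpan hwt F S N := fun h =>
    Submodule.span_mono (by rintro x ⟨l, hl, hx⟩; exact ⟨l, by lia, hx⟩)
  induction ha with
  | vac =>
    intro j b k hb hj _
    rw [Y_one, idOp_apply]
    split_ifs
    · exact hmono hj.le (hN j hj hb)
    · exact zero_mem _
  | wick s i hs hi hsi l m a ha ih =>
    intro j b k hb hj hN'
    have hm := ha.nonneg
    have hTs : ((freeFieldAlgebra wt hwt).T ^ l) s ∈ F (i + l) := by
      rw [← (freeFieldAlgebra wt hwt).Y_creation_neg_one (((freeFieldAlgebra wt hwt).T ^ l) s)]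
      have h := hFa (.wick s i hs hi hsi l 0 1 .vac)
      rwa [add_zero] at h
    rw [wick_def, Y_wick (odd_two_mul_sub_one hwt), normalProduct]
    refine finsum_induction (· ∈ monomialSpan hwt F S N) (zero_mem _)
      (fun _ _ h h' => add_mem h h') fun t => add_mem ?_ ?_
    · rw [ncoeff_Y_neg_one_sub]
      refine Submodule.smul_mem _ _ ?_
      have h1 : ((translation ι).toLinearMap ^ t • ((freeFieldAlgebra wt hwt).T ^ l) s) =
          ((freeFieldAlgebra wt hwt).T ^ (t + l)) s := by
        rw [pow_add]; rfl
      rw [h1]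
      refine wick_mem_monomialSpan hs hi hsi (t + l) (N := m + j + k - t)
        (hN _ (by lia) (hF (hFa ha) hb (by lia))) (by push_cast; lia)
    · have h := ih (i + l + j - t - 1) (ncoeff (Y (fun i => 2 * wt i - 1)
        (((freeFieldAlgebra wt hwt).T ^ l) s)) t b) (1 + k + t) (hF hTs hb (by lia)) (by lia)
        (by push_cast; lia)
      rwa [show (-1 - ((1 + k + t : ℕ) : ℤ)) = -1 - k - 1 - t by push_cast; ring] at h

variable (hwt) in
/-- The states of weight at most `N` that are evidently generated by `S` and states of smaller
weight, for an increasing filtration `F` by weight. -/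
noncomputable def generatedPart (F : ℤ → Submodule ℂ (Fock ι)) (S : Set (Fock ι)) (N : ℤ) :
    Submodule ℂ (Fock ι) :=
  Submodule.span ℂ ({1} ∪ {s | s ∈ S ∧ 0 < N ∧ s ∈ F N} ∪
    {v | ∃ u ∈ F (N - 1), v = translation ι u} ∪
    {v | ∃ i j a b, i + j ≤ N ∧ i < N ∧ j < N ∧ a ∈ F i ∧ b ∈ F j ∧
      v = (freeFieldAlgebra wt hwt).wick a b})

/-- A Nakayama lemma: if `S` generates a vertex subalgebra modulo derivatives and normally ordered
products of states of smaller weight, then it strongly generates the subalgebra. -/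
theorem isStrongGeneratingSet_of_le_generatedPart (U : (freeFieldAlgebra wt hwt).Subalgebra)
    {F : ℤ → Submodule ℂ (Fock ι)} (hneg : ∀ N < 0, F N = ⊥)
    (hone : 1 ∈ F 0)
    (hF : ∀ {i j k m : ℤ} {a b : Fock ι}, a ∈ F i → b ∈ F j → i + j - k - 1 ≤ m →
      ncoeff (Y (fun i => 2 * wt i - 1) a) k b ∈ F m)
    (hT : ∀ {i : ℤ} {a : Fock ι}, a ∈ F i → translation ι a ∈ F (i + 1))
    (hU : ∀ v ∈ U.toSubmodule, ∃ N, v ∈ F N)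
    {S : Set (Fock ι)} (hS : S ⊆ U.toSubmodule)
    (hgen : ∀ N, 0 ≤ N → F N ≤ generatedPart hwt F S N) : U.IsStrongGeneratingSet S := by
  have hFa : ∀ {i a}, IsMonomialOfWeight hwt F S i a → a ∈ F i := by
    intro i a ha
    induction ha with
    | vac => exact hone
    | wick s i hs hi hsi k m b hb ih =>
      have hTs : ((freeFieldAlgebra wt hwt).T ^ k) s ∈ F (i + k) := by
        clear ih
        induction k with
        | zero => simpa using hsi
        | succ k ih =>
          rw [pow_succ', Module.End.mul_apply, Nat.cast_succ, ← add_assoc]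
          exact hT ih
      exact hF hTs ih (by lia)
  have hspan : ∀ N : ℤ, F N ≤ monomialSpan hwt F S N := by
    have key : ∀ n : ℕ, ∀ N : ℤ, N < n → F N ≤ monomialSpan hwt F S N := by
      intro n
      induction n with
      | zero =>
        intro N hN
        rw [hneg N (by simpa using hN)]
        exact bot_le
      | succ n ih =>
        intro N hN
        rcases lt_or_ge N n with h | h
        · exact ih N h
        obtain rfl : N = n := by push_cast at hN; lia
        refine (hgen _ (by lia)).trans (Submodule.span_le.2 ?_)
        rintro v (((rfl | ⟨hs, h0, hv⟩) | ⟨u, hu, rfl⟩) | ⟨i, j, a, b, hij, hi, hj, ha, hb, rfl⟩)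
        · exact Submodule.subset_span ⟨0, by lia, .vac⟩
        · have h1 := wick_mem_monomialSpan (hwt := hwt) (N := 0) hs h0 hv 0
            (Submodule.subset_span ⟨0, le_rfl, .vac⟩) (M := n) (by simp)
          rw [pow_zero, Module.End.one_apply] at h1
          rwa [← (freeFieldAlgebra wt hwt).Y_creation_neg_one v]
        · have := translation_mem_monomialSpan (ih _ (by lia) hu)
          rwa [sub_add_cancel] at this
        · have ha' := ih _ hi ha
          clear ha
          induction ha' using Submodule.span_induction with
          | mem a ha =>
            obtain ⟨m, hm, ha⟩ := ha
            have := ncoeff_mem_monomialSpan (F := F) hF ih ha hFa j b 0 hb hj (by push_cast; lia)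
            rw [wick_def]
            simpa using this
          | zero =>
            rw [wick_def, Y_zero_apply]
            exact zero_mem _
          | add x y _ _ hx hy =>
            rw [wick_def, Y_add_apply]
            exact add_mem hx hy
          | smul r x _ hx =>
            rw [wick_def, Y_smul_apply]
            exact Submodule.smul_mem _ _ hx
    intro N
    exact key (N + 1).toNat N (by lia)
  refine ⟨hS, le_antisymm (Submodule.span_le.2 ?_) fun v hv => ?_⟩
  · intro v hv
    induction hv with
    | vac => exact U.vac_mem
    | wick s hs k b hb ih =>
      refine U.ncoeff_mem _ ?_ _ _ ih
      clear ih hb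
      induction k with
      | zero => exact hS hs
      | succ k ih =>
        have h := U.ncoeff_mem _ ih (-2) _ U.vac_mem
        have h1 := (freeFieldAlgebra wt hwt).translation (((freeFieldAlgebra wt hwt).T ^ k) s) (-1)
          (freeFieldAlgebra wt hwt).vac
        rw [(freeFieldAlgebra wt hwt).Y_creation_neg_one, (freeFieldAlgebra wt hwt).T_vac, map_zero,
          sub_zero] at h1
        rw [pow_succ', Module.End.mul_apply, h1]
        exact U.toSubmodule.smul_mem _ h
  · obtain ⟨N, hN⟩ := hU v hv
    exact Submodule.span_mono (by rintro x ⟨l, hl, hx⟩; exact hx.isMonomial) (hspan N hN)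

end Generation

end FreeField

namespace FreeField

open MvPolynomial

/-! ### Wick products with linear and quadratic states -/

section Contraction

variable {ι : Type*} {wt : ι → ℕ}

open Classical in
/-- The part of `:x_p x_q v:` in which `x_p` multiplies and `x_q` is contracted with `v`: the
derivation with `x_{q.1, l} ↦ c_l x_{p.1, p.2 + q.2 + l + 2 wt}`, which kills all other variables. -/
noncomputable def contraction (wt : ι → ℕ) (p q : ι × ℕ) : Derivation ℂ (Fock ι) (Fock ι) :=
  mkDerivation ℂ fun r => if r.1 = q.1 then
    (((p.2 + q.2 + r.2 + 2 * wt q.1).choose p.2 : ℂ) * coef (2 * wt q.1 - 1) q.2 r.2) •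
      X (p.1, p.2 + q.2 + r.2 + 2 * wt q.1) else 0

theorem contraction_X (p q : ι × ℕ) (l : ℕ) : contraction wt p q (X (q.1, l)) =
    (((p.2 + q.2 + l + 2 * wt q.1).choose p.2 : ℂ) * coef (2 * wt q.1 - 1) q.2 l) •
      X (p.1, p.2 + q.2 + l + 2 * wt q.1) := by
  rw [contraction, mkDerivation_X, if_pos rfl]

theorem contraction_X_of_ne {p q r : ι × ℕ} (h : r.1 ≠ q.1) : contraction wt p q (X r) = 0 := by
  rw [contraction, mkDerivation_X, if_neg h]

open Filter in
/-- The contraction as a sum over the annihilation operators. On a given state all but finitely many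
of them vanish, so that all sufficiently long partial sums agree. -/
theorem contraction_ev (wt : ι → ℕ) (p q : ι × ℕ) (v : Fock ι) : ∀ᶠ M : ℕ in atTop,
    contraction wt p q v = ∑ l ∈ Finset.range M,
      (((p.2 + q.2 + l + 2 * wt q.1).choose p.2 : ℂ) * coef (2 * wt q.1 - 1) q.2 l) •
        (X (p.1, p.2 + q.2 + l + 2 * wt q.1) * pderiv (q.1, l) v) := by
  classical
  obtain ⟨K, hK⟩ := (v.vars.image Prod.snd).bddAbove
  filter_upwards [eventually_ge_atTop (K + 1)] with M hM
  have hsum : ∀ (f : ℕ → Derivation ℂ (Fock ι) (Fock ι)) (x : Fock ι),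
      (∑ l ∈ Finset.range M, f l) x = ∑ l ∈ Finset.range M, f l x := fun f x => by
    have h := map_sum (Derivation.coeFnAddMonoidHom (R := ℂ) (A := Fock ι) (M := Fock ι)) f
      (Finset.range M)
    exact (congrFun h x).trans (Finset.sum_apply _ _ _)
  have h : contraction wt p q v = (∑ l ∈ Finset.range M,
      (((p.2 + q.2 + l + 2 * wt q.1).choose p.2 : ℂ) * coef (2 * wt q.1 - 1) q.2 l) •
        ((X (p.1, p.2 + q.2 + l + 2 * wt q.1) : Fock ι) • pderiv (q.1, l)) :
        Derivation ℂ (Fock ι) (Fock ι)) v := by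
    apply derivation_eq_of_forall_mem_vars
    rintro ⟨i, k⟩ hr
    have hk : k < M := by
      have := hK (Finset.mem_coe.2 (Finset.mem_image_of_mem Prod.snd hr))
      simp only at this
      lia
    rw [hsum]
    simp only [Derivation.smul_apply, pderiv_X']
    by_cases hi : i = q.1
    · subst hi
      rw [contraction_X, Finset.sum_eq_single k]
      · simp
      · intro l _ hl
        simp [hl.symm]
      · intro h
        exact absurd (Finset.mem_range.2 hk) h
    · rw [contraction_X_of_ne hi, Finset.sum_eq_zero]
      intro l _
      simp [hi]
  rw [h, hsum]
  rfl

theorem ncoeff_Y_X_neg (d : ι → ℕ) (q : ι × ℕ) (t : ℕ) (v : Fock ι) :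
    ncoeff (Y d (X q)) (-1 - t) v = ((q.2 + t).choose q.2 : ℂ) • (X (q.1, q.2 + t) * v) := by
  obtain ⟨M, hM, ht⟩ := ((normalOrder_ev d q (idOp ι) (-1 - t) v).and
    (Filter.eventually_gt_atTop t)).exists
  rw [← mul_one (X q : Fock ι), Y_X_mul, Y_one, hM, Finset.sum_eq_single t,
    Finset.sum_eq_zero, add_zero]
  · rw [idOp_apply, if_pos (by ring)]
  · intro l _
    rw [idOp_apply, if_neg (by lia), smul_zero]
  · intro j _ hj
    rw [idOp_apply, if_neg (by lia), mul_zero, smul_zero]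
  · intro h
    exact absurd (Finset.mem_range.2 ht) h

theorem ncoeff_Y_X_nonneg (d : ι → ℕ) (q : ι × ℕ) (l : ℕ) (v : Fock ι) :
    ncoeff (Y d (X q)) (q.2 + d q.1 + l : ℕ) v = coef (d q.1) q.2 l • pderiv (q.1, l) v := by
  obtain ⟨M, hM, ht⟩ := ((normalOrder_ev d q (idOp ι) (q.2 + d q.1 + l : ℕ) v).and
    (Filter.eventually_gt_atTop l)).exists
  rw [← mul_one (X q : Fock ι), Y_X_mul, Y_one, hM, Finset.sum_eq_zero, zero_add,
    Finset.sum_eq_single l]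
  · rw [idOp_apply, if_pos (by push_cast; ring)]
  · intro j _ hj
    rw [idOp_apply, if_neg (by push_cast; lia), smul_zero]
  · intro h
    exact absurd (Finset.mem_range.2 ht) h
  · intro j _
    rw [idOp_apply, if_neg (by push_cast; lia), mul_zero, smul_zero]

theorem ncoeff_Y_X_eq_zero (d : ι → ℕ) (q : ι × ℕ) {t : ℕ} (ht : t < q.2 + d q.1) (v : Fock ι) :
    ncoeff (Y d (X q)) t v = 0 := by
  obtain ⟨M, hM⟩ := (normalOrder_ev d q (idOp ι) t v).exists
  rw [← mul_one (X q : Fock ι), Y_X_mul, Y_one, hM, Finset.sum_eq_zero, zero_add,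
    Finset.sum_eq_zero]
  · intro l _
    rw [idOp_apply, if_neg (by lia), smul_zero]
  · intro j _
    rw [idOp_apply, if_neg (by lia), mul_zero, smul_zero]

theorem wick_X (hwt : ∀ i, 0 < wt i) (p : ι × ℕ) (v : Fock ι) :
    (freeFieldAlgebra wt hwt).wick (X p) v = X p * v := by
  have h := ncoeff_Y_X_neg (fun i => 2 * wt i - 1) p 0 v
  simpa [wick_def] using h

/-- The left Wick product with a quadratic state is multiplication by the state plus a derivation
that preserves the polynomial degree. -/
theorem wick_X_mul_X (hwt : ∀ i, 0 < wt i) (p q : ι × ℕ) (v : Fock ι) :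
    (freeFieldAlgebra wt hwt).wick (X p * X q) v =
      X p * X q * v + contraction wt p q v + contraction wt q p v := by
  set d : ι → ℕ := fun i => 2 * wt i - 1 with hd
  have hd1 : ∀ i, d i + 1 = 2 * wt i := fun i => by have := hwt i; simp only [hd]; lia
  obtain ⟨M, h1, h2, h3, hM⟩ := ((normalOrder_ev d p (Y d (X q)) (-1) v).and
    ((contraction_ev wt q p v).and (((Filter.tendsto_sub_atTop_nat (1 + q.2 + d q.1)).eventually
      (contraction_ev wt p q v)).and (Filter.eventually_ge_atTop (1 + q.2 + d q.1))))).exists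
  obtain ⟨L, rfl⟩ := Nat.exists_eq_add_of_le hM
  rw [Nat.add_sub_cancel_left] at h3
  rw [wick_def, Y_X_mul, h1, h2, h3]
  congr 1
  · rw [add_assoc 1, add_assoc 1, add_comm 1, Finset.sum_range_succ', Finset.sum_range_add,
      Finset.sum_eq_zero, zero_add, add_comm]
    · congr 1
      · have h := ncoeff_Y_X_neg d q 0 v
        simp only [Nat.cast_zero, sub_zero, add_zero, Nat.choose_self, Nat.cast_one, one_smul] at h
        simp [h, mul_assoc]
      · refine Finset.sum_congr rfl fun l _ => ?_
        rw [show (-1 + ((q.2 + d q.1 + l + 1 : ℕ) : ℤ)) = ((q.2 + d q.1 + l : ℕ) : ℤ) by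
          push_cast; ring, ncoeff_Y_X_nonneg, ← hd1,
          show p.2 + (q.2 + d q.1 + l + 1) = p.2 + q.2 + l + (d q.1 + 1) by ring,
          mul_smul_comm, smul_smul, Nat.add_sub_cancel]
    · intro t ht
      rw [show (-1 + ((t + 1 : ℕ) : ℤ)) = (t : ℤ) by push_cast; ring,
        ncoeff_Y_X_eq_zero d q (Finset.mem_range.1 ht), mul_zero, smul_zero]
  · refine Finset.sum_congr rfl fun l _ => ?_
    rw [show (-1 - (p.2 : ℤ) - l - d p.1 - 1) = -1 - ((p.2 + l + (d p.1 + 1) : ℕ) : ℤ) by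
      push_cast; ring, ncoeff_Y_X_neg, hd1, smul_smul, mul_comm,
      show q.2 + (p.2 + l + 2 * wt p.1) = q.2 + p.2 + l + 2 * wt p.1 by ring]

end Contraction

/-! ### The filtration by conformal weight -/

section Weight

variable {ι : Type*} {wt : ι → ℕ}

/-- The span of the monomials of conformal weight at most `N`, where `x_{i,k}` has weight
`wt i + k`. -/
noncomputable def weightLE (wt : ι → ℕ) (N : ℤ) : Submodule ℂ (Fock ι) :=
  restrictSupport ℂ {m | (Finsupp.weight (fun p : ι × ℕ => wt p.1 + p.2) m : ℤ) ≤ N}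

theorem monomial_mem_weightLE {N : ℤ} {m : ι × ℕ →₀ ℕ} {c : ℂ}
    (h : (Finsupp.weight (fun p : ι × ℕ => wt p.1 + p.2) m : ℤ) ≤ N) :
    monomial m c ∈ weightLE wt N :=
  (monomial_mem_restrictSupport ℂ).2 (Or.inl h)

theorem weightLE_mono {M N : ℤ} (h : M ≤ N) : weightLE wt M ≤ weightLE wt N :=
  restrictSupport_mono ℂ fun _ hm => le_trans hm h

theorem weightLE_neg {N : ℤ} (h : N < 0) : weightLE wt N = ⊥ := by
  rw [weightLE, restrictSupport_eq_span, Submodule.span_eq_bot]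
  rintro _ ⟨m, hm, rfl⟩
  rw [Set.mem_ofPred_eq] at hm
  lia

theorem one_mem_weightLE {N : ℤ} (h : 0 ≤ N) : 1 ∈ weightLE wt N :=
  monomial_mem_weightLE (by simpa using h)

theorem exists_mem_weightLE (wt : ι → ℕ) (v : Fock ι) : ∃ N, v ∈ weightLE wt N := by
  refine ⟨(weightedTotalDegree (fun p : ι × ℕ => wt p.1 + p.2) v : ℕ), ?_⟩
  rw [weightLE, mem_restrictSupport_iff]
  intro m hm
  rw [Set.mem_ofPred_eq, Nat.cast_le]
  exact le_weightedTotalDegree _ hm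

theorem X_mul_mem_weightLE {N M : ℤ} {v : Fock ι} (hv : v ∈ weightLE wt N) (p : ι × ℕ)
    (h : N + wt p.1 + p.2 ≤ M) : X p * v ∈ weightLE wt M := by
  rw [weightLE, restrictSupport_eq_span] at hv
  induction hv using Submodule.span_induction with
  | mem v hv =>
    obtain ⟨m, hm, rfl⟩ := hv
    rw [Set.mem_ofPred_eq] at hm
    rw [X, monomial_mul, mul_one]
    apply monomial_mem_weightLE
    rw [map_add, Finsupp.weight_single]
    simp only [smul_eq_mul, one_mul]
    push_cast
    lia
  | zero => rw [mul_zero]; exact zero_mem _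
  | add a b _ _ ha hb => rw [mul_add]; exact add_mem ha hb
  | smul r a _ ha => rw [mul_smul_comm]; exact Submodule.smul_mem _ _ ha

theorem pderiv_mem_weightLE {N M : ℤ} {v : Fock ι} (hv : v ∈ weightLE wt N) (p : ι × ℕ)
    (h : N ≤ M + wt p.1 + p.2) : pderiv p v ∈ weightLE wt M := by
  rw [weightLE, restrictSupport_eq_span] at hv
  induction hv using Submodule.span_induction with
  | mem v hv =>
    obtain ⟨m, hm, rfl⟩ := hv
    rw [Set.mem_ofPred_eq] at hm
    rw [pderiv_monomial]
    by_cases hp : m p = 0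
    · rw [hp]
      simp
    · apply monomial_mem_weightLE
      have := Finsupp.weight_sub_single_add (w := fun p : ι × ℕ => wt p.1 + p.2) hp
      lia
  | zero => rw [map_zero]; exact zero_mem _
  | add a b _ _ ha hb => rw [map_add]; exact add_mem ha hb
  | smul r a _ ha => rw [Derivation.map_smul]; exact Submodule.smul_mem _ _ ha

theorem ncoeff_mem_weightLE (hwt : ∀ i, 0 < wt i) {i j k N : ℤ} {a b : Fock ι}
    (ha : a ∈ weightLE wt i) (hb : b ∈ weightLE wt j) (h : i + j - k - 1 ≤ N) :
    ncoeff (Y (fun i => 2 * wt i - 1) a) k b ∈ weightLE wt N := by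
  rw [weightLE, restrictSupport_eq_span] at ha
  induction ha using Submodule.span_induction with
  | mem v hv =>
    obtain ⟨m, hm, rfl⟩ := hv
    rw [Set.mem_ofPred_eq] at hm
    generalize hD : m.degree = D
    induction D generalizing m i j k N b with
    | zero =>
      obtain rfl := (Finsupp.degree_eq_zero_iff m).1 hD
      change ncoeff (Y (fun i => 2 * wt i - 1) 1) k b ∈ _
      rw [Y_one, idOp_apply]
      split_ifs with hk
      · refine weightLE_mono ?_ hb
        rw [map_zero] at hm
        push_cast at hm
        lia
      · exact zero_mem _
    | succ D ih =>
      obtain ⟨p, hp⟩ : ∃ p, m p ≠ 0 := by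
        by_contra! h0
        have : m = 0 := Finsupp.ext h0
        rw [this, map_zero] at hD
        lia
      obtain ⟨m, rfl⟩ : ∃ m', m = Finsupp.single p 1 + m' :=
        ⟨m - Finsupp.single p 1, (add_tsub_cancel_of_le
          (Finsupp.single_le_iff.2 (Nat.one_le_iff_ne_zero.2 hp))).symm⟩
      rw [map_add, Finsupp.degree_single] at hD
      rw [map_add, Finsupp.weight_single] at hm
      simp only [smul_eq_mul, one_mul] at hm
      push_cast at hm
      have e : (monomial (Finsupp.single p 1 + m) 1 : Fock ι) = X p * monomial m 1 := by
        rw [X, monomial_mul, mul_one]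
      obtain ⟨M, hM⟩ := (normalOrder_ev (fun i => 2 * wt i - 1) p
        (Y (fun i => 2 * wt i - 1) (monomial m 1)) k b).exists
      beta_reduce
      rw [e, Y_X_mul, hM]
      refine add_mem (sum_mem fun t _ => Submodule.smul_mem _ _ ?_)
        (sum_mem fun l _ => Submodule.smul_mem _ _ ?_)
      · refine X_mul_mem_weightLE (ih (i := i - wt p.1 - p.2) hb le_rfl m (by lia) (by lia)) _ ?_
        push_cast
        lia
      · refine ih (i := i - wt p.1 - p.2) (j := j - wt p.1 - l)
          (pderiv_mem_weightLE hb (p.1, l) (by lia)) ?_ m (by lia) (by lia)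
        have := hwt p.1
        rw [Nat.cast_sub (by lia)]
        push_cast
        lia
  | zero => rw [Y_zero_apply]; exact zero_mem _
  | add a b _ _ ha hb => rw [Y_add_apply]; exact add_mem ha hb
  | smul r a _ ha => rw [Y_smul_apply]; exact Submodule.smul_mem _ _ ha

theorem translation_mem_weightLE (hwt : ∀ i, 0 < wt i) {N : ℤ} {v : Fock ι}
    (hv : v ∈ weightLE wt N) : translation ι v ∈ weightLE wt (N + 1) := by
  have h := translation_Y (fun i => 2 * wt i - 1) v (-1) 1
  rw [(Y_creation _ v).2, Derivation.map_one_eq_zero, map_zero, zero_add] at h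
  rw [h]
  exact Submodule.smul_mem _ _ (ncoeff_mem_weightLE hwt hv (one_mem_weightLE le_rfl) (by lia))

end Weight

end FreeField

namespace WFree

open MvPolynomial FreeField

/-! ### The weight filtration of the orbifold -/

/-- The conformal weights of the generators `W^i`. -/
abbrev wt (n : ℕ) : Set.Icc 2 n → ℕ := fun i => (i : ℕ)

theorem wt_pos {n : ℕ} (i : Set.Icc 2 n) : 0 < wt n i := lt_of_lt_of_le two_pos i.2.1

/-- The signs by which the involution multiplies the generators. -/
abbrev sign (n : ℕ) : Set.Icc 2 n → ℤˣ := fun i => (-1) ^ (i : ℕ)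

theorem sign_of_even {n : ℕ} {i : Set.Icc 2 n} (h : Even (i : ℕ)) : ((sign n i : ℤ) : ℂ) = 1 := by
  simp [sign, h.neg_one_pow]

theorem sign_of_odd {n : ℕ} {i : Set.Icc 2 n} (h : Odd (i : ℕ)) : ((sign n i : ℤ) : ℂ) = -1 := by
  simp [sign, h.neg_one_pow]

theorem mem_orbifold {n : ℕ} {v : Fock (Set.Icc 2 n)} :
    v ∈ (orbifold n).toSubmodule ↔ rescale (sign n) v = v := Iff.rfl

theorem one_mem_orbifold (n : ℕ) : 1 ∈ (orbifold n).toSubmodule := (orbifold n).vac_mem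

theorem X_mul_mem_orbifold_iff {n : ℕ} {p : Set.Icc 2 n × ℕ} (hp : Even (p.1 : ℕ))
    {v : Fock (Set.Icc 2 n)} :
    X p * v ∈ (orbifold n).toSubmodule ↔ v ∈ (orbifold n).toSubmodule := by
  rw [mem_orbifold, mem_orbifold, rescale_X_mul, sign_of_even hp, one_smul]
  exact (mul_right_injective₀ (X_ne_zero p)).eq_iff

theorem X_mul_X_mul_mem_orbifold_iff {n : ℕ} {p q : Set.Icc 2 n × ℕ} (hp : Odd (p.1 : ℕ))
    (hq : Odd (q.1 : ℕ)) {v : Fock (Set.Icc 2 n)} :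
    X p * (X q * v) ∈ (orbifold n).toSubmodule ↔ v ∈ (orbifold n).toSubmodule := by
  rw [mem_orbifold, mem_orbifold, rescale_X_mul, rescale_X_mul, sign_of_odd hp, sign_of_odd hq]
  simp only [neg_smul, one_smul, mul_neg, neg_neg]
  rw [(mul_right_injective₀ (X_ne_zero p)).eq_iff, (mul_right_injective₀ (X_ne_zero q)).eq_iff]

theorem X_mul_X_mem_orbifold {n : ℕ} {p q : Set.Icc 2 n × ℕ} (hp : Odd (p.1 : ℕ))
    (hq : Odd (q.1 : ℕ)) : X p * X q ∈ (orbifold n).toSubmodule := by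
  rw [← mul_one (X q)]
  exact (X_mul_X_mul_mem_orbifold_iff hp hq).2 (one_mem_orbifold n)

theorem X_mul_pderiv_mem_orbifold {n : ℕ} {p q : Set.Icc 2 n × ℕ} (hp : Odd (p.1 : ℕ))
    (hq : Odd (q.1 : ℕ)) {v : Fock (Set.Icc 2 n)} (hv : v ∈ (orbifold n).toSubmodule) :
    X p * pderiv q v ∈ (orbifold n).toSubmodule := by
  have h := pderiv_rescale (sign n) q v
  rw [mem_orbifold.1 hv, sign_of_odd hq] at h
  rw [mem_orbifold, rescale_X_mul, sign_of_odd hp]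
  conv_rhs => rw [h]
  simp

theorem translation_mem_orbifold {n : ℕ} {v : Fock (Set.Icc 2 n)}
    (hv : v ∈ (orbifold n).toSubmodule) :
    translation _ v ∈ (orbifold n).toSubmodule := by
  have h := translation_Y (fun i => 2 * wt n i - 1) v (-1) 1
  rw [(Y_creation _ v).2, Derivation.map_one_eq_zero, map_zero, zero_add] at h
  rw [h]
  exact Submodule.smul_mem _ _ ((orbifold n).ncoeff_mem v hv _ 1 (one_mem_orbifold n))

theorem rescale_monomial {n : ℕ} (m : Set.Icc 2 n × ℕ →₀ ℕ) : ∃ s : ℂ, s ≠ 0 ∧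
    ∀ c : ℂ, rescale (sign n) (monomial m c) = s • monomial m c := by
  refine ⟨m.prod fun p k => ((sign n p.1 : ℤ) : ℂ) ^ k, ?_, fun c => ?_⟩
  · refine Finset.prod_ne_zero_iff.2 fun p _ => pow_ne_zero _ ?_
    simp
  · rw [rescale_apply, aeval_monomial, monomial_eq, MvPolynomial.algebraMap_eq, smul_eq_C_mul]
    simp only [Finsupp.prod, smul_eq_C_mul, map_prod, mul_pow, Finset.prod_mul_distrib,
      map_pow]
    ring

/-- The orbifold is spanned by the monomials that it contains. -/
theorem monomial_mem_orbifold {n : ℕ} {v : Fock (Set.Icc 2 n)}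
    (hv : v ∈ (orbifold n).toSubmodule) {m : Set.Icc 2 n × ℕ →₀ ℕ} (hm : m ∈ v.support) :
    monomial m 1 ∈ (orbifold n).toSubmodule := by
  classical
  obtain ⟨s, _, hs⟩ := rescale_monomial m
  have hcoeff : ∀ w : Fock (Set.Icc 2 n), coeff m (rescale (sign n) w) = s * coeff m w := by
    intro w
    induction w using MvPolynomial.induction_on' with
    | monomial u a =>
      by_cases h : u = m
      · subst h
        rw [hs, coeff_smul, smul_eq_mul]
      · obtain ⟨s', _, hs'⟩ := rescale_monomial u
        rw [hs', coeff_smul, coeff_monomial, if_neg h]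
        simp
    | add a b ha hb => rw [map_add, coeff_add, coeff_add, ha, hb, mul_add]
  have h1 := hcoeff v
  rw [mem_orbifold.1 hv] at h1
  have h2 : s = 1 := mul_right_cancel₀ (mem_support_iff.1 hm) (by rw [← h1, one_mul])
  rw [mem_orbifold, hs, h2, one_smul]

/-- The subspace of the orbifold of states of weight at most `N`. -/
noncomputable def filtration (n : ℕ) (N : ℤ) : Submodule ℂ (Fock (Set.Icc 2 n)) :=
  weightLE (wt n) N ⊓ (orbifold n).toSubmodule

theorem X_mul_X_mem_filtration {n : ℕ} {p q : Set.Icc 2 n} (hp : Odd (p : ℕ)) (hq : Odd (q : ℕ))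
    {a b : ℕ} {N : ℤ} (h : (p + q + a + b : ℤ) ≤ N) : X (p, a) * X (q, b) ∈ filtration n N := by
  refine ⟨?_, X_mul_X_mem_orbifold hp hq⟩
  rw [← mul_one (X (q, b))]
  exact X_mul_mem_weightLE (X_mul_mem_weightLE (one_mem_weightLE le_rfl) _ le_rfl) _ (by
    simp only
    lia)

/-! ### Quadratic states modulo derivatives and products -/

/-- The states of weight at most `N` in the orbifold that are evidently generated by the elements
of `generators n` and states of smaller weight. -/
noncomputable abbrev generated (n : ℕ) (N : ℤ) : Submodule ℂ (Fock (Set.Icc 2 n)) :=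
  generatedPart (wt_pos (n := n)) (filtration n) (generators n) N

theorem generator_mem_generated {n : ℕ} {N : ℤ} {v : Fock (Set.Icc 2 n)} (hv : v ∈ generators n)
    (hN : 0 < N) (hvN : v ∈ filtration n N) : v ∈ generated n N :=
  Submodule.subset_span (Or.inl (Or.inl (Or.inr ⟨hv, hN, hvN⟩)))

theorem translation_mem_generated {n : ℕ} {N : ℤ} {v : Fock (Set.Icc 2 n)}
    (hv : v ∈ filtration n (N - 1)) : translation _ v ∈ generated n N :=
  Submodule.subset_span (Or.inl (Or.inr ⟨v, hv, rfl⟩))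

theorem wick_mem_generated {n : ℕ} {i j N : ℤ} {a b : Fock (Set.Icc 2 n)}
    (ha : a ∈ filtration n i) (hb : b ∈ filtration n j) (hij : i + j ≤ N) (hi : 0 < i)
    (hj : 0 < j) : (freeFieldAlgebra (wt n) wt_pos).wick a b ∈ generated n N :=
  Submodule.subset_span (Or.inr ⟨i, j, a, b, hij, by lia, by lia, ha, hb, rfl⟩)

theorem T_pow_X {n : ℕ} (i : Set.Icc 2 n) (b : ℕ) :
    ((algebra n).T ^ b) (X (i, 0)) = (b.factorial : ℂ) • X (i, b) := by
  induction b with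
  | zero => simp
  | succ b ih =>
    rw [pow_succ', Module.End.mul_apply, ih, map_smul]
    have : (algebra n).T (X (i, b)) = translation _ (X (i, b)) := rfl
    rw [this, translation_X, smul_smul, Nat.factorial_succ, mul_comm, Nat.cast_mul]

theorem W_eq {n : ℕ} (i : Set.Icc 2 n) : W n i = X (i, 0) := by
  rw [W, dif_pos i.2]

theorem U_eq {n : ℕ} (i j : Set.Icc 2 n) (b : ℕ) :
    U n i j 0 b = (b.factorial : ℂ) • (X (i, 0) * X (j, b)) := by
  rw [U, W_eq, W_eq, pow_zero, Module.End.one_apply, T_pow_X]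
  exact (wick_X wt_pos _ _).trans (mul_smul_comm _ _ _)

/-- Integration by parts: modulo derivatives, a quadratic state is a multiple of one with a single
differentiated factor. -/
theorem X_mul_X_sub_mem_generated {n : ℕ} {p q : Set.Icc 2 n} (hp : Odd (p : ℕ))
    (hq : Odd (q : ℕ)) {N : ℤ} {a b : ℕ} (h : (p + q + a + b : ℤ) ≤ N) :
    X (p, a) * X (q, b) - ((-1) ^ a * ((a + b).choose a : ℂ)) • (X (p, 0) * X (q, a + b)) ∈
      generated n N := by
  induction a generalizing b with
  | zero => simp
  | succ a ih =>
    have h1 := ih (b := b + 1) (by push_cast at h ⊢; lia)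
    have h2 := translation_mem_generated (N := N) (X_mul_X_mem_filtration hp hq (a := a) (b := b)
      (N := N - 1) (by push_cast at h ⊢; lia))
    rw [Derivation.leibniz, translation_X, translation_X] at h2
    have ha : ((a : ℂ) + 1) ≠ 0 := by exact_mod_cast a.succ_ne_zero
    have h3 := Submodule.smul_mem _ ((a : ℂ) + 1)⁻¹
      (sub_mem h2 (Submodule.smul_mem _ ((b : ℂ) + 1) h1))
    have hc : ((a + (b + 1)).choose (a + 1) : ℂ) * (a + 1) = (a + (b + 1)).choose a * (b + 1) := by
      have := Nat.choose_succ_right_eq (a + (b + 1)) a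
      rw [Nat.add_sub_cancel_left] at this
      exact_mod_cast this
    rw [show a + 1 + b = a + (b + 1) by ring]
    convert h3 using 1
    simp only [smul_eq_mul, mul_smul_comm, Nat.cast_succ, smul_sub, smul_add, smul_smul]
    rw [mul_comm (X (q, b)), inv_mul_cancel₀ ha, one_smul]
    have e : (a + 1 : ℂ)⁻¹ * ((b + 1) * ((-1) ^ a * ((a + (b + 1)).choose a : ℂ))) =
        - ((-1) ^ (a + 1) * ((a + (b + 1)).choose (a + 1) : ℂ)) := by
      field_simp
      rw [pow_succ]
      linear_combination -(-1) ^ a * hc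
    rw [e, neg_smul]
    abel

theorem X_mul_X_mem_generated_iff {n : ℕ} {p q : Set.Icc 2 n} (hp : Odd (p : ℕ))
    (hq : Odd (q : ℕ)) {N : ℤ} {a b : ℕ} (h : (p + q + a + b : ℤ) ≤ N) :
    X (p, a) * X (q, b) ∈ generated n N ↔ X (p, 0) * X (q, a + b) ∈ generated n N := by
  have h1 := X_mul_X_sub_mem_generated hp hq h
  have hc : ((-1) ^ a * ((a + b).choose a : ℂ)) ≠ 0 :=
    mul_ne_zero (pow_ne_zero _ (by norm_num))
      (Nat.cast_ne_zero.2 (Nat.choose_pos (Nat.le_add_right a b)).ne')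
  rw [← Submodule.smul_mem_iff (generated n N) hc (x := X (p, 0) * X (q, a + b))]
  exact ⟨fun h2 => (Submodule.sub_mem_iff_right _ h2).1 h1, fun h2 =>
    (Submodule.sub_mem_iff_left _ h2).1 h1⟩

theorem X_mul_X_self_mem_generated {n : ℕ} {p : Set.Icc 2 n} (hp : Odd (p : ℕ)) {N : ℤ} {m : ℕ}
    (hm : Odd m) (h : (p + p + m : ℤ) ≤ N) : X (p, 0) * X (p, m) ∈ generated n N := by
  have h1 := X_mul_X_sub_mem_generated hp hp (a := m) (b := 0) (N := N) (by push_cast; lia)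
  rw [add_zero, Nat.choose_self, hm.neg_one_pow, Nat.cast_one, mul_one, neg_smul, one_smul,
    sub_neg_eq_add, mul_comm, ← two_smul ℂ] at h1
  exact (Submodule.smul_mem_iff _ two_ne_zero).1 h1

/-- The contractions with `W^3`. -/
theorem contraction_three {n : ℕ} {t : Set.Icc 2 n} (ht : (t : ℕ) = 3) (p : Set.Icc 2 n)
    (k l m : ℕ) : contraction (wt n) (p, k) (t, l) (X (t, m)) =
      (((k + l + m + 6).choose k : ℂ) * coef 5 l m) • X (p, k + l + m + 6) := by
  have h := contraction_X (wt := wt n) (p, k) (t, l) m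
  simp only [wt, ht] at h
  exact h

theorem contraction_ne {n : ℕ} {q r : Set.Icc 2 n} (h : r ≠ q) (p : Set.Icc 2 n × ℕ)
    (l m : ℕ) : contraction (wt n) p (q, l) (X (r, m)) = 0 :=
  contraction_X_of_ne h

theorem coef_five_zero (m : ℕ) : coef 5 0 m = (m + 5).choose 5 := by
  simp [coef]

theorem coef_five_one (m : ℕ) : coef 5 1 m = -((m + 6) * (m + 5).choose 5) := by
  simp only [coef, Nat.choose_one_right]
  push_cast
  ring

theorem U_mem_generated {n : ℕ} {i j : Set.Icc 2 n} (hi : Odd (i : ℕ)) (hj : Odd (j : ℕ)) {b : ℕ}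
    {N : ℤ} (hS : U n i j 0 b ∈ generators n) (h : (i + j + b : ℤ) ≤ N) :
    X (i, 0) * X (j, b) ∈ generated n N := by
  have hi2 := i.2.1
  have hb : (b.factorial : ℂ) ≠ 0 := Nat.cast_ne_zero.2 b.factorial_ne_zero
  rw [← Submodule.smul_mem_iff _ hb]
  rw [U_eq] at hS
  exact generator_mem_generated hS (by lia) (Submodule.smul_mem _ _
    (X_mul_X_mem_filtration hi hj (by push_cast; lia)))

/-- The relation between `x_{t,1} x_{t,0} · x_{t,0} x_{r,d}` and `x_{t,0} x_{t,0} · x_{t,1} x_{r,d}`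
decomposes all quadratics in `W^3`, `W^r` with at least seven derivatives. -/
theorem three_mul_X_mem_generated {n : ℕ} {t r : Set.Icc 2 n} (ht : (t : ℕ) = 3) (hr : Odd (r : ℕ))
    (hrt : r ≠ t) (m : ℕ) {N : ℤ} (h : (3 + r + m : ℤ) ≤ N) :
    X (t, 0) * X (r, m) ∈ generated n N := by
  have ht' : Odd (t : ℕ) := by rw [ht]; decide
  have hr2 := r.2.1
  rcases le_or_gt m 6 with hm | hm
  · refine U_mem_generated ht' hr ?_ (by rw [ht]; exact h)
    obtain ⟨i, hi⟩ := hr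
    refine Or.inl (Or.inl (Or.inr ⟨i, ?_, ?_, m, hm, ?_⟩))
    · have : (r : ℕ) ≠ 3 := fun h => hrt (Subtype.ext (h.trans ht.symm))
      lia
    · have := r.2.2
      lia
    · rw [hi, ht]
  · obtain ⟨d, rfl⟩ := Nat.exists_eq_add_of_lt hm
    have h1 := wick_mem_generated (N := N) (X_mul_X_mem_filtration ht' ht' (a := 1) (b := 0) le_rfl)
      (X_mul_X_mem_filtration ht' hr (a := 0) (b := d) le_rfl) (by push_cast at h ⊢; lia)
      (by push_cast; lia) (by push_cast; lia)
    have h2 := wick_mem_generated (N := N) (X_mul_X_mem_filtration ht' ht' (a := 0) (b := 0) le_rfl)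
      (X_mul_X_mem_filtration ht' hr (a := 1) (b := d) le_rfl) (by push_cast at h ⊢; lia)
      (by push_cast; lia) (by push_cast; lia)
    have h3 := sub_mem h1 h2
    rw [wick_X_mul_X, wick_X_mul_X] at h3
    -- The quartic terms cancel, and the contractions add up to `-11 x_{t,7} x_{r,d}`.
    simp only [Derivation.leibniz, contraction_three ht, contraction_ne hrt, smul_eq_mul,
      coef_five_zero, coef_five_one] at h3
    have h4 : (X (t, 7) * X (r, d) : Fock (Set.Icc 2 n)) ∈ generated n N := by
      rw [← Submodule.smul_mem_iff _ (show (-11 : ℂ) ≠ 0 by norm_num)]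
      convert h3 using 1
      norm_num [Nat.choose, smul_eq_C_mul]
      simp only [map_ofNat]
      ring
    rw [X_mul_X_mem_generated_iff ht' hr (by push_cast at h ⊢; lia)] at h4
    rwa [show 6 + d + 1 = 7 + d by ring]

/-- The relation between `x_{t,1} x_{t,1} · x_{t,0} x_{t,s}` and
`x_{t,1} x_{t,0} · x_{t,1} x_{t,s}` decomposes all quadratics in `W^3` with at least eight
derivatives. -/
theorem three_mul_three_mem_generated {n : ℕ} {t : Set.Icc 2 n} (ht : (t : ℕ) = 3) (m : ℕ) {N : ℤ}
    (h : (6 + m : ℤ) ≤ N) : X (t, 0) * X (t, m) ∈ generated n N := by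
  have ht' : Odd (t : ℕ) := by rw [ht]; decide
  rcases Nat.even_or_odd m with hm | hm
  swap
  · exact X_mul_X_self_mem_generated ht' hm (by lia)
  rcases le_or_gt m 6 with h6 | h6
  · refine U_mem_generated ht' ht' ?_ (by lia)
    obtain ⟨a, rfl⟩ := hm
    refine Or.inl (Or.inl (Or.inl (Or.inr ⟨a, by lia, ?_⟩)))
    rw [ht, two_mul]
  · obtain ⟨s, rfl⟩ : ∃ s, m = s + 8 := ⟨m - 8, by obtain ⟨a, rfl⟩ := hm; lia⟩
    have hs : Even s := by
      rw [Nat.even_add] at hm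
      exact hm.2 (by decide)
    have h1 := wick_mem_generated (N := N) (X_mul_X_mem_filtration ht' ht' (a := 1) (b := 1) le_rfl)
      (X_mul_X_mem_filtration ht' ht' (a := 0) (b := s) le_rfl) (by push_cast at h ⊢; lia)
      (by push_cast; lia) (by push_cast; lia)
    have h2 := wick_mem_generated (N := N) (X_mul_X_mem_filtration ht' ht' (a := 1) (b := 0) le_rfl)
      (X_mul_X_mem_filtration ht' ht' (a := 1) (b := s) le_rfl) (by push_cast at h ⊢; lia)
      (by push_cast; lia) (by push_cast; lia)
    have h3 := sub_mem h1 h2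
    rw [wick_X_mul_X, wick_X_mul_X] at h3
    simp only [Derivation.leibniz, contraction_three ht, smul_eq_mul,
      coef_five_zero, coef_five_one] at h3
    have h4 := X_mul_X_sub_mem_generated ht' ht' (a := 8) (b := s) (N := N) (by push_cast at h ⊢; lia)
    have h5 := X_mul_X_sub_mem_generated ht' ht' (a := 1) (b := s + 7) (N := N)
      (by push_cast at h ⊢; lia)
    -- Integration by parts turns all contractions into multiples of `x_{t,0} x_{t,s+8}`; their
    -- total coefficient is negative.
    have hκ : -(102 * ((s + 8).choose 8 : ℂ) + (s + 8) * (2 * s + 11) * (s + 5).choose 5) ≠ 0 := by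
      rw [neg_ne_zero]
      have : 0 < (s + 8).choose 8 := Nat.choose_pos (by lia)
      have h' : 102 * (s + 8).choose 8 + (s + 8) * (2 * s + 11) * (s + 5).choose 5 ≠ 0 := by lia
      exact_mod_cast h'
    rw [← Submodule.smul_mem_iff _ hκ]
    have h6 := add_mem (add_mem h3 (Submodule.smul_mem _ (102 : ℂ) h4))
      (Submodule.smul_mem _ ((s + 5).choose 5 : ℂ) h5)
    convert h6 using 1
    simp only [show 8 + s = s + 8 by ring, show 1 + (s + 7) = s + 8 by ring,
      show 1 + 1 + s + 6 = s + 8 by ring, show 1 + 0 + s + 6 = s + 7 by ring,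
      Nat.choose_one_right, Nat.choose_zero_right, zero_add,
      Nat.choose_self, show (1 + 5).choose 5 = 6 from rfl, smul_eq_C_mul, map_mul, map_add, map_neg,
      map_natCast, map_ofNat, map_pow, map_one, Nat.cast_add, Nat.cast_one, Nat.cast_ofNat]
    norm_num
    ring

end WFree

namespace WFree

open MvPolynomial FreeField

/-- The relation between `x_{t,0} x_{p,k} · x_{t,0} x_{r,0}` and `x_{t,0} x_{t,0} · x_{p,k} x_{r,0}`,
where `t` is the index of `W^3`, decomposes all quadratics in the other odd generators with at least
six derivatives. -/
theorem X_zero_mul_X_mem_generated {n : ℕ} {t p r : Set.Icc 2 n} (ht : (t : ℕ) = 3)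
    (hp : Odd (p : ℕ)) (hr : Odd (r : ℕ)) (hpt : p ≠ t) (hrt : r ≠ t) (hpr : (p : ℕ) ≤ r) (m : ℕ)
    {N : ℤ} (h : (p + r + m : ℤ) ≤ N) : X (p, 0) * X (r, m) ∈ generated n N := by
  have ht' : Odd (t : ℕ) := by rw [ht]; decide
  have hp2 := p.2.1
  have hr2 := r.2.1
  rcases le_or_gt m 5 with hm | hm
  · have hp3 : (p : ℕ) ≠ 3 := fun h => hpt (Subtype.ext (h.trans ht.symm))
    have hrn := r.2.2
    by_cases heq : p = r
    · subst heq
      rcases Nat.even_or_odd m with hm2 | hm2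
      · refine U_mem_generated hp hp ?_ h
        obtain ⟨i, hi⟩ := hp
        obtain ⟨a, rfl⟩ := hm2
        refine Or.inl (Or.inr ⟨i, by lia, by lia, a, by lia, ?_⟩)
        rw [hi, two_mul a]
      · exact X_mul_X_self_mem_generated hp hm2 h
    · refine U_mem_generated hp hr ?_ h
      have hne : (p : ℕ) ≠ r := fun h => heq (Subtype.ext h)
      obtain ⟨i, hi⟩ := hp
      obtain ⟨j, hj⟩ := hr
      refine Or.inr ⟨i, j, by lia, by lia, by lia, m, hm, ?_⟩
      rw [hi, hj]
  · obtain ⟨k, rfl⟩ := Nat.exists_eq_add_of_lt hm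
    have h1 := wick_mem_generated (N := N) (X_mul_X_mem_filtration ht' hp (a := 0) (b := k) le_rfl)
      (X_mul_X_mem_filtration ht' hr (a := 0) (b := 0) le_rfl) (by push_cast at h ⊢; lia)
      (by push_cast; lia) (by push_cast; lia)
    have h2 := wick_mem_generated (N := N) (X_mul_X_mem_filtration ht' ht' (a := 0) (b := 0) le_rfl)
      (X_mul_X_mem_filtration hp hr (a := k) (b := 0) le_rfl) (by push_cast at h ⊢; lia)
      (by push_cast; lia) (by push_cast; lia)
    have h3 := sub_mem h1 h2
    rw [wick_X_mul_X, wick_X_mul_X] at h3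
    simp only [Derivation.leibniz, contraction_three ht, contraction_ne hrt, contraction_ne hpt,
      contraction_ne hpt.symm, smul_eq_mul, coef_five_zero] at h3
    -- For `r = p` the relation has a second term, which is quadratic in `W^3`.
    have h4 : X (t, 0) * contraction (wt n) (t, 0) (p, k) (X (r, 0)) ∈ generated n N := by
      by_cases hrp : r = p
      · subst hrp
        have h5 := contraction_X (wt := wt n) (t, 0) (r, k) 0
        dsimp only at h5
        rw [h5, mul_smul_comm]
        refine Submodule.smul_mem _ _ (three_mul_three_mem_generated ht _ ?_)
        push_cast at h ⊢
        lia
      · rw [contraction_ne hrp, mul_zero]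
        exact zero_mem _
    have h5 := sub_mem h3 h4
    have h6 : X (p, k + 6) * X (r, 0) ∈ generated n N := by
      have hc : ((k + 6).choose k : ℂ) ≠ 0 :=
        Nat.cast_ne_zero.2 (Nat.choose_pos (Nat.le_add_right k 6)).ne'
      rw [← Submodule.smul_mem_iff _ hc]
      convert h5 using 1
      simp only [add_zero, zero_add, Nat.choose_self, Nat.cast_one, mul_one, mul_zero,
        smul_eq_C_mul]
      ring
    rwa [X_mul_X_mem_generated_iff hp hr (by push_cast at h ⊢; lia),
      show k + 6 + 0 = 5 + k + 1 by ring] at h6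

/-- All quadratic states are generated. -/
theorem X_mul_X_mem_generated {n : ℕ} (hn : 3 ≤ n) {p r : Set.Icc 2 n} (hp : Odd (p : ℕ))
    (hr : Odd (r : ℕ)) {a b : ℕ} {N : ℤ} (h : (p + r + a + b : ℤ) ≤ N) :
    X (p, a) * X (r, b) ∈ generated n N := by
  wlog hpr : (p : ℕ) ≤ r generalizing p r a b
  · rw [mul_comm]
    exact this hr hp (by lia) (by lia)
  obtain ⟨t, ht⟩ : ∃ t : Set.Icc 2 n, (t : ℕ) = 3 := ⟨⟨3, by norm_num, hn⟩, rfl⟩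
  rw [X_mul_X_mem_generated_iff hp hr h]
  have hp3 : 3 ≤ (p : ℕ) := by
    have := p.2.1
    obtain ⟨i, hi⟩ := hp
    lia
  by_cases hpt : p = t
  · subst hpt
    by_cases hrt : r = p
    · subst hrt
      exact three_mul_three_mem_generated ht _ (by push_cast; lia)
    · exact three_mul_X_mem_generated ht hr hrt _ (by push_cast; lia)
  · have hrt : r ≠ t := by
      rintro rfl
      exact hpt (Subtype.ext (by lia))
    exact X_zero_mul_X_mem_generated ht hp hr hpt hrt hpr _ (by push_cast; lia)

/-! ### Strong generation -/

theorem X_mem_generated {n : ℕ} {p : Set.Icc 2 n × ℕ} (hp : Even (p.1 : ℕ)) {N : ℤ}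
    (h : (p.1 + p.2 : ℤ) ≤ N) : X p ∈ generated n N := by
  obtain ⟨i, k⟩ := p
  have hmem : ∀ (k : ℕ) (N : ℤ), (i + k : ℤ) ≤ N → X (i, k) ∈ filtration n N := by
    intro k N h
    rw [← mul_one (X (i, k))]
    refine ⟨?_, (X_mul_mem_orbifold_iff (p := (i, k)) hp).2 (one_mem_orbifold n)⟩
    exact X_mul_mem_weightLE (N := 0) (one_mem_weightLE le_rfl) (i, k) (by simpa using h)
  obtain ⟨hi2, hin⟩ := i.2
  cases k with
  | zero =>
    obtain ⟨j, hj⟩ := hp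
    rw [← two_mul] at hj
    refine generator_mem_generated (Or.inl (Or.inl (Or.inl (Or.inl ⟨j, ?_, ?_, ?_⟩))))
      (by dsimp only at h; lia) (hmem 0 N h)
    · dsimp only at hj; lia
    · dsimp only at hj; lia
    · dsimp only at hj
      rw [← hj, W_eq]
  | succ k =>
    have h1 := translation_mem_generated (hmem k (N - 1) (by push_cast at h; lia))
    rw [translation_X] at h1
    exact (Submodule.smul_mem_iff _ (Nat.cast_ne_zero.2 k.succ_ne_zero)).1 h1

/-- By induction on the degree: an even variable or a pair of odd variables can be split off a
monomial by a Wick product, up to contractions, which have smaller degree. -/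
theorem monomial_mem_generated {n : ℕ} (hn : 3 ≤ n) {N : ℤ} (D : ℕ) :
    ∀ (m : Set.Icc 2 n × ℕ →₀ ℕ), m.degree = D → monomial m 1 ∈ (orbifold n).toSubmodule →
      (Finsupp.weight (fun p : Set.Icc 2 n × ℕ => wt n p.1 + p.2) m : ℤ) ≤ N →
      monomial m 1 ∈ generated n N := by
  have hsplit : ∀ (m : Set.Icc 2 n × ℕ →₀ ℕ) (p), m p ≠ 0 → ∃ m' : Set.Icc 2 n × ℕ →₀ ℕ,
      m = Finsupp.single p 1 + m' := fun m p hp => ⟨m - Finsupp.single p 1,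
    (add_tsub_cancel_of_le (Finsupp.single_le_iff.2 (Nat.one_le_iff_ne_zero.2 hp))).symm⟩
  have hX : ∀ (m' : Set.Icc 2 n × ℕ →₀ ℕ) (p),
      (monomial (Finsupp.single p 1 + m') 1 : Fock (Set.Icc 2 n)) = X p * monomial m' 1 :=
    fun m' p => by rw [X, monomial_mul, mul_one]
  have hpos : ∀ (m : Set.Icc 2 n × ℕ →₀ ℕ), m ≠ 0 →
      0 < Finsupp.weight (fun p : Set.Icc 2 n × ℕ => wt n p.1 + p.2) m := by
    intro m hm
    obtain ⟨p, hp⟩ := Finsupp.ne_iff.1 hm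
    obtain ⟨m', rfl⟩ := hsplit m p hp
    rw [map_add, Finsupp.weight_single]
    have := wt_pos p.1
    simp only [smul_eq_mul, one_mul]
    lia
  induction D using Nat.strong_induction_on with
  | _ D ih =>
  intro m hD hU hw
  rcases eq_or_ne m 0 with rfl | hm
  · exact Submodule.subset_span (Or.inl (Or.inl (Or.inl rfl)))
  by_cases heven : ∃ p, m p ≠ 0 ∧ Even (p.1 : ℕ)
  · obtain ⟨p, hp, hpe⟩ := heven
    obtain ⟨m, rfl⟩ := hsplit m p hp
    rw [map_add, Finsupp.weight_single] at hw
    simp only [smul_eq_mul, one_mul] at hw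
    push_cast at hw
    rw [hX] at hU ⊢
    rcases eq_or_ne m 0 with rfl | hm0
    · have h1 : (monomial 0 1 : Fock (Set.Icc 2 n)) = 1 := rfl
      rw [h1, mul_one]
      exact X_mem_generated hpe (by simpa using hw)
    · have h0 := hpos m hm0
      have := wt_pos p.1
      rw [← wick_X wt_pos]
      refine wick_mem_generated (i := wt n p.1 + p.2) (j := N - wt n p.1 - p.2) ⟨?_, ?_⟩
        ⟨monomial_mem_weightLE (by lia), (X_mul_mem_orbifold_iff hpe).1 hU⟩ (by lia) (by lia)
        (by lia)
      · rw [← mul_one (X p)]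
        exact X_mul_mem_weightLE (one_mem_weightLE le_rfl) _ (by simp)
      · rw [← mul_one (X p)]
        exact (X_mul_mem_orbifold_iff hpe).2 (one_mem_orbifold n)
  · have hodd : ∀ p, m p ≠ 0 → Odd (p.1 : ℕ) := fun p hp =>
      Nat.not_even_iff_odd.1 fun h => heven ⟨p, hp, h⟩
    obtain ⟨p, hp⟩ := Finsupp.ne_iff.1 hm
    have hpo := hodd p hp
    obtain ⟨m, rfl⟩ := hsplit m p hp
    have hm0 : m ≠ 0 := by
      -- A single odd variable is not fixed by the involution.
      rintro rfl
      rw [hX] at hU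
      have h1 : (monomial 0 1 : Fock (Set.Icc 2 n)) = 1 := rfl
      rw [h1, mem_orbifold, rescale_X_mul, sign_of_odd hpo, show rescale (sign n) 1 = 1 from
        one_mem_orbifold n, mul_one, neg_smul, one_smul] at hU
      exact X_ne_zero p (self_eq_neg.1 hU.symm)
    obtain ⟨q, hq⟩ := Finsupp.ne_iff.1 hm0
    have hqo := hodd q (by
      have : m q ≠ 0 := hq
      simp [this])
    obtain ⟨m, rfl⟩ := hsplit m q hq
    simp only [map_add, Finsupp.weight_single, Finsupp.degree_single, smul_eq_mul, one_mul] at hw hD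
    push_cast at hw
    rw [hX, hX] at hU ⊢
    have hU' := (X_mul_X_mul_mem_orbifold_iff hpo hqo).1 hU
    rcases eq_or_ne m 0 with rfl | hm1
    · have h1 : (monomial 0 1 : Fock (Set.Icc 2 n)) = 1 := rfl
      rw [h1, mul_one]
      refine X_mul_X_mem_generated hn hpo hqo ?_
      rw [map_zero] at hw
      push_cast at hw
      lia
    · have h0 := hpos m hm1
      have hwick : (freeFieldAlgebra (wt n) wt_pos).wick (X p * X q) (monomial m 1) ∈
          generated n N :=
        wick_mem_generated (i := wt n p.1 + wt n q.1 + p.2 + q.2)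
          (j := N - wt n p.1 - wt n q.1 - p.2 - q.2) (X_mul_X_mem_filtration hpo hqo le_rfl)
          ⟨monomial_mem_weightLE (by lia), hU'⟩ (by lia)
          (by have := wt_pos p.1; lia) (by lia)
      have hcontr : ∀ p q : Set.Icc 2 n × ℕ, Odd (p.1 : ℕ) → Odd (q.1 : ℕ) →
          (wt n p.1 + p.2 + wt n q.1 + q.2 +
            Finsupp.weight (fun p : Set.Icc 2 n × ℕ => wt n p.1 + p.2) m : ℤ) ≤ N →
          contraction (wt n) p q (monomial m 1) ∈ generated n N := by
        intro p q hpo hqo hw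
        obtain ⟨M, hM⟩ := (contraction_ev (wt n) p q (monomial m 1)).exists
        rw [hM]
        refine sum_mem fun l _ => Submodule.smul_mem _ _ ?_
        have hmem := X_mul_pderiv_mem_orbifold
          (p := (p.1, p.2 + q.2 + l + 2 * wt n q.1)) (q := (q.1, l)) hpo hqo hU'
        by_cases hl : m (q.1, l) = 0
        · rw [pderiv_monomial, hl]
          simp
        · obtain ⟨m, rfl⟩ := hsplit m (q.1, l) hl
          have e : (X (p.1, p.2 + q.2 + l + 2 * wt n q.1) *
              pderiv (q.1, l) (monomial (Finsupp.single (q.1, l) 1 + m) 1) : Fock (Set.Icc 2 n)) =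
              ((m (q.1, l) + 1 : ℕ) : ℂ) •
                monomial (Finsupp.single (p.1, p.2 + q.2 + l + 2 * wt n q.1) 1 + m) 1 := by
            rw [pderiv_monomial, add_tsub_cancel_left, hX, Finsupp.add_apply,
              Finsupp.single_eq_same, add_comm 1, one_mul, ← mul_smul_comm, smul_monomial,
              smul_eq_mul, mul_one]
          rw [e] at hmem ⊢
          refine Submodule.smul_mem _ _ (ih _ ?_ _ rfl ((Submodule.smul_mem_iff _
            (Nat.cast_ne_zero.2 (Nat.succ_ne_zero _))).1 hmem) ?_)
          · simp only [map_add, Finsupp.degree_single] at hD ⊢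
            lia
          · simp only [map_add, Finsupp.weight_single, smul_eq_mul, one_mul] at hw ⊢
            push_cast at hw ⊢
            lia
      have h2 := sub_mem (sub_mem hwick (hcontr p q hpo hqo (by lia))) (hcontr q p hqo hpo (by lia))
      rw [wick_X_mul_X] at h2
      convert h2 using 1
      ring

theorem generators_subset_orbifold {n : ℕ} (hn : 3 ≤ n) :
    generators n ⊆ (orbifold n).toSubmodule := by
  have hW : ∀ i, Even i → W n i ∈ (orbifold n).toSubmodule := by
    intro i hi
    rw [W]
    split_ifs with h
    · rw [← mul_one (X _)]
      exact (X_mul_mem_orbifold_iff hi).2 (one_mem_orbifold n)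
    · exact zero_mem _
  have hU : ∀ i j a, Odd i → Odd j → i ∈ Set.Icc 2 n → j ∈ Set.Icc 2 n →
      U n i j 0 a ∈ (orbifold n).toSubmodule := by
    intro i j a hi hj hin hjn
    have := U_eq ⟨i, hin⟩ ⟨j, hjn⟩ a
    dsimp only at this
    rw [this]
    exact Submodule.smul_mem _ _ (X_mul_X_mem_orbifold hi hj)
  have h3 : Odd 3 := by decide
  rintro v ((((⟨i, -, -, rfl⟩ | ⟨a, -, rfl⟩) | ⟨i, hi, hin, a, -, rfl⟩) | ⟨i, hi, hin, a, -, rfl⟩) |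
    ⟨i, j, hi, hij, hj, a, -, rfl⟩)
  · exact hW _ (even_two_mul i)
  · exact hU _ _ _ h3 h3 ⟨by lia, hn⟩ ⟨by lia, hn⟩
  · exact hU _ _ _ h3 (odd_two_mul_add_one i) ⟨by lia, hn⟩ ⟨by lia, by lia⟩
  · exact hU _ _ _ (odd_two_mul_add_one i) (odd_two_mul_add_one i) ⟨by lia, by lia⟩
      ⟨by lia, by lia⟩
  · exact hU _ _ _ (odd_two_mul_add_one i) (odd_two_mul_add_one j) ⟨by lia, by lia⟩
      ⟨by lia, by lia⟩

theorem isStrongGeneratingSet_generators {n : ℕ} (hn : 3 ≤ n) :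
    (orbifold n).IsStrongGeneratingSet (generators n) := by
  refine isStrongGeneratingSet_of_le_generatedPart (hwt := wt_pos) (orbifold n)
    (F := filtration n) ?_ ?_ ?_ ?_ ?_ (generators_subset_orbifold hn) ?_
  · intro N hN
    rw [filtration, weightLE_neg hN, bot_inf_eq]
  · exact ⟨one_mem_weightLE le_rfl, one_mem_orbifold n⟩
  · exact fun ha hb h => ⟨ncoeff_mem_weightLE wt_pos ha.1 hb.1 h,
      (orbifold n).ncoeff_mem _ ha.2 _ _ hb.2⟩
  · exact fun ha => ⟨translation_mem_weightLE wt_pos ha.1, translation_mem_orbifold ha.2⟩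
  · intro v hv
    obtain ⟨N, hN⟩ := exists_mem_weightLE (wt n) v
    exact ⟨N, hN, hv⟩
  · intro N _ v hv
    rw [v.as_sum]
    refine sum_mem fun m hm => ?_
    rw [← mul_one (coeff m v), ← smul_eq_mul, ← smul_monomial]
    exact Submodule.smul_mem _ _ (monomial_mem_generated hn _ m rfl
      (monomial_mem_orbifold hv.2 hm) (hv.1 hm))

end WFree

/-! ### Derivatives at the vacuum -/

namespace FreeField

open MvPolynomial

section VacuumCoeff

variable {ι : Type*} {wt : ι → ℕ}

/-- The coefficient of the vacuum. -/
noncomputable def vacuumCoeff (ι : Type*) : Fock ι →ₐ[ℂ] ℂ := aeval fun _ => 0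

theorem vacuumCoeff_X_mul (p : ι × ℕ) (v : Fock ι) : vacuumCoeff ι (X p * v) = 0 := by
  rw [map_mul, vacuumCoeff, aeval_X, zero_mul]

theorem vacuumCoeff_translation (v : Fock ι) : vacuumCoeff ι (translation ι v) = 0 := by
  induction v using fock_induction with
  | one => rw [Derivation.map_one_eq_zero, map_zero]
  | add a b ha hb => rw [map_add, map_add, ha, hb, add_zero]
  | smul r a ha => rw [Derivation.map_smul, map_smul, ha, smul_zero]
  | mul p a ha =>
    obtain ⟨i, k⟩ := p
    rw [Derivation.leibniz, translation_X, smul_eq_mul, smul_eq_mul, map_add, vacuumCoeff_X_mul,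
      mul_smul_comm, map_smul, mul_comm, vacuumCoeff_X_mul, smul_zero, add_zero]

theorem vacuumCoeff_contraction (p q : ι × ℕ) (v : Fock ι) :
    vacuumCoeff ι (contraction wt p q v) = 0 := by
  obtain ⟨M, hM⟩ := (contraction_ev wt p q v).exists
  rw [hM, map_sum]
  exact Finset.sum_eq_zero fun l _ => by rw [map_smul, vacuumCoeff_X_mul, smul_zero]

/-- The first partial derivative at the vacuum. -/
noncomputable def firstDeriv (x : ι × ℕ) : Fock ι →ₗ[ℂ] ℂ :=
  (vacuumCoeff ι).toLinearMap ∘ₗ (pderiv x).toLinearMap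

/-- The second partial derivative at the vacuum. -/
noncomputable def secondDeriv (x y : ι × ℕ) : Fock ι →ₗ[ℂ] ℂ :=
  firstDeriv x ∘ₗ (pderiv y).toLinearMap

/-- The third partial derivative at the vacuum. -/
noncomputable def thirdDeriv (x y z : ι × ℕ) : Fock ι →ₗ[ℂ] ℂ :=
  secondDeriv x y ∘ₗ (pderiv z).toLinearMap

/-- The fourth partial derivative at the vacuum. -/
noncomputable def fourthDeriv (x y z u : ι × ℕ) : Fock ι →ₗ[ℂ] ℂ :=
  thirdDeriv x y z ∘ₗ (pderiv u).toLinearMap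

theorem firstDeriv_apply (x : ι × ℕ) (v : Fock ι) :
    firstDeriv x v = vacuumCoeff ι (pderiv x v) := rfl

theorem secondDeriv_apply (x y : ι × ℕ) (v : Fock ι) :
    secondDeriv x y v = firstDeriv x (pderiv y v) := rfl

theorem thirdDeriv_apply (x y z : ι × ℕ) (v : Fock ι) :
    thirdDeriv x y z v = secondDeriv x y (pderiv z v) := rfl

theorem fourthDeriv_apply (x y z u : ι × ℕ) (v : Fock ι) :
    fourthDeriv x y z u v = thirdDeriv x y z (pderiv u v) := rfl

theorem secondDeriv_one (x y : ι × ℕ) : secondDeriv x y 1 = 0 := by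
  rw [secondDeriv_apply, Derivation.map_one_eq_zero, map_zero]

theorem secondDeriv_comm (x y : ι × ℕ) (v : Fock ι) : secondDeriv x y v = secondDeriv y x v := by
  simp only [secondDeriv_apply, firstDeriv_apply, pderiv_comm x y]

variable [DecidableEq ι]

theorem pderiv_X_mul (x s : ι × ℕ) (w : Fock ι) :
    pderiv x (X s * w) = X s * pderiv x w + if s = x then w else 0 := by
  rw [Derivation.leibniz, pderiv_X, Pi.single_apply, smul_eq_mul, smul_eq_mul, mul_ite, mul_one,
    mul_zero]

theorem firstDeriv_X_mul (x s : ι × ℕ) (w : Fock ι) :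
    firstDeriv x (X s * w) = if s = x then vacuumCoeff ι w else 0 := by
  rw [firstDeriv_apply, pderiv_X_mul, map_add, vacuumCoeff_X_mul, zero_add, apply_ite (vacuumCoeff ι),
    map_zero]

theorem secondDeriv_X_mul (x y s : ι × ℕ) (w : Fock ι) : secondDeriv x y (X s * w) =
    (if s = x then firstDeriv y w else 0) + if s = y then firstDeriv x w else 0 := by
  rw [secondDeriv_apply, pderiv_X_mul, map_add, firstDeriv_X_mul, apply_ite (firstDeriv x), map_zero,
    firstDeriv_apply y]

theorem thirdDeriv_X_mul (x y z s : ι × ℕ) (w : Fock ι) : thirdDeriv x y z (X s * w) =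
    (if s = x then secondDeriv y z w else 0) + (if s = y then secondDeriv x z w else 0) +
      if s = z then secondDeriv x y w else 0 := by
  rw [thirdDeriv_apply, pderiv_X_mul, map_add, secondDeriv_X_mul, apply_ite (secondDeriv x y),
    map_zero, secondDeriv_apply y, secondDeriv_apply x z]

theorem fourthDeriv_X_mul (x y z u s : ι × ℕ) (w : Fock ι) : fourthDeriv x y z u (X s * w) =
    (if s = x then thirdDeriv y z u w else 0) + (if s = y then thirdDeriv x z u w else 0) +
      (if s = z then thirdDeriv x y u w else 0) + if s = u then thirdDeriv x y z w else 0 := by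
  rw [fourthDeriv_apply, pderiv_X_mul, map_add, thirdDeriv_X_mul, apply_ite (thirdDeriv x y z),
    map_zero, thirdDeriv_apply y, thirdDeriv_apply x z, thirdDeriv_apply x y u]

theorem secondDeriv_X_mul_X_mul (x y p q : ι × ℕ) {w : Fock ι} (hw : vacuumCoeff ι w = 0) :
    secondDeriv x y (X p * X q * w) = 0 := by
  rw [mul_assoc, secondDeriv_X_mul, firstDeriv_X_mul, firstDeriv_X_mul, hw]
  simp

/-- A contraction raises the number of derivatives by at least twice the weight. -/
theorem secondDeriv_contraction_eq_zero {x y p q : ι × ℕ} (hx : x.2 < 2 * wt q.1)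
    (hy : y.2 < 2 * wt q.1) (v : Fock ι) : secondDeriv x y (contraction wt p q v) = 0 := by
  obtain ⟨M, hM⟩ := (contraction_ev wt p q v).exists
  rw [hM, map_sum]
  refine Finset.sum_eq_zero fun l _ => ?_
  rw [map_smul, secondDeriv_X_mul, if_neg, if_neg, add_zero, smul_zero]
  · rintro rfl
    simp only at hy
    lia
  · rintro rfl
    simp only at hx
    lia

/-- For a pole of order six the contraction `x_{p,6} ∂/∂x_{q,0}` has just six derivatives. -/
theorem secondDeriv_contraction_six {x y p q : ι × ℕ} (hx : x.2 = 6) (hy : y.2 = 0)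
    (hq : 3 ≤ wt q.1) (v : Fock ι) : secondDeriv x y (contraction wt p q v) =
      if p = (x.1, 0) ∧ q.2 = 0 ∧ wt q.1 = 3 then secondDeriv y q v else 0 := by
  obtain ⟨M, hM, h1⟩ := ((contraction_ev wt p q v).and (Filter.eventually_ge_atTop 1)).exists
  obtain ⟨x, k⟩ := x
  obtain ⟨q, b⟩ := q
  obtain ⟨p, a⟩ := p
  dsimp only at hx hq hM ⊢
  subst hx
  have hterm : ∀ l, secondDeriv (x, 6) y (X (p, a + b + l + 2 * wt q) * pderiv (q, l) v) =
      if p = x ∧ a = 0 ∧ b = 0 ∧ l = 0 ∧ wt q = 3 then secondDeriv y (q, l) v else 0 := by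
    intro l
    rw [secondDeriv_X_mul, if_neg (c := (_, _) = y) (by rintro rfl; simp only at hy; lia), add_zero]
    refine if_congr ?_ rfl rfl
    rw [Prod.mk.injEq]
    refine and_congr_right fun _ => ?_
    lia
  rw [hM, map_sum, Finset.sum_eq_single 0]
  · rw [map_smul, hterm, smul_ite, smul_zero]
    simp only [Prod.mk.injEq]
    by_cases h : p = x ∧ a = 0 ∧ b = 0 ∧ wt q = 3
    · obtain ⟨rfl, rfl, rfl, h3⟩ := h
      simp [h3, coef]
    · rw [if_neg (by tauto), if_neg (by tauto)]
  · intro l _ hl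
    rw [map_smul, hterm, if_neg (by tauto), smul_zero]
  · intro h
    exact absurd (Finset.mem_range.2 (by lia)) h

theorem fourthDeriv_contraction {x y z u : ι} {p q : ι × ℕ} (hq : 0 < wt q.1) (v : Fock ι) :
    fourthDeriv (x, 0) (y, 0) (z, 0) (u, 0) (contraction wt p q v) = 0 := by
  obtain ⟨M, hM⟩ := (contraction_ev wt p q v).exists
  rw [hM, map_sum]
  refine Finset.sum_eq_zero fun l _ => ?_
  have h : ∀ x : ι, (p.1, p.2 + q.2 + l + 2 * wt q.1) ≠ (x, 0) := by
    intro x h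
    rw [Prod.mk.injEq] at h
    lia
  rw [map_smul, fourthDeriv_X_mul, if_neg (h _), if_neg (h _), if_neg (h _), if_neg (h _)]
  simp

theorem fourthDeriv_X_mul_X (x y z u p q : ι × ℕ) :
    fourthDeriv x y z u (X p * X q) = 0 := by
  rw [← mul_one (X q)]
  simp only [fourthDeriv_X_mul, thirdDeriv_X_mul, secondDeriv_one, ite_self, add_zero]

theorem fourthDeriv_X (x y z u p : ι × ℕ) : fourthDeriv x y z u (X p) = 0 := by
  rw [← mul_one (X p), fourthDeriv_X_mul]
  simp only [thirdDeriv_apply, Derivation.map_one_eq_zero, map_zero, ite_self, add_zero]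

end VacuumCoeff

/-! ### Functionals on quadratic states -/

section Functional

variable {ι : Type*}

/-- The functional on the quadratic states in `W i`, `W j` with `m` derivatives that vanishes on
derivatives: the alternating sum of the coefficients of `(∂ᵃ W i) (∂ᵇ W j)` for `a + b = m`, where
`∂ᵃ W i` is the state `a! x_{i,a}`. -/
noncomputable def quadraticFunctional (i j : ι) (m : ℕ) : Fock ι →ₗ[ℂ] ℂ :=
  ∑ a ∈ Finset.HasAntidiagonal.antidiagonal m,
    ((-1) ^ a.1 * (a.1.factorial : ℂ)⁻¹ * (a.2.factorial : ℂ)⁻¹) • secondDeriv (i, a.1) (j, a.2)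

theorem quadraticFunctional_apply (i j : ι) (m : ℕ) (v : Fock ι) : quadraticFunctional i j m v =
    ∑ a ∈ Finset.HasAntidiagonal.antidiagonal m,
      ((-1) ^ a.1 * (a.1.factorial : ℂ)⁻¹ * (a.2.factorial : ℂ)⁻¹) * secondDeriv (i, a.1) (j, a.2) v := by
  rw [quadraticFunctional, LinearMap.sum_apply]
  rfl

theorem secondDeriv_translation (i j : ι) (a b : ℕ) (v : Fock ι) :
    secondDeriv (i, a) (j, b) (translation ι v) =
      a * secondDeriv (i, a - 1) (j, b) v + b * secondDeriv (i, a) (j, b - 1) v := by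
  simp only [secondDeriv_apply, firstDeriv_apply]
  rw [pderiv_translation, map_add, map_add, pderiv_translation, map_add, vacuumCoeff_translation,
    zero_add, map_smul, Derivation.map_smul, map_smul, smul_eq_mul, smul_eq_mul]

theorem fourthDeriv_translation (i j k l : ι) (v : Fock ι) :
    fourthDeriv (i, 0) (j, 0) (k, 0) (l, 0) (translation ι v) = 0 := by
  simp only [fourthDeriv_apply, thirdDeriv_apply, secondDeriv_apply, firstDeriv_apply,
    pderiv_translation, Nat.cast_zero, zero_smul, add_zero, vacuumCoeff_translation]

theorem quadraticFunctional_translation (i j : ι) (m : ℕ) (v : Fock ι) :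
    quadraticFunctional i j m (translation ι v) = 0 := by
  rw [quadraticFunctional_apply]
  simp only [secondDeriv_translation, mul_add, Finset.sum_add_distrib]
  cases m with
  | zero => simp
  | succ m =>
    rw [Finset.Nat.sum_antidiagonal_succ, Finset.Nat.sum_antidiagonal_succ', Nat.cast_zero, zero_mul,
      mul_zero, zero_mul, mul_zero, zero_add, zero_add, ← Finset.sum_add_distrib]
    refine Finset.sum_eq_zero fun a _ => ?_
    have h : ∀ k : ℕ, ((k + 1).factorial : ℂ)⁻¹ * (k + 1 : ℕ) = (k.factorial : ℂ)⁻¹ := by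
      intro k
      rw [Nat.factorial_succ, Nat.cast_mul, mul_inv, mul_right_comm,
        inv_mul_cancel₀ (Nat.cast_ne_zero.2 k.succ_ne_zero), one_mul]
    have h1 := h a.1
    have h2 := h a.2
    rw [Nat.add_sub_cancel, Nat.add_sub_cancel, pow_succ]
    linear_combination (-(-1) ^ a.1 * (a.2.factorial : ℂ)⁻¹ * secondDeriv (i, a.1) (j, a.2) v) * h1 +
      ((-1) ^ a.1 * (a.1.factorial : ℂ)⁻¹ * secondDeriv (i, a.1) (j, a.2) v) * h2

theorem quadraticFunctional_X_mul_X [DecidableEq ι] (i j i' j' : ι) (m b : ℕ) :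
    quadraticFunctional i j m (X (i', 0) * X (j', b)) = if b = m then (m.factorial : ℂ)⁻¹ *
      ((if i' = i ∧ j' = j then 1 else 0) + (-1) ^ m * (if i' = j ∧ j' = i then 1 else 0)) else 0 := by
  have h1 : ∀ x y : ι × ℕ, firstDeriv x (X y) = if y = x then 1 else 0 := by
    intro x y
    rw [← mul_one (X y), firstDeriv_X_mul, map_one]
  have hterm : ∀ a : ℕ × ℕ, secondDeriv (i, a.1) (j, a.2) (X (i', 0) * X (j', b)) =
      (if a = (0, b) then if i' = i ∧ j' = j then 1 else 0 else 0) +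
        if a = (b, 0) then if i' = j ∧ j' = i then 1 else 0 else 0 := by
    rintro ⟨a, c⟩
    rw [secondDeriv_X_mul, h1, h1, ← ite_and, ← ite_and, ← ite_and, ← ite_and]
    congr 1
    · refine if_congr ?_ rfl rfl
      simp only [Prod.mk.injEq]
      tauto
    · refine if_congr ?_ rfl rfl
      simp only [Prod.mk.injEq]
      tauto
  rw [quadraticFunctional_apply]
  simp only [hterm, mul_add, Finset.sum_add_distrib, mul_ite (_ = (_ : ℕ × ℕ)), mul_zero,
    Finset.sum_ite_eq', Finset.HasAntidiagonal.mem_antidiagonal, zero_add, add_zero]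
  split_ifs with h <;> simp [h, mul_comm]

theorem quadraticFunctional_one (i j : ι) (m : ℕ) : quadraticFunctional i j m 1 = 0 := by
  rw [quadraticFunctional_apply]
  refine Finset.sum_eq_zero fun a _ => ?_
  rw [secondDeriv_one, mul_zero]

theorem quadraticFunctional_X_mul_X_mul [DecidableEq ι] (i j : ι) (m : ℕ)
    (p q : ι × ℕ) {v : Fock ι} (hv : vacuumCoeff ι v = 0) :
    quadraticFunctional i j m (X p * X q * v) = 0 := by
  rw [quadraticFunctional_apply]
  refine Finset.sum_eq_zero fun a _ => ?_
  rw [secondDeriv_X_mul_X_mul _ _ _ _ hv, mul_zero]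

end Functional

end FreeField

namespace WFree

open MvPolynomial FreeField

/-! ### Minimality -/

/-- The span of the derivatives of the even `W^i` and of all quadratic states in the odd `W^i`. It
contains the elements of `generators n` and all their derivatives. -/
noncomputable def letters (n : ℕ) : Submodule ℂ (Fock (Set.Icc 2 n)) :=
  Submodule.span ℂ ({v | ∃ p : Set.Icc 2 n × ℕ, Even (p.1 : ℕ) ∧ v = X p} ∪
    {v | ∃ p q : Set.Icc 2 n × ℕ, Odd (p.1 : ℕ) ∧ Odd (q.1 : ℕ) ∧ v = X p * X q})

theorem X_mem_letters {n : ℕ} {p : Set.Icc 2 n × ℕ} (hp : Even (p.1 : ℕ)) : X p ∈ letters n :=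
  Submodule.subset_span (Or.inl ⟨p, hp, rfl⟩)

theorem X_mul_X_mem_letters {n : ℕ} {p q : Set.Icc 2 n × ℕ} (hp : Odd (p.1 : ℕ))
    (hq : Odd (q.1 : ℕ)) : X p * X q ∈ letters n :=
  Submodule.subset_span (Or.inr ⟨p, q, hp, hq, rfl⟩)

theorem translation_mem_letters {n : ℕ} {v : Fock (Set.Icc 2 n)} (hv : v ∈ letters n) :
    translation _ v ∈ letters n := by
  induction hv using Submodule.span_induction with
  | mem v hv =>
    obtain ⟨⟨i, k⟩, hp, rfl⟩ | ⟨⟨i, k⟩, ⟨j, l⟩, hp, hq, rfl⟩ := hv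
    · rw [translation_X]
      exact Submodule.smul_mem _ _ (X_mem_letters hp)
    · rw [Derivation.leibniz, translation_X, translation_X, smul_eq_mul, smul_eq_mul,
        mul_smul_comm, mul_smul_comm]
      exact add_mem (Submodule.smul_mem _ _ (X_mul_X_mem_letters hp hq))
        (Submodule.smul_mem _ _ (X_mul_X_mem_letters hq hp))
  | zero => rw [map_zero]; exact zero_mem _
  | add a b _ _ ha hb => rw [map_add]; exact add_mem ha hb
  | smul c a _ ha => rw [Derivation.map_smul]; exact Submodule.smul_mem _ c ha

/-- The elements of `generators n` in terms of the variables: the quadratic ones are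
`m! x_{p,0} x_{r,m} = :W^p ∂ᵐW^r:` with `p ≤ r`. -/
theorem mem_generators {n : ℕ} (hn : 3 ≤ n) {v : Fock (Set.Icc 2 n)} (hv : v ∈ generators n) :
    (∃ i : Set.Icc 2 n, Even (i : ℕ) ∧ v = X (i, 0)) ∨
      ∃ (p r : Set.Icc 2 n) (m : ℕ), Odd (p : ℕ) ∧ Odd (r : ℕ) ∧ p ≤ r ∧ (p = r → Even m) ∧
        (m ≤ 5 ∨ m = 6 ∧ (p : ℕ) = 3) ∧ v = (m.factorial : ℂ) • (X (p, 0) * X (r, m)) := by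
  have h3 : Odd 3 := by decide
  obtain ((((⟨i, hi, hin, rfl⟩ | ⟨a, ha, rfl⟩) | ⟨i, hi, hin, a, ha, rfl⟩) |
    ⟨i, hi, hin, a, ha, rfl⟩) | ⟨i, j, hi, hij, hj, a, ha, rfl⟩) := hv
  · exact Or.inl ⟨⟨2 * i, by lia, hin⟩, even_two_mul i, W_eq ⟨2 * i, by lia, hin⟩⟩
  · refine Or.inr ⟨⟨3, by lia, hn⟩, ⟨3, by lia, hn⟩, 2 * a, h3, h3, le_rfl,
      fun _ => even_two_mul a, ?_, U_eq ⟨3, by lia, hn⟩ ⟨3, by lia, hn⟩ _⟩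
    simp only
    lia
  · refine Or.inr ⟨⟨3, by lia, hn⟩, ⟨2 * i + 1, by lia, hin⟩, a, h3, odd_two_mul_add_one i,
      Subtype.mk_le_mk.2 (by lia), fun h => ?_, ?_, U_eq ⟨3, by lia, hn⟩ ⟨2 * i + 1, by lia, hin⟩ _⟩
    · have := Subtype.mk.inj h
      lia
    · simp only
      lia
  · exact Or.inr ⟨⟨2 * i + 1, by lia, hin⟩, ⟨2 * i + 1, by lia, hin⟩, 2 * a,
      odd_two_mul_add_one i, odd_two_mul_add_one i, le_rfl, fun _ => even_two_mul a,
      Or.inl (by lia), U_eq ⟨2 * i + 1, by lia, hin⟩ ⟨2 * i + 1, by lia, hin⟩ _⟩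
  · refine Or.inr ⟨⟨2 * i + 1, by lia, by lia⟩, ⟨2 * j + 1, by lia, hj⟩, a,
      odd_two_mul_add_one i, odd_two_mul_add_one j, Subtype.mk_le_mk.2 (by lia), fun h => ?_,
      Or.inl ha, U_eq ⟨2 * i + 1, by lia, by lia⟩ ⟨2 * j + 1, by lia, hj⟩ _⟩
    have := Subtype.mk.inj h
    lia

theorem generators_subset_letters {n : ℕ} (hn : 3 ≤ n) : generators n ⊆ letters n := by
  intro v hv
  obtain ⟨i, hi, rfl⟩ | ⟨p, r, m, hp, hr, -, -, -, rfl⟩ := mem_generators hn hv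
  · exact X_mem_letters hi
  · exact Submodule.smul_mem _ _ (X_mul_X_mem_letters hp hr)

/-- Linear functionals that vanish on the vacuum, on derivatives and on normally ordered products
`:ab:`, where `a` is a derivative of a generator and `b` has no vacuum component. -/
structure VanishesOnDecomposables {n : ℕ} (φ : Fock (Set.Icc 2 n) →ₗ[ℂ] ℂ) : Prop where
  map_one : φ 1 = 0
  map_translation : ∀ v, φ (translation _ v) = 0
  map_X_mul : ∀ (p : Set.Icc 2 n × ℕ), Even (p.1 : ℕ) → ∀ v, vacuumCoeff _ v = 0 → φ (X p * v) = 0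
  map_wick : ∀ (p q : Set.Icc 2 n × ℕ), Odd (p.1 : ℕ) → Odd (q.1 : ℕ) →
    ∀ v, vacuumCoeff _ v = 0 →
      φ (X p * X q * v + contraction (wt n) p q v + contraction (wt n) q p v) = 0

/-- A functional annihilates `:av:` for all `a ∈ letters n` if it does so for the spanning states,
for which the Wick product is explicit. -/
theorem map_wick_eq_zero {n : ℕ} {φ : Fock (Set.Icc 2 n) →ₗ[ℂ] ℂ} {v : Fock (Set.Icc 2 n)}
    (hX : ∀ p : Set.Icc 2 n × ℕ, Even (p.1 : ℕ) → φ (X p * v) = 0)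
    (hXX : ∀ p q : Set.Icc 2 n × ℕ, Odd (p.1 : ℕ) → Odd (q.1 : ℕ) →
      φ (X p * X q * v + contraction (wt n) p q v + contraction (wt n) q p v) = 0)
    {a : Fock (Set.Icc 2 n)} (ha : a ∈ letters n) : φ ((algebra n).wick a v) = 0 := by
  induction ha using Submodule.span_induction with
  | mem a ha =>
    obtain ⟨p, hp, rfl⟩ | ⟨p, q, hp, hq, rfl⟩ := ha
    · rw [← hX p hp]
      exact congrArg φ (wick_X wt_pos p v)
    · rw [← hXX p q hp hq]
      exact congrArg φ (wick_X_mul_X wt_pos p q v)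
  | zero => simp [VertexAlgebra.wick]
  | add a b _ _ ha hb =>
    simp only [VertexAlgebra.wick, map_add, Pi.add_apply, LinearMap.add_apply] at ha hb ⊢
    rw [ha, hb, add_zero]
  | smul c a _ ha =>
    simp only [VertexAlgebra.wick, map_smul, Pi.smul_apply, LinearMap.smul_apply] at ha ⊢
    rw [ha, smul_zero]

/-- A generator that is detected by a functional vanishing on decomposable states and on all other
generators cannot be omitted. -/
theorem mem_of_vanishesOnDecomposables {n : ℕ} (hn : 3 ≤ n) {S : Set (Fock (Set.Icc 2 n))}
    (hS : (orbifold n).IsStrongGeneratingSet S) (hSn : S ⊆ generators n)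
    {t : Fock (Set.Icc 2 n)} (ht : t ∈ generators n) {φ : Fock (Set.Icc 2 n) →ₗ[ℂ] ℂ}
    (hφ : VanishesOnDecomposables φ) (hφt : φ t ≠ 0)
    (hφs : ∀ s ∈ generators n, φ s ≠ 0 → s = t) : t ∈ S := by
  by_contra htS
  have hS0 : ∀ s ∈ S, φ s = 0 := by
    intro s hs
    by_contra h
    exact htS (hφs s (hSn hs) h ▸ hs)
  have hletter : ∀ s ∈ S, ∀ k, ((algebra n).T ^ k) s ∈ letters n := by
    intro s hs k
    induction k with
    | zero => exact generators_subset_letters hn (hSn hs)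
    | succ k ih =>
      rw [pow_succ', Module.End.mul_apply]
      exact translation_mem_letters ih
  have hmon : ∀ v, (algebra n).IsMonomial S v → φ v = 0 ∧ (v = 1 ∨ vacuumCoeff _ v = 0) := by
    intro v hv
    induction hv with
    | vac => exact ⟨hφ.map_one, Or.inl rfl⟩
    | wick s hs k b _ ih =>
      refine ⟨?_, Or.inr (map_wick_eq_zero (φ := (vacuumCoeff _).toLinearMap)
        (fun p _ => vacuumCoeff_X_mul p b) (fun p q _ _ => ?_) (hletter s hs k))⟩
      · obtain rfl | hb := ih.2
        · have h1 : (algebra n).wick (((algebra n).T ^ k) s) 1 = ((algebra n).T ^ k) s :=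
            (algebra n).Y_creation_neg_one _
          rw [h1]
          cases k with
          | zero => exact hS0 s hs
          | succ k =>
            rw [pow_succ', Module.End.mul_apply]
            exact hφ.map_translation _
        · exact map_wick_eq_zero (fun p hp => hφ.map_X_mul p hp b hb)
            (fun p q hp hq => hφ.map_wick p q hp hq b hb) (hletter s hs k)
      · change vacuumCoeff _ (_ + _ + _) = 0
        rw [map_add, map_add, mul_assoc, vacuumCoeff_X_mul, vacuumCoeff_contraction,
          vacuumCoeff_contraction, add_zero, add_zero]
  have ht' : t ∈ Submodule.span ℂ {v | (algebra n).IsMonomial S v} := by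
    rw [hS.2]
    exact generators_subset_orbifold hn ht
  have hker : Submodule.span ℂ {v | (algebra n).IsMonomial S v} ≤ LinearMap.ker φ :=
    Submodule.span_le.2 fun v hv => (hmon v hv).1
  exact hφt (hker ht')

theorem ne_of_even_of_odd {n : ℕ} {p q : Set.Icc 2 n × ℕ} (hp : Even (p.1 : ℕ))
    (hq : Odd (q.1 : ℕ)) : p ≠ q := by
  rintro rfl
  exact Nat.not_even_iff_odd.2 hq hp

theorem three_le_of_odd {n : ℕ} {i : Set.Icc 2 n} (hi : Odd (i : ℕ)) : 3 ≤ wt n i := by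
  have := i.2.1
  obtain ⟨k, hk⟩ := hi
  simp only [wt]
  lia

theorem vanishesOnDecomposables_firstDeriv {n : ℕ} {i : Set.Icc 2 n} (hi : Even (i : ℕ)) :
    VanishesOnDecomposables (firstDeriv (i, 0)) where
  map_one := by rw [firstDeriv_apply, Derivation.map_one_eq_zero, map_zero]
  map_translation v := by
    rw [firstDeriv_apply, pderiv_translation, Nat.cast_zero, zero_smul, add_zero,
      vacuumCoeff_translation]
  map_X_mul p _ v hv := by rw [firstDeriv_X_mul, hv, ite_self]
  map_wick p q hp hq v _ := by
    have hc : ∀ p q : Set.Icc 2 n × ℕ, Odd (p.1 : ℕ) →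
        firstDeriv (i, 0) (contraction (wt n) p q v) = 0 := by
      intro p q hp
      obtain ⟨M, hM⟩ := (contraction_ev (wt n) p q v).exists
      rw [hM, map_sum]
      refine Finset.sum_eq_zero fun l _ => ?_
      rw [map_smul, firstDeriv_X_mul,
        if_neg (ne_of_even_of_odd (p := (i, 0)) (q := (p.1, p.2 + q.2 + l + 2 * wt n q.1)) hi hp).symm,
        smul_zero]
    rw [map_add, map_add, hc p q hp, hc q p hq, mul_assoc, firstDeriv_X_mul,
      if_neg (ne_of_even_of_odd (p := (i, 0)) hi hp).symm, add_zero, add_zero]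

theorem quadraticFunctional_X_mul_of_even {n : ℕ} {p r : Set.Icc 2 n} (hp : Odd (p : ℕ))
    (hr : Odd (r : ℕ)) (m : ℕ) {s : Set.Icc 2 n × ℕ} (hs : Even (s.1 : ℕ))
    (v : Fock (Set.Icc 2 n)) : quadraticFunctional p r m (X s * v) = 0 := by
  rw [quadraticFunctional_apply]
  refine Finset.sum_eq_zero fun a _ => ?_
  rw [secondDeriv_X_mul, if_neg (ne_of_even_of_odd (q := (p, _)) hs hp),
    if_neg (ne_of_even_of_odd (q := (r, _)) hs hr), add_zero, mul_zero]

theorem vanishesOnDecomposables_quadraticFunctional {n : ℕ} {p r : Set.Icc 2 n}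
    (hp : Odd (p : ℕ)) (hr : Odd (r : ℕ)) {m : ℕ} (hm : m ≤ 5) :
    VanishesOnDecomposables (quadraticFunctional p r m) where
  map_one := quadraticFunctional_one p r m
  map_translation := quadraticFunctional_translation p r m
  map_X_mul s hs v _ := quadraticFunctional_X_mul_of_even hp hr m hs v
  map_wick s u hs hu v hv := by
    have hc : ∀ s u : Set.Icc 2 n × ℕ, Odd (u.1 : ℕ) →
        quadraticFunctional p r m (contraction (wt n) s u v) = 0 := by
      intro s u hu
      have h3 := three_le_of_odd hu
      rw [quadraticFunctional_apply]
      refine Finset.sum_eq_zero fun a ha => ?_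
      rw [Finset.HasAntidiagonal.mem_antidiagonal] at ha
      rw [secondDeriv_contraction_eq_zero (by simp only; lia) (by simp only; lia), mul_zero]
    rw [map_add, map_add, hc s u hu, hc u s hs, quadraticFunctional_X_mul_X_mul _ _ _ _ _ hv,
      add_zero, add_zero]

theorem quadraticFunctional_six_contraction {n : ℕ} {t r : Set.Icc 2 n} (ht : (t : ℕ) = 3)
    (s : Set.Icc 2 n × ℕ) {u : Set.Icc 2 n × ℕ} (hu : Odd (u.1 : ℕ))
    (v : Fock (Set.Icc 2 n)) : quadraticFunctional t r 6 (contraction (wt n) s u v) =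
      720⁻¹ * ((if s = (t, 0) ∧ u = (t, 0) then secondDeriv (r, 0) (t, 0) v else 0) +
        if s = (r, 0) ∧ u = (t, 0) then secondDeriv (t, 0) (t, 0) v else 0) := by
  have h3 := three_le_of_odd hu
  have hut : u.2 = 0 ∧ wt n u.1 = 3 ↔ u = (t, 0) := by
    obtain ⟨u, k⟩ := u
    simp only [Prod.mk.injEq, Subtype.ext_iff, wt, ht]
    tauto
  have hsix : ∀ x y : Set.Icc 2 n, secondDeriv (x, 6) (y, 0) (contraction (wt n) s u v) =
      if s = (x, 0) ∧ u = (t, 0) then secondDeriv (y, 0) (t, 0) v else 0 := by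
    intro x y
    rw [secondDeriv_contraction_six rfl rfl h3]
    simp only [hut]
    split_ifs with h
    · rw [h.2]
    · rfl
  have hlow : ∀ a b : ℕ, a < 6 → b < 6 →
      secondDeriv (t, a) (r, b) (contraction (wt n) s u v) = 0 := fun a b ha hb =>
    secondDeriv_contraction_eq_zero (by simp only; lia) (by simp only; lia) v
  rw [quadraticFunctional_apply]
  simp only [Finset.Nat.antidiagonal_succ, Finset.Nat.antidiagonal_zero, Finset.map_singleton,
    Finset.sum_cons, Finset.map_cons, Finset.sum_singleton]
  simp [hlow, hsix, secondDeriv_comm (t, 0) (r, 6), Nat.factorial]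
  split_ifs <;> ring

/-- Contractions with `W^3` have a component with six derivatives, which the quartic term of the
functional compensates. The constant is `3 * 720`: on `x_s x_u v` the fourth derivative is three times
the sum that the contractions contribute with the factor `1 / 720`. -/
theorem vanishesOnDecomposables_quadraticFunctional_six {n : ℕ} {t r : Set.Icc 2 n}
    (ht : (t : ℕ) = 3) (hr : Odd (r : ℕ)) :
    VanishesOnDecomposables (quadraticFunctional t r 6 -
      (2160 : ℂ)⁻¹ • fourthDeriv (t, 0) (t, 0) (t, 0) (r, 0)) where
  map_one := by
    rw [LinearMap.sub_apply, quadraticFunctional_one, LinearMap.smul_apply, fourthDeriv_apply,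
      Derivation.map_one_eq_zero, map_zero, smul_zero, sub_zero]
  map_translation v := by
    rw [LinearMap.sub_apply, quadraticFunctional_translation, LinearMap.smul_apply,
      fourthDeriv_translation, smul_zero, sub_zero]
  map_X_mul s hs v _ := by
    have ht' : Odd (t : ℕ) := by rw [ht]; decide
    have hst : s ≠ (t, 0) := ne_of_even_of_odd hs ht'
    have hsr : s ≠ (r, 0) := ne_of_even_of_odd hs hr
    rw [LinearMap.sub_apply, quadraticFunctional_X_mul_of_even ht' hr 6 hs, LinearMap.smul_apply,
      fourthDeriv_X_mul, if_neg hst, if_neg hsr]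
    simp
  map_wick s u hs hu v hv := by
    rw [LinearMap.sub_apply, LinearMap.smul_apply]
    simp only [map_add]
    rw [quadraticFunctional_X_mul_X_mul _ _ _ _ _ hv, quadraticFunctional_six_contraction ht s hu,
      quadraticFunctional_six_contraction ht u hs, fourthDeriv_contraction (wt_pos _),
      fourthDeriv_contraction (wt_pos _), mul_assoc, fourthDeriv_X_mul, thirdDeriv_X_mul,
      thirdDeriv_X_mul, secondDeriv_comm (t, 0) (r, 0)]
    simp only [ite_and, smul_eq_mul]
    split_ifs <;> ring

/-- Each quadratic generator is the only one on which its functional does not vanish. -/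
theorem quadraticFunctional_generator_ne_zero_iff {n : ℕ} {p r p' r' : Set.Icc 2 n} {m m' : ℕ}
    (hpr : p ≤ r) (hm : p = r → Even m) (hpr' : p' ≤ r') :
    quadraticFunctional p r m ((m'.factorial : ℂ) • (X (p', 0) * X (r', m'))) ≠ 0 ↔
      p' = p ∧ r' = r ∧ m' = m := by
  have hfac : (m.factorial : ℂ) ≠ 0 := Nat.cast_ne_zero.2 m.factorial_ne_zero
  rw [map_smul, quadraticFunctional_X_mul_X, smul_eq_mul]
  by_cases hmm : m' = m
  swap
  · simp [hmm]
  subst hmm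
  by_cases h : p' = p ∧ r' = r
  · obtain ⟨rfl, rfl⟩ := h
    by_cases h : p' = r'
    · subst h
      simp [(hm rfl).neg_one_pow, hfac]
    · simp [h, hfac]
  · have h' : ¬ (p' = r ∧ r' = p) := by
      rintro ⟨rfl, rfl⟩
      have := le_antisymm hpr hpr'
      exact h ⟨this.symm, this⟩
    simp only [h, h', ← and_assoc]
    simp

theorem quadraticFunctional_X {n : ℕ} {p r i : Set.Icc 2 n} (hp : Odd (p : ℕ)) (hr : Odd (r : ℕ))
    (hi : Even (i : ℕ)) (m : ℕ) : quadraticFunctional p r m (X (i, 0)) = 0 := by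
  rw [← mul_one (X (i, 0))]
  exact quadraticFunctional_X_mul_of_even hp hr m (s := (i, 0)) hi 1

/-- For each generator there is a functional that vanishes on decomposable states and on all other
generators. -/
theorem exists_functional {n : ℕ} (hn : 3 ≤ n) {t : Fock (Set.Icc 2 n)} (ht : t ∈ generators n) :
    ∃ φ : Fock (Set.Icc 2 n) →ₗ[ℂ] ℂ, VanishesOnDecomposables φ ∧ φ t ≠ 0 ∧
      ∀ s ∈ generators n, φ s ≠ 0 → s = t := by
  obtain ⟨i, hi, rfl⟩ | ⟨p, r, m, hp, hr, hpr, hpm, hm, rfl⟩ := mem_generators hn ht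
  · refine ⟨_, vanishesOnDecomposables_firstDeriv hi, ?_, fun s hs hs0 => ?_⟩
    · rw [← mul_one (X (i, 0)), firstDeriv_X_mul, if_pos rfl, map_one]
      exact one_ne_zero
    · obtain ⟨j, -, rfl⟩ | ⟨p, r, m, hp, -, -, -, -, rfl⟩ := mem_generators hn hs
      · rw [← mul_one (X (j, 0)), firstDeriv_X_mul] at hs0
        rw [(ite_ne_right_iff.1 hs0).1]
      · rw [map_smul, firstDeriv_X_mul,
          if_neg (ne_of_even_of_odd (p := (i, 0)) (q := (p, 0)) hi hp).symm, smul_zero] at hs0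
        exact absurd rfl hs0
  · obtain ⟨φ, hφ, hφX, hφXX⟩ : ∃ φ : Fock (Set.Icc 2 n) →ₗ[ℂ] ℂ, VanishesOnDecomposables φ ∧
        (∀ i : Set.Icc 2 n, Even (i : ℕ) → φ (X (i, 0)) = 0) ∧
        ∀ a b, φ (X a * X b) = quadraticFunctional p r m (X a * X b) := by
      obtain hm | ⟨rfl, hp3⟩ := hm
      · exact ⟨_, vanishesOnDecomposables_quadraticFunctional hp hr hm,
          fun i hi => quadraticFunctional_X hp hr hi m, fun _ _ => rfl⟩
      · refine ⟨_, vanishesOnDecomposables_quadraticFunctional_six hp3 hr, fun i hi => ?_,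
          fun a b => ?_⟩
        · rw [LinearMap.sub_apply, quadraticFunctional_X hp hr hi, LinearMap.smul_apply,
            fourthDeriv_X, smul_zero, sub_zero]
        · rw [LinearMap.sub_apply, LinearMap.smul_apply, fourthDeriv_X_mul_X, smul_zero, sub_zero]
    refine ⟨φ, hφ, ?_, fun s hs hs0 => ?_⟩
    · rw [map_smul, hφXX, ← map_smul]
      exact (quadraticFunctional_generator_ne_zero_iff hpr hpm hpr).2 ⟨rfl, rfl, rfl⟩
    · obtain ⟨i, hi, rfl⟩ | ⟨p', r', m', -, -, hpr', -, -, rfl⟩ := mem_generators hn hs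
      · exact absurd (hφX i hi) hs0
      · rw [map_smul, hφXX, ← map_smul] at hs0
        obtain ⟨rfl, rfl, rfl⟩ :=
          (quadraticFunctional_generator_ne_zero_iff hpr hpm hpr').1 hs0
        rfl

end WFree

theorem mainTheorem5 (n : ℕ) (hn : 4 ≤ n) :
    (WFree.orbifold n).IsMinimalStrongGeneratingSet (WFree.generators n) := by
  have h3 : 3 ≤ n := by lia
  refine ⟨WFree.isStrongGeneratingSet_generators h3, fun S hS hSn t ht => ?_⟩
  obtain ⟨φ, hφ, hφt, hφs⟩ := WFree.exists_functional h3 ht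
  exact WFree.mem_of_vanishesOnDecomposables h3 hS hSn ht hφ hφt hφs
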